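/- Let $0\le K<M$, $T\ge 1$, and let $\theta\mapsto A_\theta\in\mathbb C^{M\times K}$, $\theta\in\mathbb R^L$, have partial derivatives $A'_{\theta_k}=\partial A_\theta/\partial\theta_k$ at the point $\theta$ considered, where $A_\theta$ has full column rank $K$. Put $\Pi^\perp_{B}=I-B(B^HB)^{-1}B^H$. Let $g:(0,\infty)\to[0,\infty)$ be differentiable with $\delta=\int_0^\infty t^{M-1}g(t)\,dt\in(0,\infty)$, let $\varphi=g'/g$, let $Q$ have density $\delta^{-1}t^{M-1}g(t)$ on $(0,\infty)$, assume $\mathrm E[Q^2\varphi(Q)^2]<\infty$, and put $\xi_2=\mathrm E[Q^2\varphi(Q)^2]/(M(M+1))$ and $c=\Gamma(M)/(\pi^M\delta)$. We observe $T$ independent copies of a random vector $z\in\mathbb C^M$. A star denotes entrywise complex conjugation. **Circular case.** $z$ has the density $c\,|\Sigma|^{-1}g(z^H\Sigma^{-1}z)$ with $\Sigma=A_\theta R_sA_\theta^H+\sigma^2I$, $\sigma^2>0$. The parameter of interest is $\theta$; the nuisance parameters are $\sigma^2$ and the $K^2$ real coordinates, in any fixed basis, of the Hermitian matrix $R_s$,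 whose true value is positive semidefinite. **Noncircular case.** With $\tilde z=(z^T,z^H)^T$, $z$ has the density $c\,|\tilde\Gamma|^{-1/2}g(\tfrac12\tilde z^H\tilde\Gamma^{-1}\tilde z)$ with $\tilde\Gamma=\tilde A_\theta R_{\tilde s}\tilde A_\theta^H+\sigma^2I$, $\sigma^2>0$, $\tilde A_\theta=\mathrm{diag}(A_\theta,A_\theta^*)$, $R_{\tilde s}=\begin{pmatrix}R_s&\Omega_s\\ \Omega_s^*&R_s^*\end{pmatrix}$. The nuisance parameters are $\sigma^2$ and the real coordinates, in any fixed bases, of the Hermitian matrix $R_s$ and of the complex symmetric matrix $\Omega_s$; the true $R_{\tilde s}$ is positive semidefinite. In each case let $J$ be the Fisher information matrix of all parameters based on the $T$ observations, with entries $J_{ij}=\mathrm E[\partial_i\log p\;\partial_j\log p]$, where $p$ is the joint density. Define $F\in\mathbb R^{L\times L}$ by $$F_{kl}=\frac{2\xi_2}{\sigma^2}\,\mathrm{Re}\,\mathrm{tr}\!\left(\Pi^\perp_{A_\theta}A'_{\theta_l}\,H\,A'^{\,H}_{\theta_k}\right),$$ where in the circular case $$H=R_sA_\theta^H\Sigma^{-1}A_\theta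 R_s,$$ and in the noncircular case $$H=\begin{pmatrix}R_sA_\theta^H&\Omega_sA_\theta^T\end{pmatrix}\tilde\Gamma^{-1}\begin{pmatrix}A_\theta R_s\\ A_\theta^*\Omega_s^*\end{pmatrix}.$$ Then in each case the scores exist almost surely and have finite second moments, the nuisance block of $J$ is nonsingular, and $$\frac1T\left[J_{\theta\theta}-J_{\theta\eta}J_{\eta\eta}^{-1}J_{\eta\theta}\right]_{kl}=F_{kl},$$ where $\eta$ denotes the nuisance parameters. The matrix $J$ is nonsingular if and only if $F$ is. If it is, then the stochastic Cramér–Rao bound on $\theta$, that is, $\mathrm{SCRB}(\theta)=[J^{-1}]_{\theta\theta}$, is nonsingular and $$\frac1T\left[\mathrm{SCRB}^{-1}(\theta)\right]_{kl}=F_{kl}.$$ In the noncircular case, moreover, with $\tilde A'_{\theta_k}=\mathrm{diag}(A'_{\theta_k},A'^{*}_{\theta_k})$, $$F_{kl}=\frac{\xi_2}{\sigma^2}\,\mathrm{Re}\,\mathrm{tr}\!\left(\Pi^\perp_{\tilde A_\theta}\tilde A'_{\theta_l}R_{\tilde s}\tilde A_\theta^H\tilde\Gamma^{-1}\tilde A_\theta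 R_{\tilde s}\tilde A'^{\,H}_{\theta_k}\right).$$ -/

import Mathlib

open scoped Matrix ComplexConjugate ComplexOrder
open MeasureTheory

noncomputable section

/-! ### Fisher information and Cramér–Rao bound of a parametric family of densities -/

/-- The score `∂ log p(x; α) / ∂ α_i` of a family of densities `p`, with respect to the real
parameter vector `α`. -/
def score {ι X : Type*} [DecidableEq ι] (p : (ι → ℝ) → X → ℝ) (α : ι → ℝ) (i : ι) (x : X) : ℝ :=
  lineDeriv ℝ (fun a => Real.log (p a x)) α (Pi.single i 1)

/-- The Fisher information matrix `E[score_i score_j]`, the expectation being under `p(·; α)`. -/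
def fisherInformation {ι X : Type*} [DecidableEq ι] [MeasureSpace X]
    (p : (ι → ℝ) → X → ℝ) (α : ι → ℝ) : Matrix ι ι ℝ :=
  Matrix.of fun i j => ∫ x, score p α i x * score p α j x * p α x

/-- The Fisher information at `α` is a genuine one: the scores exist almost surely, and
the products of scores have finite expectation. -/
def FisherRegular {ι X : Type*} [DecidableEq ι] [MeasureSpace X]
    (p : (ι → ℝ) → X → ℝ) (α : ι → ℝ) : Prop :=
  (∀ i, ∀ᵐ x : X, p α x ≠ 0 →
    LineDifferentiableAt ℝ (fun a => Real.log (p a x)) α (Pi.single i 1)) ∧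
  ∀ i j, Integrable fun x : X => score p α i x * score p α j x * p α x

/-- The Cramér–Rao bound on the first group of parameters (the parameter of interest), the
second group being unknown nuisance parameters: the corresponding block of the inverse of the
Fisher information matrix of all parameters. -/
def crbBlock {ι ν : Type*} [Fintype ι] [Fintype ν] [DecidableEq ι] [DecidableEq ν]
    (J : Matrix (ι ⊕ ν) (ι ⊕ ν) ℝ) : Matrix ι ι ℝ :=
  (J⁻¹).toBlocks₁₁

/-- The information on the first group of parameters that is left once the second group is
unknown (Schur complement of the nuisance block). It is the inverse of `crbBlock J` when `J` is
nonsingular, and is still meaningful when only the nuisance block is nonsingular. -/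
def efficientInformation {ι ν : Type*} [Fintype ν] [DecidableEq ν]
    (J : Matrix (ι ⊕ ν) (ι ⊕ ν) ℝ) : Matrix ι ι ℝ :=
  J.toBlocks₁₁ - J.toBlocks₁₂ * J.toBlocks₂₂⁻¹ * J.toBlocks₂₁

/-- The joint density of `T` independent observations with common density `p α`. -/
def iidDensity {ι X : Type*} (T : ℕ) (p : (ι → ℝ) → X → ℝ) (α : ι → ℝ) (z : Fin T → X) : ℝ :=
  ∏ t, p α (z t)

/-! ### Complex elliptically symmetric distributions on `ℂ^M` -/

/-- `δ_{M,g} = ∫₀^∞ t^{M-1} g(t) dt` (used for `M ≥ 1`). -/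
def genMoment (M : ℕ) (g : ℝ → ℝ) : ℝ := ∫ t in Set.Ioi (0 : ℝ), t ^ (M - 1) * g t

/-- Differentiable density generators on `ℂ^M`; only the values of `g` on `(0, ∞)` matter. -/
structure IsDensityGenerator (M : ℕ) (g : ℝ → ℝ) : Prop where
  nonneg : ∀ t, 0 < t → 0 ≤ g t
  differentiable : ∀ t, 0 < t → DifferentiableAt ℝ g t
  integrable : IntegrableOn (fun t => t ^ (M - 1) * g t) (Set.Ioi 0)
  genMoment_pos : 0 < genMoment M g

/-- `c_{M,g} = 2 / (s_M δ_{M,g})`, where `s_M = 2 π^M / Γ(M)` is the area of the unit sphere of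
`ℂ^M`. -/
def cesConst (M : ℕ) (g : ℝ → ℝ) : ℝ :=
  2 / ((2 * Real.pi ^ M / Real.Gamma M) * genMoment M g)

/-- Circular CES density with zero mean and scatter matrix `S`:
`c_{M,g} |S|⁻¹ g(zᴴ S⁻¹ z)`. -/
def circularCESDensity {M : ℕ} (g : ℝ → ℝ) (S : Matrix (Fin M) (Fin M) ℂ) (z : Fin M → ℂ) : ℝ :=
  cesConst M g * (S.det.re)⁻¹ * g ((star z ⬝ᵥ (S⁻¹ *ᵥ z)).re)

/-- The augmented vector `z̃ = (zᵀ, zᴴ)ᵀ`. -/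
def augVec {M : ℕ} (z : Fin M → ℂ) : Fin M ⊕ Fin M → ℂ := Sum.elim z (star z)

/-- The augmented matrix `[[B, C], [C*, B*]]`, the star being entrywise conjugation. -/
def augMat {m n : Type*} (B C : Matrix m n ℂ) : Matrix (m ⊕ m) (n ⊕ n) ℂ :=
  Matrix.fromBlocks B C (C.map conj) (B.map conj)

/-- Noncircular CES density with zero mean and augmented scatter matrix `G`:
`c_{M,g} |G|^{-1/2} g(½ z̃ᴴ G⁻¹ z̃)`. -/
def noncircularCESDensity {M : ℕ} (g : ℝ → ℝ) (G : Matrix (Fin M ⊕ Fin M) (Fin M ⊕ Fin M) ℂ)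
    (z : Fin M → ℂ) : ℝ :=
  cesConst M g * (Real.sqrt G.det.re)⁻¹ *
    g (1 / 2 * (star (augVec z) ⬝ᵥ (G⁻¹ *ᵥ augVec z)).re)

/-- `φ = g' / g`. -/
def logDerivGen (g : ℝ → ℝ) (t : ℝ) : ℝ := deriv g t / g t

/-- `E[Q² φ(Q)²] < ∞`, where `Q` has density `δ_{M,g}⁻¹ t^{M-1} g(t)` on `(0, ∞)`. -/
def FiniteXi₂ (M : ℕ) (g : ℝ → ℝ) : Prop :=
  IntegrableOn (fun t => t ^ 2 * logDerivGen g t ^ 2 * ((genMoment M g)⁻¹ * (t ^ (M - 1) * g t)))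
    (Set.Ioi 0)

/-- `ξ₂ = E[Q² φ(Q)²] / (M (M + 1))`, where `Q` has density `δ_{M,g}⁻¹ t^{M-1} g(t)` on
`(0, ∞)`. -/
def xi₂ (M : ℕ) (g : ℝ → ℝ) : ℝ :=
  (∫ t in Set.Ioi (0 : ℝ),
    t ^ 2 * logDerivGen g t ^ 2 * ((genMoment M g)⁻¹ * (t ^ (M - 1) * g t))) / (M * (M + 1))

/-! ### The noisy linear mixture -/

/-- The real vector space of complex symmetric matrices. -/
def symmetricMatrices (K : ℕ) : Submodule ℝ (Matrix (Fin K) (Fin K) ℂ) where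
  carrier := {C | Cᵀ = C}
  add_mem' := by
    intro C D hC hD
    simp only [Set.mem_ofPred_eq] at *
    rw [Matrix.transpose_add, hC, hD]
  zero_mem' := by simp
  smul_mem' := by
    intro c C hC
    simp only [Set.mem_ofPred_eq] at *
    rw [Matrix.transpose_smul, hC]

/-- The Hermitian matrix `R_s` with real coordinate vector `ρ` in the basis `b`. -/
def hermitianOf {K : ℕ} {κ : Type*} [Fintype κ]
    (b : Module.Basis κ ℝ (selfAdjoint (Matrix (Fin K) (Fin K) ℂ))) (ρ : κ → ℝ) :
    Matrix (Fin K) (Fin K) ℂ :=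
  ((∑ a, ρ a • b a : selfAdjoint (Matrix (Fin K) (Fin K) ℂ)) : Matrix (Fin K) (Fin K) ℂ)

/-- The complex symmetric matrix with real coordinate vector `ρ` in the basis `c`. -/
def symmetricOf {K : ℕ} {κ : Type*} [Fintype κ]
    (c : Module.Basis κ ℝ (symmetricMatrices K)) (ρ : κ → ℝ) : Matrix (Fin K) (Fin K) ℂ :=
  ((∑ a, ρ a • c a : symmetricMatrices K) : Matrix (Fin K) (Fin K) ℂ)

/-- `B R Bᴴ + s I`. This is `Σ` for `B = A_θ`, `R = R_s`, `s = σ²`, and `Γ̃` for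
`B = diag(A_θ, A_θ*)` and `R` the augmented source scatter matrix. -/
def mixtureScatter {m n : Type*} [Fintype n] [DecidableEq m]
    (B : Matrix m n ℂ) (R : Matrix n n ℂ) (s : ℝ) : Matrix m m ℂ :=
  B * R * Bᴴ + (s : ℂ) • (1 : Matrix m m ℂ)

/-- `Π⊥_B = I - B (Bᴴ B)⁻¹ Bᴴ`, for `B` of full column rank. -/
def projPerp {m n : Type*} [Fintype m] [Fintype n] [DecidableEq m] [DecidableEq n]
    (B : Matrix m n ℂ) : Matrix m m ℂ :=
  1 - B * (Bᴴ * B)⁻¹ * Bᴴ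

/-- The entrywise partial derivative `∂ A_θ / ∂ θ_k`. -/
def partialMat {L M K : ℕ} (A : (Fin L → ℝ) → Matrix (Fin M) (Fin K) ℂ) (θ : Fin L → ℝ)
    (k : Fin L) : Matrix (Fin M) (Fin K) ℂ :=
  Matrix.of fun i j => lineDeriv ℝ (fun a => A a i j) θ (Pi.single k 1)

/-- Circular CES mixture: the density of one observation as a function of the parameters
`(θ, ρ, σ²)`, where `ρ` are the real coordinates of `R_s`. -/
def circularModel {L M K : ℕ} {κ : Type*} [Fintype κ] (g : ℝ → ℝ)
    (A : (Fin L → ℝ) → Matrix (Fin M) (Fin K) ℂ)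
    (b : Module.Basis κ ℝ (selfAdjoint (Matrix (Fin K) (Fin K) ℂ)))
    (α : Fin L ⊕ (κ ⊕ Unit) → ℝ) (z : Fin M → ℂ) : ℝ :=
  circularCESDensity g
    (mixtureScatter (A fun k => α (.inl k)) (hermitianOf b fun a => α (.inr (.inl a)))
      (α (.inr (.inr ())))) z

/-- Noncircular CES mixture: the density of one observation as a function of the parameters
`(θ, ρ, ρ', σ²)`, where `ρ` and `ρ'` are the real coordinates of the scatter matrix `R_s` and of
the pseudo-scatter matrix `Ω_s` of the sources. -/
def noncircularModel {L M K : ℕ} {κ κ' : Type*} [Fintype κ] [Fintype κ'] (g : ℝ → ℝ)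
    (A : (Fin L → ℝ) → Matrix (Fin M) (Fin K) ℂ)
    (b : Module.Basis κ ℝ (selfAdjoint (Matrix (Fin K) (Fin K) ℂ)))
    (c : Module.Basis κ' ℝ (symmetricMatrices K))
    (α : Fin L ⊕ ((κ ⊕ κ') ⊕ Unit) → ℝ) (z : Fin M → ℂ) : ℝ :=
  noncircularCESDensity g
    (mixtureScatter (augMat (A fun k => α (.inl k)) 0)
      (augMat (hermitianOf b fun a => α (.inr (.inl (.inl a))))
        (symmetricOf c fun a => α (.inr (.inl (.inr a)))))
      (α (.inr (.inr ())))) z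

end

/-! Both models are elliptical laws on `ℝ^(2M)`. In the coordinates `(Re z, Im z)` an augmented
scatter matrix becomes a real symmetric matrix `P`, up to a similarity that preserves traces and
determinants (`realMatrix`), and a circular law is the noncircular law with augmented matrix
`diag(Σ, Σ*)`. Writing `P = L Lᵀ` and `x = L w` makes the law spherical. The score in the direction
`D` is then a constant minus `φ(|w|²) wᵀHw` with `H = L⁻¹ D L⁻ᵀ`, so second and fourth moments of
spherical laws, together with `E[Qφ(Q)] = -M`, give the Fisher information of one observation
(`integral_ellipticScore_mul`, `fisherInformation_scatter`). It is a bilinear form on tangent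
scatter matrices, `a Re tr(G⁻¹XG⁻¹Y) + b Re tr(G⁻¹X) Re tr(G⁻¹Y)`, called `infoForm`. Scores have
mean zero, so `T` independent observations multiply it by `T`.

On Hermitian matrices of order `m` this form is positive definite as soon as `a > 0` and `a + bm >
0`. In both cases the latter amounts to `(M+1)ξ₂ > M`, the strict Cauchy–Schwarz inequality `E[Q²φ²]
> M²` (`lt_succ_mul_xi₂`). Since `K < M`, the nuisance directions `B E Bᴴ` and `I` are linearly
independent, so the nuisance block is nonsingular.

The Schur complement is the Gram matrix of the components of the `θ`-tangents orthogonal to the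
nuisance tangent space (`efficientInformation_eq`). With `C = B'R`, the tangent `CBᴴ + BCᴴ` splits
into `Π⊥CBᴴ + BCᴴΠ⊥` and a term `B Z Bᴴ` with `Z` Hermitian (`tangent_eq`). Because `G⁻¹Π⊥ = s⁻¹Π⊥`
and `Bᴴ Π⊥ = 0`, the first part is orthogonal to every `B E Bᴴ` and to `I`, and its weighted trace
is zero. Hence `b` drops out and the Gram matrix is the stated trace formula
(`infoForm_perpTangent`). The claims on the Cramér–Rao bound are block inversion, and the two
noncircular expressions agree because the trace of an augmented matrix has twice the real part of
the trace of its first block. -/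

/-! ### Calculus on the half-line -/

/-- The substitution `t = exp s` moves the half-line to `ℝ`, where integrability alone disposes of
the boundary terms at both ends. -/
theorem integrableOn_Ioi_iff_integrable_exp (f : ℝ → ℝ) :
    IntegrableOn f (Set.Ioi 0) ↔ Integrable fun s => Real.exp s * f (Real.exp s) := by
  have h := integrableOn_image_iff_integrableOn_abs_deriv_smul (s := Set.univ) (f := Real.exp)
    (f' := Real.exp) MeasurableSet.univ (fun x _ => (Real.hasDerivAt_exp x).hasDerivWithinAt)
    Real.exp_injective.injOn f
  simpa [Set.image_univ, Real.range_exp, abs_of_pos (Real.exp_pos _)] using h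

theorem integral_Ioi_eq_integral_exp (f : ℝ → ℝ) :
    ∫ t in Set.Ioi 0, f t = ∫ s, Real.exp s * f (Real.exp s) := by
  have h := integral_image_eq_integral_abs_deriv_smul (s := Set.univ) (f := Real.exp)
    (f' := Real.exp) MeasurableSet.univ (fun x _ => (Real.hasDerivAt_exp x).hasDerivWithinAt)
    Real.exp_injective.injOn f
  simpa [Set.image_univ, Real.range_exp, abs_of_pos (Real.exp_pos _)] using h

/-- If `f'` and `f(t)/t` are integrable on `(0, ∞)`, then `f'` integrates to zero. -/
theorem integral_Ioi_deriv_eq_zero {f f' : ℝ → ℝ} (hf : ∀ t, 0 < t → HasDerivAt f (f' t) t)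
    (h1 : IntegrableOn f' (Set.Ioi 0)) (h2 : IntegrableOn (fun t => t⁻¹ * f t) (Set.Ioi 0)) :
    ∫ t in Set.Ioi 0, f' t = 0 := by
  rw [integrableOn_Ioi_iff_integrable_exp] at h1 h2
  rw [integral_Ioi_eq_integral_exp]
  -- On the whole line it suffices that a function and its derivative are integrable; for `f ∘ exp`
  -- these are exactly `h2` and `h1`.
  refine integral_eq_zero_of_hasDerivAt_of_integrable (f := fun s => f (Real.exp s)) (fun s => ?_)
    h1 ?_
  · rw [mul_comm]
    exact (hf _ (Real.exp_pos s)).comp s (Real.hasDerivAt_exp s)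
  · refine h2.congr (Filter.Eventually.of_forall fun s => ?_)
    simp [(Real.exp_pos s).ne']

/-- If `f' = 0` almost everywhere on `(0, ∞)` and `f(t)/t` is integrable, then `f = 0`. -/
theorem eq_zero_of_deriv_ae_zero {f f' : ℝ → ℝ} (hf : ∀ t, 0 < t → HasDerivAt f (f' t) t)
    (h1 : ∀ᵐ t ∂volume.restrict (Set.Ioi (0 : ℝ)), f' t = 0)
    (h2 : IntegrableOn (fun t => t⁻¹ * f t) (Set.Ioi 0)) (t : ℝ) (ht : 0 < t) : f t = 0 := by
  have hconst : ∀ a, 0 < a → f a = f 1 := by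
    intro a ha
    have hsub : Set.uIcc 1 a ⊆ Set.Ioi 0 := fun x hx => by
      have := hx.1
      exact lt_of_lt_of_le (lt_min one_pos ha) this
    have hae : ∀ᵐ x, x ∈ Set.uIoc 1 a → f' x = 0 := by
      have := (ae_restrict_iff' measurableSet_Ioi).1 h1
      filter_upwards [this] with x hx hxa
      exact hx (hsub (Set.uIoc_subset_uIcc hxa))
    have hint : IntervalIntegrable f' volume 1 a := by
      rw [intervalIntegrable_iff]
      refine (integrableOn_zero).congr ?_
      rw [Filter.EventuallyEq, ae_restrict_iff' measurableSet_uIoc]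
      filter_upwards [hae] with x hx hxa using (hx hxa).symm
    have := intervalIntegral.integral_eq_sub_of_hasDerivAt
      (fun x hx => hf x (hsub hx)) hint
    rw [intervalIntegral.integral_zero_ae hae] at this
    linarith
  rw [hconst t ht]
  by_contra hne
  -- A nonzero constant value of `f` would make `1/t` integrable on `(0, ∞)`.
  have h3 : IntegrableOn (fun t : ℝ => t⁻¹) (Set.Ioi 0) := by
    have := h2.mul_const (f 1)⁻¹
    refine (integrableOn_congr_fun (fun x hx => ?_) measurableSet_Ioi).1 this
    simp only [hconst x hx]
    field_simp
  exact not_integrableOn_Ioi_inv h3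

/-! ### Radial moments of the density generator -/

section Generator

variable {M : ℕ} {g : ℝ → ℝ}

/-- A zero of the nonnegative `g` is a minimum. This is why `φ g = g'` survives the convention `x /
0 = 0`, so that `g` may vanish on part of the half-line. -/
theorem IsDensityGenerator.deriv_eq_zero (hg : IsDensityGenerator M g) {t : ℝ} (ht : 0 < t)
    (h0 : g t = 0) : deriv g t = 0 := by
  refine IsLocalMin.deriv_eq_zero ?_
  filter_upwards [lt_mem_nhds ht] with s hs
  rw [h0]; exact hg.nonneg s hs

theorem IsDensityGenerator.logDerivGen_mul (hg : IsDensityGenerator M g) {t : ℝ} (ht : 0 < t) :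
    logDerivGen g t * g t = deriv g t := by
  unfold logDerivGen
  by_cases h0 : g t = 0
  · simp [h0, hg.deriv_eq_zero ht h0]
  · field_simp

theorem FiniteXi₂.integrableOn (hg : IsDensityGenerator M g) (hξ : FiniteXi₂ M g) :
    IntegrableOn (fun t => t ^ (M - 1) * (t ^ 2 * (logDerivGen g t ^ 2 * g t))) (Set.Ioi 0) := by
  have := hξ.const_mul (genMoment M g)
  refine this.congr (Filter.Eventually.of_forall fun t => ?_)
  have := hg.genMoment_pos.ne'
  simp only
  field_simp

theorem integral_sq_logDerivGen (hM : 0 < M) (hg : IsDensityGenerator M g) :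
    ∫ t in Set.Ioi 0, t ^ (M - 1) * (t ^ 2 * (logDerivGen g t ^ 2 * g t)) =
      M * (M + 1) * xi₂ M g * genMoment M g := by
  have h0 := hg.genMoment_pos.ne'
  have hM' : (M : ℝ) ≠ 0 := by positivity
  unfold xi₂
  rw [mul_div_cancel₀ _ (by positivity), mul_comm, ← integral_const_mul]
  congr 1
  ext t
  field_simp

/-- The bound `|x| ≤ 1 + x²` with `x = tφ(t)` dominates the first moment by the zeroth and the
second. -/
theorem integrableOn_deriv_generator (hg : IsDensityGenerator M g) (hξ : FiniteXi₂ M g) :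
    IntegrableOn (fun t => t ^ (M - 1) * (t * (logDerivGen g t * g t))) (Set.Ioi 0) := by
  refine (hg.integrable.add (hξ.integrableOn hg)).mono' ?_ ?_
  -- Measurability is read off from `g'`, since `deriv` of any function is measurable while `g`
  -- itself is unconstrained outside `(0, ∞)`.
  · have hm : AEStronglyMeasurable (fun t : ℝ => t ^ (M - 1) * (t * deriv g t))
        (volume.restrict (Set.Ioi 0)) := by
      have := measurable_deriv g
      exact Measurable.aestronglyMeasurable (by fun_prop)
    refine hm.congr ?_
    filter_upwards [ae_restrict_mem measurableSet_Ioi] with t ht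
    rw [hg.logDerivGen_mul ht]
  · filter_upwards [ae_restrict_mem measurableSet_Ioi] with t (ht : 0 < t)
    have hgt := hg.nonneg t ht
    have h1 : |t * logDerivGen g t| ≤ 1 + (t * logDerivGen g t) ^ 2 := by
      rw [abs_le]; constructor <;> nlinarith [sq_nonneg (t * logDerivGen g t - 1),
      sq_nonneg (t * logDerivGen g t + 1)]
    have h2 : 0 ≤ t ^ (M - 1) * g t := by positivity
    calc ‖t ^ (M - 1) * (t * (logDerivGen g t * g t))‖
        = (t ^ (M - 1) * g t) * |t * logDerivGen g t| := by
          rw [show t ^ (M - 1) * (t * (logDerivGen g t * g t)) =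
            (t ^ (M - 1) * g t) * (t * logDerivGen g t) by ring, norm_mul, Real.norm_eq_abs,
            Real.norm_eq_abs, abs_of_nonneg h2]
      _ ≤ (t ^ (M - 1) * g t) * (1 + (t * logDerivGen g t) ^ 2) := by gcongr
      _ = _ := by simp only [Pi.add_apply]; ring

theorem hasDerivAt_pow_mul_generator (hM : 0 < M) (hg : IsDensityGenerator M g) {t : ℝ}
    (ht : 0 < t) : HasDerivAt (fun t => t ^ M * g t)
      (M * (t ^ (M - 1) * g t) + t ^ (M - 1) * (t * (logDerivGen g t * g t))) t := by
  have := (hasDerivAt_pow M t).mul (hg.differentiable t ht).hasDerivAt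
  refine this.congr_deriv ?_
  rw [hg.logDerivGen_mul ht]
  obtain ⟨m, rfl⟩ : ∃ m, M = m + 1 := ⟨M - 1, by omega⟩
  simp only [Nat.add_sub_cancel, pow_succ]
  ring

theorem integrableOn_inv_mul_generator (hM : 0 < M) (hg : IsDensityGenerator M g) :
    IntegrableOn (fun t => t⁻¹ * (t ^ M * g t)) (Set.Ioi 0) := by
  refine (integrableOn_congr_fun (fun t (ht : 0 < t) => ?_) measurableSet_Ioi).1 hg.integrable
  obtain ⟨m, rfl⟩ : ∃ m, M = m + 1 := ⟨M - 1, by omega⟩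
  simp only [Nat.add_sub_cancel, pow_succ]
  field_simp

/-- `E[Q φ(Q)] = -M`. -/
theorem integral_deriv_generator (hM : 0 < M) (hg : IsDensityGenerator M g)
    (hξ : FiniteXi₂ M g) :
    ∫ t in Set.Ioi 0, t ^ (M - 1) * (t * (logDerivGen g t * g t)) = -M * genMoment M g := by
  have h1 := hg.integrable.const_mul (M : ℝ)
  have h2 := integrableOn_deriv_generator hg hξ
  have := integral_Ioi_deriv_eq_zero (fun t ht => hasDerivAt_pow_mul_generator hM hg ht)
    (h1.add h2) (integrableOn_inv_mul_generator hM hg)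
  rw [integral_add h1 h2, integral_const_mul] at this
  unfold genMoment
  linarith

/-- `E[Q² φ(Q)²] > M²`. -/
theorem lt_succ_mul_xi₂ (hM : 0 < M) (hg : IsDensityGenerator M g) (hξ : FiniteXi₂ M g) :
    (M : ℝ) < (M + 1) * xi₂ M g := by
  have hMr : (0 : ℝ) < M := by exact_mod_cast hM
  have h0 := hg.integrable.const_mul ((M : ℝ) ^ 2)
  have h1 := (integrableOn_deriv_generator hg hξ).const_mul (2 * (M : ℝ))
  have h2 := hξ.integrableOn hg
  have hsum := (h2.add h1).add h0
  -- Up to the factor `genMoment`, this is the variance of `Qφ(Q)`, whose mean is `-M`.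
  have hI : ∫ t in Set.Ioi 0, t ^ (M - 1) * (g t * (t * logDerivGen g t + M) ^ 2) =
      M * genMoment M g * ((M + 1) * xi₂ M g - M) := by
    have e : ∀ t : ℝ, t ^ (M - 1) * (g t * (t * logDerivGen g t + M) ^ 2) =
      (t ^ (M - 1) * (t ^ 2 * (logDerivGen g t ^ 2 * g t)) +
        2 * M * (t ^ (M - 1) * (t * (logDerivGen g t * g t)))) +
        M ^ 2 * (t ^ (M - 1) * g t) := fun t => by ring
    simp_rw [e]
    rw [integral_add (by exact h2.add h1) h0, integral_add h2 h1, integral_const_mul, integral_const_mul,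
      integral_sq_logDerivGen hM hg, integral_deriv_generator hM hg hξ]
    change _ + _ + _ * genMoment M g = _
    ring
  have hnn : ∀ᵐ t ∂volume.restrict (Set.Ioi (0 : ℝ)),
      0 ≤ t ^ (M - 1) * (g t * (t * logDerivGen g t + M) ^ 2) := by
    filter_upwards [ae_restrict_mem measurableSet_Ioi] with t (ht : 0 < t)
    have := hg.nonneg t ht
    positivity
  have hδ := hg.genMoment_pos
  by_contra hle
  have hle' : M * genMoment M g * ((M + 1) * xi₂ M g - M) ≤ 0 :=
    mul_nonpos_of_nonneg_of_nonpos (by positivity) (by linarith)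
  have hz := le_antisymm (hI.trans_le hle') (integral_nonneg_of_ae hnn)
  rw [integral_eq_zero_iff_of_nonneg_ae hnn] at hz
  -- Zero variance would force `(t^M g)' = 0` almost everywhere, hence `t^M g = 0`, against the
  -- positivity of `genMoment`.
  · have hae : ∀ᵐ t ∂volume.restrict (Set.Ioi (0 : ℝ)),
        M * (t ^ (M - 1) * g t) + t ^ (M - 1) * (t * (logDerivGen g t * g t)) = 0 := by
      filter_upwards [hz, ae_restrict_mem measurableSet_Ioi] with t h (ht : 0 < t)
      have : g t = 0 ∨ t * logDerivGen g t + M = 0 := by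
        simpa [ht.ne'] using h
      rcases this with h | h
      · simp [h]
      · linear_combination t ^ (M - 1) * g t * h
    have hzero := eq_zero_of_deriv_ae_zero
      (fun t ht => hasDerivAt_pow_mul_generator hM hg ht) hae (integrableOn_inv_mul_generator hM hg)
    have : genMoment M g = 0 := by
      unfold genMoment
      refine setIntegral_eq_zero_of_forall_eq_zero fun t (ht : 0 < t) => ?_
      have := hzero t ht
      have : g t = 0 := by simpa [ht.ne'] using this
      simp [this]
    exact hδ.ne' this
  · refine hsum.congr (Filter.Eventually.of_forall fun t => ?_)
    simp only [Pi.add_apply]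
    ring

end Generator

/-! ### Polar coordinates in dimension `2M` -/

section Radial

variable {ι : Type*} [Fintype ι]

theorem norm_sq_eq_dotProduct_ofLp (x : EuclideanSpace ℝ ι) :
    x.ofLp ⬝ᵥ x.ofLp = ‖x‖ ^ 2 := by
  rw [EuclideanSpace.real_norm_sq_eq]
  simp [dotProduct, sq]

/-- Polar coordinates produce the weight `r^(2M-1)`, which `t = r²` turns into `t^(M-1)` up to a
constant. -/
theorem integrable_dotProduct_self_iff {M : ℕ} (hM : 0 < M) (hι : Fintype.card ι = 2 * M)
    (h : ℝ → ℝ) : Integrable (fun w : ι → ℝ => h (w ⬝ᵥ w)) ↔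
      IntegrableOn (fun t => t ^ (M - 1) * h t) (Set.Ioi 0) := by
  have hne : Nonempty ι := Fintype.card_pos_iff.1 (by omega)
  have e1 := (EuclideanSpace.volume_preserving_symm_measurableEquiv_toLp ι).integrable_comp_emb
    (MeasurableEquiv.measurableEmbedding _) (g := fun w : ι → ℝ => h (w ⬝ᵥ w))
  rw [← e1]
  have e2 : ((fun w : ι → ℝ => h (w ⬝ᵥ w)) ∘ (MeasurableEquiv.toLp 2 (ι → ℝ)).symm) =
      fun x : EuclideanSpace ℝ ι => (fun r => h (r ^ 2)) ‖x‖ := by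
    ext x; simp only [Function.comp]; rw [← norm_sq_eq_dotProduct_ofLp]; rfl
  rw [e2]
  refine (integrable_fun_norm_addHaar (volume : Measure (EuclideanSpace ℝ ι))
    (f := fun r => h (r ^ 2))).trans ?_
  rw [finrank_euclideanSpace, hι, ← integrableOn_Ioi_comp_rpow_iff' (fun t => t ^ (M - 1) * h t) (two_ne_zero)]
  refine integrableOn_congr_fun (fun r (hr : 0 < r) => ?_) measurableSet_Ioi
  obtain ⟨m, rfl⟩ : ∃ m, M = m + 1 := ⟨M - 1, by omega⟩
  simp only [smul_eq_mul, show 2 * (m + 1) - 1 = 2 * m + 1 by omega, Nat.add_sub_cancel,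
    Real.rpow_two, show (2 : ℝ) - 1 = 1 by norm_num, Real.rpow_one]
  ring

/-- The constant is the dimension `2M` times the ball volume `π^M / M!` times the `1/2` of the
substitution `t = r²`. -/
theorem integral_dotProduct_self {M : ℕ} (hM : 0 < M) (hι : Fintype.card ι = 2 * M)
    (h : ℝ → ℝ) : ∫ w : ι → ℝ, h (w ⬝ᵥ w) =
      Real.pi ^ M / Real.Gamma M * ∫ t in Set.Ioi 0, t ^ (M - 1) * h t := by
  have hne : Nonempty ι := Fintype.card_pos_iff.1 (by omega)
  have e1 := (EuclideanSpace.volume_preserving_symm_measurableEquiv_toLp ι).integral_comp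
    (MeasurableEquiv.measurableEmbedding _) (fun w : ι → ℝ => h (w ⬝ᵥ w))
  rw [← e1]
  have e2 : ∀ x : EuclideanSpace ℝ ι, h ((MeasurableEquiv.toLp 2 (ι → ℝ)).symm x ⬝ᵥ
      (MeasurableEquiv.toLp 2 (ι → ℝ)).symm x) = (fun r => h (r ^ 2)) ‖x‖ := by
    intro x; simp only; rw [← norm_sq_eq_dotProduct_ofLp]; rfl
  have hdim : Module.finrank ℝ (EuclideanSpace ℝ ι) = 2 * M := by
    rw [finrank_euclideanSpace, hι]
  have hvol : volume.real (Metric.ball (0 : EuclideanSpace ℝ ι) 1) = Real.pi ^ M / (M.factorial) := by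
    rw [measureReal_def, InnerProductSpace.volume_ball_of_dim_even hdim]
    simp only [ENNReal.ofReal_one, one_pow, one_mul]
    exact ENNReal.toReal_ofReal (by positivity)
  simp_rw [e2]
  refine (integral_fun_norm_addHaar (volume : Measure (EuclideanSpace ℝ ι))
    (fun r => h (r ^ 2))).trans ?_
  rw [hdim, hvol, ← integral_comp_rpow_Ioi_of_pos (g := fun t => t ^ (M - 1) * h t) two_pos]
  obtain ⟨m, rfl⟩ : ∃ m, M = m + 1 := ⟨M - 1, by omega⟩
  have e3 : ∫ y in Set.Ioi (0 : ℝ), y ^ (2 * (m + 1) - 1) • h (y ^ 2) =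
      (1 / 2) * ∫ x in Set.Ioi (0 : ℝ), (2 * x ^ ((2 : ℝ) - 1)) •
        ((x ^ (2 : ℝ)) ^ (m + 1 - 1) * h (x ^ (2 : ℝ))) := by
    rw [← integral_const_mul]
    congr 1
    ext r
    simp only [smul_eq_mul, show 2 * (m + 1) - 1 = 2 * m + 1 by omega, Nat.add_sub_cancel,
      Real.rpow_two, show (2 : ℝ) - 1 = 1 by norm_num, Real.rpow_one]
    ring
  rw [e3, Nat.factorial_succ, show ((m + 1 : ℕ) : ℝ) = (m : ℝ) + 1 by push_cast; rfl,
    Real.Gamma_nat_eq_factorial]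
  have : (m.factorial : ℝ) ≠ 0 := by positivity
  simp only [nsmul_eq_mul, smul_eq_mul]
  push_cast
  field_simp

end Radial

/-! ### Linear changes of variables and reflections -/

section LinearChange

variable {ι : Type*} [Fintype ι] [DecidableEq ι]

theorem measurableEmbedding_mulVec {L : Matrix ι ι ℝ} (hL : L.det ≠ 0) :
    MeasurableEmbedding fun w : ι → ℝ => L *ᵥ w := by
  let e := LinearMap.equivOfDetNeZero (Matrix.toLin' L) (by rwa [LinearMap.det_toLin'])
  exact e.toContinuousLinearEquiv.toHomeomorph.measurableEmbedding

theorem map_mulVec_volume {L : Matrix ι ι ℝ} (hL : L.det ≠ 0) :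
    Measure.map (fun w : ι → ℝ => L *ᵥ w) volume = ENNReal.ofReal |L.det|⁻¹ • volume := by
  rw [← abs_inv]
  exact Real.map_matrix_volume_pi_eq_smul_volume_pi hL

theorem integral_comp_mulVec {L : Matrix ι ι ℝ} (hL : L.det ≠ 0) (F : (ι → ℝ) → ℝ) :
    ∫ w, F (L *ᵥ w) = |L.det|⁻¹ * ∫ x, F x := by
  rw [← (measurableEmbedding_mulVec hL).integral_map, map_mulVec_volume hL, integral_smul_measure,
    ENNReal.toReal_ofReal (by positivity), smul_eq_mul]

theorem integrable_comp_mulVec_iff {L : Matrix ι ι ℝ} (hL : L.det ≠ 0) (F : (ι → ℝ) → ℝ) :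
    Integrable (fun w => F (L *ᵥ w)) ↔ Integrable F := by
  have h := (measurableEmbedding_mulVec hL).integrable_map_iff (μ := volume) (g := F)
  rw [map_mulVec_volume hL, integrable_smul_measure (by simpa using hL) (by simp)] at h
  exact h.symm

theorem integral_comp_orthogonal {Q : Matrix ι ι ℝ} (hQ : Qᵀ * Q = 1) (F : (ι → ℝ) → ℝ) :
    ∫ w, F (Q *ᵥ w) = ∫ x, F x := by
  have h : |Q.det| = 1 := by
    have := congrArg Matrix.det hQ
    rw [Matrix.det_mul, Matrix.det_transpose, Matrix.det_one] at this
    rw [← Real.sqrt_mul_self_eq_abs, this, Real.sqrt_one]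
  have h0 : Q.det ≠ 0 := fun h' => by simp [h'] at h
  rw [integral_comp_mulVec h0, h, inv_one, one_mul]

theorem dotProduct_orthogonal {Q : Matrix ι ι ℝ} (hQ : Qᵀ * Q = 1) (w : ι → ℝ) :
    (Q *ᵥ w) ⬝ᵥ (Q *ᵥ w) = w ⬝ᵥ w := by
  rw [Matrix.dotProduct_mulVec, Matrix.vecMul_mulVec, hQ, Matrix.vecMul_one]

theorem reflection_orthogonal (v : ι → ℝ) (hv : v ⬝ᵥ v ≠ 0) :
    (1 - (2 / (v ⬝ᵥ v)) • Matrix.vecMulVec v v)ᵀ * (1 - (2 / (v ⬝ᵥ v)) • Matrix.vecMulVec v v) = 1 := by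
  have h1 : (Matrix.vecMulVec v v)ᵀ = Matrix.vecMulVec v v := by
    ext i j; simp [Matrix.vecMulVec_apply, mul_comm]
  have h2 : Matrix.vecMulVec v v * Matrix.vecMulVec v v = (v ⬝ᵥ v) • Matrix.vecMulVec v v := by
    rw [Matrix.vecMulVec_mul_vecMulVec]
    ext i j; simp [Matrix.vecMulVec_apply]; ring
  rw [Matrix.transpose_sub, Matrix.transpose_smul, Matrix.transpose_one, h1, sub_mul, mul_sub,
    mul_sub, smul_mul_smul_comm, h2, smul_smul, one_mul, mul_one, one_mul]
  have : 2 / v ⬝ᵥ v * (2 / v ⬝ᵥ v) * v ⬝ᵥ v = 2 / v ⬝ᵥ v + 2 / v ⬝ᵥ v := by field_simp; norm_num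
  rw [this, add_smul]
  abel

/-- A radial weight is invariant under the Householder reflection that sends `v` to `-v`. Suitable
choices of `v` give every symmetry needed for the moments of coordinates. -/
theorem integral_radial_comp_reflection (h : ℝ → ℝ) (v : ι → ℝ) (hv : v ⬝ᵥ v ≠ 0)
    (F : (ι → ℝ) → ℝ) :
    ∫ w, h (w ⬝ᵥ w) * F (w - (2 / (v ⬝ᵥ v) * (v ⬝ᵥ w)) • v) = ∫ w, h (w ⬝ᵥ w) * F w := by
  have hQ := reflection_orthogonal v hv
  refine Eq.trans ?_ (integral_comp_orthogonal hQ fun w => h (w ⬝ᵥ w) * F w)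
  congr 1
  ext w
  rw [dotProduct_orthogonal hQ]
  congr 2
  rw [Matrix.sub_mulVec, Matrix.one_mulVec, Matrix.smul_mulVec, Matrix.vecMulVec_mulVec]
  ext i
  simp
  ring

theorem exists_orthogonal_diagonal {H : Matrix ι ι ℝ} (hH : H.IsSymm) :
    ∃ (U : Matrix ι ι ℝ) (d : ι → ℝ), Uᵀ * U = 1 ∧ H = U * Matrix.diagonal d * Uᵀ := by
  have hH' : H.IsHermitian := by
    rw [Matrix.IsHermitian, Matrix.conjTranspose_eq_transpose_of_trivial]; exact hH
  refine ⟨hH'.eigenvectorUnitary, hH'.eigenvalues, ?_, ?_⟩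
  · have := Unitary.coe_star_mul_self hH'.eigenvectorUnitary
    rwa [Matrix.star_eq_conjTranspose, Matrix.conjTranspose_eq_transpose_of_trivial] at this
  · have := hH'.spectral_theorem
    rw [Unitary.conjStarAlgAut_apply, Matrix.star_eq_conjTranspose,
      Matrix.conjTranspose_eq_transpose_of_trivial] at this
    exact this

end LinearChange

/-! ### Second and fourth moments of spherical laws -/

section Moments

variable {ι : Type*} [Fintype ι]

/-- `F / |w|^(2n)` is bounded and measurable, and where the denominator vanishes the bound forces `F
= 0`, so the division loses nothing. -/
theorem Integrable.radial_mul {h : ℝ → ℝ} {n : ℕ}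
    (hI : Integrable fun w : ι → ℝ => h (w ⬝ᵥ w) * (w ⬝ᵥ w) ^ n) {F : (ι → ℝ) → ℝ} {C : ℝ}
    (hF : Continuous F) (hC : ∀ w, |F w| ≤ C * (w ⬝ᵥ w) ^ n) :
    Integrable fun w : ι → ℝ => h (w ⬝ᵥ w) * F w := by
  have hm : Measurable fun w : ι → ℝ => F w / (w ⬝ᵥ w) ^ n := by
    refine hF.measurable.div (Continuous.measurable ?_)
    fun_prop
  have h0 : ∀ w : ι → ℝ, 0 ≤ (w ⬝ᵥ w) ^ n := fun w =>
    pow_nonneg (Finset.sum_nonneg fun i _ => mul_self_nonneg _) n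
  have hb : ∀ w : ι → ℝ, ‖F w / (w ⬝ᵥ w) ^ n‖ ≤ max C 0 := fun w => by
    rw [norm_div, Real.norm_eq_abs, Real.norm_eq_abs, abs_of_nonneg (h0 w)]
    refine div_le_of_le_mul₀ (h0 w) (le_max_right _ _) ((hC w).trans ?_)
    exact mul_le_mul_of_nonneg_right (le_max_left _ _) (h0 w)
  refine (hI.mul_bdd hm.aestronglyMeasurable (Filter.Eventually.of_forall hb)).congr
    (Filter.Eventually.of_forall fun w => ?_)
  simp only
  by_cases hw : (w ⬝ᵥ w) ^ n = 0
  · have := hC w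
    rw [hw, mul_zero] at this
    rw [abs_nonpos_iff.1 this]
    simp
  · field_simp

theorem abs_mul_apply_le_dotProduct_self (w : ι → ℝ) (a b : ι) : |w a * w b| ≤ w ⬝ᵥ w := by
  have h : ∀ i, w i ^ 2 ≤ w ⬝ᵥ w := fun i => by
    rw [sq]
    exact Finset.single_le_sum (f := fun i => w i * w i) (fun j _ => mul_self_nonneg _)
      (Finset.mem_univ i)
  have := h a
  have := h b
  rw [abs_le]
  constructor <;> nlinarith [sq_nonneg (w a + w b), sq_nonneg (w a - w b)]

theorem abs_quadratic_le (H : Matrix ι ι ℝ) (w : ι → ℝ) :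
    |w ⬝ᵥ (H *ᵥ w)| ≤ (∑ a, ∑ b, |H a b|) * (w ⬝ᵥ w) := by
  have : w ⬝ᵥ (H *ᵥ w) = ∑ a, ∑ b, H a b * (w a * w b) := by
    simp only [dotProduct, Matrix.mulVec, Finset.mul_sum]
    exact Finset.sum_congr rfl fun a _ => Finset.sum_congr rfl fun b _ => by ring
  rw [this, Finset.sum_mul]
  refine (Finset.abs_sum_le_sum_abs _ _).trans (Finset.sum_le_sum fun a _ => ?_)
  rw [Finset.sum_mul]
  refine (Finset.abs_sum_le_sum_abs _ _).trans (Finset.sum_le_sum fun b _ => ?_)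
  rw [abs_mul]
  exact mul_le_mul_of_nonneg_left (abs_mul_apply_le_dotProduct_self w a b) (abs_nonneg _)

theorem integrable_radial_mul_quadratic {h : ℝ → ℝ}
    (hI : Integrable fun w : ι → ℝ => h (w ⬝ᵥ w) * (w ⬝ᵥ w)) (H : Matrix ι ι ℝ) :
    Integrable fun w : ι → ℝ => h (w ⬝ᵥ w) * (w ⬝ᵥ (H *ᵥ w)) := by
  refine Integrable.radial_mul (n := 1) (C := ∑ a, ∑ b, |H a b|) (by simpa using hI) (by fun_prop)
    fun w => ?_
  simpa using abs_quadratic_le H w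

theorem integrable_radial_mul_quadratic_mul {h : ℝ → ℝ}
    (hI : Integrable fun w : ι → ℝ => h (w ⬝ᵥ w) * (w ⬝ᵥ w) ^ 2) (H K : Matrix ι ι ℝ) :
    Integrable fun w : ι → ℝ => h (w ⬝ᵥ w) * ((w ⬝ᵥ (H *ᵥ w)) * (w ⬝ᵥ (K *ᵥ w))) := by
  refine Integrable.radial_mul (C := (∑ a, ∑ b, |H a b|) * (∑ a, ∑ b, |K a b|)) hI
    (by fun_prop) fun w => ?_
  rw [abs_mul]
  calc _ ≤ ((∑ a, ∑ b, |H a b|) * (w ⬝ᵥ w)) * ((∑ a, ∑ b, |K a b|) * (w ⬝ᵥ w)) :=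
        mul_le_mul (abs_quadratic_le H w) (abs_quadratic_le K w) (abs_nonneg _)
          ((abs_nonneg _).trans (abs_quadratic_le H w))
    _ = _ := by ring

variable [DecidableEq ι]

/-- The reflection along `e_a - e_b` exchanges the two coordinates. -/
theorem integral_radial_swap (h : ℝ → ℝ) {a b : ι} (hab : a ≠ b) (f : ℝ → ℝ) :
    ∫ w : ι → ℝ, h (w ⬝ᵥ w) * f (w a) = ∫ w : ι → ℝ, h (w ⬝ᵥ w) * f (w b) := by
  have hv : (Pi.single a 1 - Pi.single b 1 : ι → ℝ) ⬝ᵥ (Pi.single a 1 - Pi.single b 1) = 2 := by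
    simp [dotProduct_sub, hab, hab.symm]; norm_num
  rw [← integral_radial_comp_reflection h (Pi.single a 1 - Pi.single b 1) (by rw [hv]; norm_num)
    fun w => f (w b), hv]
  congr 1; ext w; congr 2
  simp [sub_dotProduct, hab.symm]

/-- The second moments of a spherical law. -/
theorem integral_radial_sq (h : ℝ → ℝ)
    (hI : Integrable fun w : ι → ℝ => h (w ⬝ᵥ w) * (w ⬝ᵥ w)) (a : ι) :
    (Fintype.card ι : ℝ) * ∫ w : ι → ℝ, h (w ⬝ᵥ w) * w a ^ 2 =
      ∫ w : ι → ℝ, h (w ⬝ᵥ w) * (w ⬝ᵥ w) := by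
  have hi : ∀ b, Integrable fun w : ι → ℝ => h (w ⬝ᵥ w) * w b ^ 2 := fun b => by
    refine Integrable.radial_mul (n := 1) (C := 1) (by simpa using hI) (by fun_prop) fun w => ?_
    simpa [sq] using abs_mul_apply_le_dotProduct_self w b b
  have e : ∀ w : ι → ℝ, h (w ⬝ᵥ w) * (w ⬝ᵥ w) = ∑ b, h (w ⬝ᵥ w) * w b ^ 2 := fun w => by
    rw [← Finset.mul_sum]; simp [dotProduct, sq]
  have hs : ∀ b, ∫ w : ι → ℝ, h (w ⬝ᵥ w) * w b ^ 2 = ∫ w : ι → ℝ, h (w ⬝ᵥ w) * w a ^ 2 :=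
    fun b => by
      by_cases hab : b = a
      · rw [hab]
      · exact integral_radial_swap h hab (· ^ 2)
  simp_rw [e]
  rw [integral_finsetSum _ fun b _ => hi b, Finset.sum_congr rfl fun b _ => hs b]
  simp

/-- Invariance of the fourth moment under a single oblique reflection already fixes the mixed
moment. The reflection along `e_a - 2s e_b`, with `s = ±1`, sends `w_a` to the rational combination
`(3 w_a + 4s w_b)/5`; adding the two signs cancels the odd terms. -/
theorem integral_radial_sq_mul_sq_of_ne (h : ℝ → ℝ)
    (hI : Integrable fun w : ι → ℝ => h (w ⬝ᵥ w) * (w ⬝ᵥ w) ^ 2) {a b : ι} (hab : a ≠ b) :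
    3 * ∫ w : ι → ℝ, h (w ⬝ᵥ w) * (w a ^ 2 * w b ^ 2) = ∫ w : ι → ℝ, h (w ⬝ᵥ w) * w a ^ 4 := by
  have hi : ∀ c d e f : ι, Integrable fun w : ι → ℝ => h (w ⬝ᵥ w) * ((w c * w d) * (w e * w f)) :=
    fun c d e f => by
      refine Integrable.radial_mul (C := 1) hI (by fun_prop) fun w => ?_
      rw [abs_mul, one_mul, sq]
      exact mul_le_mul (abs_mul_apply_le_dotProduct_self w c d)
        (abs_mul_apply_le_dotProduct_self w e f) (abs_nonneg _)
        (Finset.sum_nonneg fun i _ => mul_self_nonneg _)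
  have hrot : ∀ s : ℝ, s ^ 2 = 1 → ∫ w : ι → ℝ, h (w ⬝ᵥ w) * ((3 * w a + s * 4 * w b) / 5) ^ 4 =
      ∫ w : ι → ℝ, h (w ⬝ᵥ w) * w a ^ 4 := by
    intro s hs
    have hv : (Pi.single a 1 - Pi.single b (2 * s) : ι → ℝ) ⬝ᵥ
        (Pi.single a 1 - Pi.single b (2 * s)) = 5 := by
      simp [dotProduct_sub, hab, hab.symm]
      linear_combination 4 * hs
    rw [← integral_radial_comp_reflection h (Pi.single a 1 - Pi.single b (2 * s))
      (by rw [hv]; norm_num) fun w => w a ^ 4, hv]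
    congr 1; ext w; congr 2
    simp [sub_dotProduct, hab]
    ring
  have h1 := hrot 1 (by norm_num)
  have h2 := hrot (-1) (by norm_num)
  have h3 := integral_radial_swap h hab (· ^ 4)
  have i1 := hi a a a a
  have i2 := hi a a b b
  have i3 := hi b b b b
  have i4 := hi a a a b
  have i5 := hi a b b b
  have e1 : ∀ w : ι → ℝ, h (w ⬝ᵥ w) * ((3 * w a + 1 * 4 * w b) / 5) ^ 4 +
      h (w ⬝ᵥ w) * ((3 * w a + -1 * 4 * w b) / 5) ^ 4 =
      (162 / 625) * (h (w ⬝ᵥ w) * w a ^ 4) + ((1728 / 625) * (h (w ⬝ᵥ w) * (w a ^ 2 * w b ^ 2)) +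
        (512 / 625) * (h (w ⬝ᵥ w) * w b ^ 4)) := fun w => by ring
  have j1 : Integrable fun w : ι → ℝ => h (w ⬝ᵥ w) * w a ^ 4 := i1.congr
    (Filter.Eventually.of_forall fun w => by simp only; ring)
  have j3 : Integrable fun w : ι → ℝ => h (w ⬝ᵥ w) * w b ^ 4 := i3.congr
    (Filter.Eventually.of_forall fun w => by simp only; ring)
  have j2 : Integrable fun w : ι → ℝ => h (w ⬝ᵥ w) * (w a ^ 2 * w b ^ 2) := i2.congr
    (Filter.Eventually.of_forall fun w => by simp only; ring)
  have k : ∀ s : ℝ, Integrable fun w : ι → ℝ => h (w ⬝ᵥ w) * ((3 * w a + s * 4 * w b) / 5) ^ 4 :=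
    fun s => by
      refine (((((i1.const_mul (81 / 625)).add (i4.const_mul (432 * s / 625))).add
        (i2.const_mul (864 * s ^ 2 / 625))).add (i5.const_mul (768 * s ^ 3 / 625))).add
        (i3.const_mul (256 * s ^ 4 / 625))).congr (Filter.Eventually.of_forall fun w => ?_)
      simp only [Pi.add_apply]
      ring
  have hsum := integral_add (k 1) (k (-1))
  simp_rw [e1] at hsum
  rw [integral_add (j1.const_mul _) (by exact (j2.const_mul _).add (j3.const_mul _)),
    integral_add (j2.const_mul _) (j3.const_mul _), integral_const_mul, integral_const_mul,
    integral_const_mul, h1, h2] at hsum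
  rw [← h3] at hsum
  linarith

/-- The fourth moments of a spherical law. -/
theorem integral_radial_sq_mul_sq (h : ℝ → ℝ)
    (hI : Integrable fun w : ι → ℝ => h (w ⬝ᵥ w) * (w ⬝ᵥ w) ^ 2) (a b : ι) :
    (Fintype.card ι * (Fintype.card ι + 2) : ℝ) * ∫ w : ι → ℝ, h (w ⬝ᵥ w) * (w a ^ 2 * w b ^ 2) =
      (1 + 2 * if a = b then 1 else 0) * ∫ w : ι → ℝ, h (w ⬝ᵥ w) * (w ⬝ᵥ w) ^ 2 := by
  set m : ι → ι → ℝ := fun a b => ∫ w : ι → ℝ, h (w ⬝ᵥ w) * (w a ^ 2 * w b ^ 2) with hm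
  have hi : ∀ c d : ι, Integrable fun w : ι → ℝ => h (w ⬝ᵥ w) * (w c ^ 2 * w d ^ 2) :=
    fun c d => by
      refine Integrable.radial_mul (C := 1) hI (by fun_prop) fun w => ?_
      rw [abs_mul, one_mul, sq, sq, sq]
      exact mul_le_mul (abs_mul_apply_le_dotProduct_self w c c)
        (abs_mul_apply_le_dotProduct_self w d d) (abs_nonneg _)
        (Finset.sum_nonneg fun i _ => mul_self_nonneg _)
  have h4 : ∀ c, m c c = ∫ w : ι → ℝ, h (w ⬝ᵥ w) * w c ^ 4 := fun c => by
    simp only [hm]; congr 1; ext w; ring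
  have hd : ∀ c, m c c = m a a := fun c => by
    rw [h4, h4]
    by_cases hca : c = a
    · rw [hca]
    · exact integral_radial_swap h hca (· ^ 4)
  -- All fourth moments are multiples of one number, which the total `E|w|⁴ = ∑ m c d` then
  -- determines: with `n = card ι`, the coefficients sum to `n(n + 2)`.
  have ho : ∀ c d, m c d = (1 + 2 * if c = d then 1 else 0) * (m a a / 3) := fun c d => by
    by_cases hcd : c = d
    · subst hcd; rw [hd, if_pos rfl]; ring
    · have := integral_radial_sq_mul_sq_of_ne h hI hcd
      rw [← h4, hd] at this
      rw [if_neg hcd]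
      simp only [hm] at this ⊢
      linarith
  have e : ∀ w : ι → ℝ, h (w ⬝ᵥ w) * (w ⬝ᵥ w) ^ 2 =
      ∑ c, ∑ d, h (w ⬝ᵥ w) * (w c ^ 2 * w d ^ 2) := fun w => by
    simp_rw [← Finset.mul_sum]
    rw [← Finset.sum_mul]
    simp [dotProduct, sq]
  have htot : ∫ w : ι → ℝ, h (w ⬝ᵥ w) * (w ⬝ᵥ w) ^ 2 = ∑ c, ∑ d, m c d := by
    simp_rw [e]
    rw [integral_finsetSum _ fun c _ => integrable_finsetSum _ fun d _ => hi c d]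
    exact Finset.sum_congr rfl fun c _ => integral_finsetSum _ fun d _ => hi c d
  rw [htot]
  change _ * m a b = _
  rw [Finset.sum_congr rfl fun c _ => Finset.sum_congr rfl fun d _ => ho c d, ho a b]
  have : ∀ c : ι, ∑ d, (1 + 2 * if c = d then 1 else 0) * (m a a / 3) =
      (Fintype.card ι + 2) * (m a a / 3) := fun c => by
    rw [← Finset.sum_mul, Finset.sum_add_distrib, ← Finset.mul_sum]
    simp
  rw [Finset.sum_congr rfl fun c _ => this c]
  simp only [Finset.sum_const, Finset.card_univ, nsmul_eq_mul]
  ring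

theorem quadratic_orthogonal_diagonal {H U : Matrix ι ι ℝ} {d : ι → ℝ} (hU : Uᵀ * U = 1)
    (hH : H = U * Matrix.diagonal d * Uᵀ) (w : ι → ℝ) :
    (U *ᵥ w) ⬝ᵥ (H *ᵥ (U *ᵥ w)) = ∑ a, d a * w a ^ 2 := by
  rw [Matrix.mulVec_mulVec, hH, Matrix.mul_assoc, hU, Matrix.mul_one, ← Matrix.mulVec_mulVec,
    Matrix.dotProduct_mulVec, Matrix.vecMul_mulVec, hU, Matrix.vecMul_one, dotProduct]
  exact Finset.sum_congr rfl fun a _ => by rw [Matrix.mulVec_diagonal]; ring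

/-- `E[wᵀ H w]` under a spherical law. -/
theorem integral_radial_quadratic (h : ℝ → ℝ)
    (hI : Integrable fun w : ι → ℝ => h (w ⬝ᵥ w) * (w ⬝ᵥ w)) {H : Matrix ι ι ℝ} (hH : H.IsSymm) :
    (Fintype.card ι : ℝ) * ∫ w : ι → ℝ, h (w ⬝ᵥ w) * (w ⬝ᵥ (H *ᵥ w)) =
      H.trace * ∫ w : ι → ℝ, h (w ⬝ᵥ w) * (w ⬝ᵥ w) := by
  obtain ⟨U, d, hU, hd⟩ := exists_orthogonal_diagonal hH
  have hi : ∀ b, Integrable fun w : ι → ℝ => h (w ⬝ᵥ w) * w b ^ 2 := fun b => by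
    refine Integrable.radial_mul (n := 1) (C := 1) (by simpa using hI) (by fun_prop) fun w => ?_
    simpa [sq] using abs_mul_apply_le_dotProduct_self w b b
  rw [← integral_comp_orthogonal hU]
  simp_rw [dotProduct_orthogonal hU, quadratic_orthogonal_diagonal hU hd, Finset.mul_sum,
    mul_left_comm (h _)]
  rw [integral_finsetSum _ fun b _ => (hi b).const_mul _, Finset.mul_sum]
  simp_rw [integral_const_mul, mul_left_comm _ (d _), integral_radial_sq h hI, ← Finset.sum_mul]
  rw [hd, Matrix.trace_mul_comm, ← Matrix.mul_assoc, hU, Matrix.one_mul, Matrix.trace_diagonal]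

/-- A single form can be diagonalised by an orthogonal change of variables, leaving moments of
coordinates. Two different forms need not commute, so the bilinear version comes from this one by
polarisation. -/
theorem integral_radial_quadratic_sq (h : ℝ → ℝ)
    (hI : Integrable fun w : ι → ℝ => h (w ⬝ᵥ w) * (w ⬝ᵥ w) ^ 2) {H : Matrix ι ι ℝ}
    (hH : H.IsSymm) :
    (Fintype.card ι * (Fintype.card ι + 2) : ℝ) *
      ∫ w : ι → ℝ, h (w ⬝ᵥ w) * ((w ⬝ᵥ (H *ᵥ w)) * (w ⬝ᵥ (H *ᵥ w))) =
      (2 * (H * H).trace + H.trace * H.trace) * ∫ w : ι → ℝ, h (w ⬝ᵥ w) * (w ⬝ᵥ w) ^ 2 := by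
  obtain ⟨U, d, hU, hd⟩ := exists_orthogonal_diagonal hH
  have hi : ∀ c d : ι, Integrable fun w : ι → ℝ => h (w ⬝ᵥ w) * (w c ^ 2 * w d ^ 2) :=
    fun c d => by
      refine Integrable.radial_mul (C := 1) hI (by fun_prop) fun w => ?_
      rw [abs_mul, one_mul, sq, sq, sq]
      exact mul_le_mul (abs_mul_apply_le_dotProduct_self w c c)
        (abs_mul_apply_le_dotProduct_self w d d) (abs_nonneg _)
        (Finset.sum_nonneg fun i _ => mul_self_nonneg _)
  have e : ∀ w : ι → ℝ, h (w ⬝ᵥ w) * ((∑ a, d a * w a ^ 2) * (∑ a, d a * w a ^ 2)) =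
      ∑ a, ∑ b, (d a * d b) * (h (w ⬝ᵥ w) * (w a ^ 2 * w b ^ 2)) := fun w => by
    rw [Finset.sum_mul_sum, Finset.mul_sum]
    refine Finset.sum_congr rfl fun a _ => ?_
    rw [Finset.mul_sum]
    exact Finset.sum_congr rfl fun b _ => by ring
  have t1 : H.trace = ∑ a, d a := by
    rw [hd, Matrix.trace_mul_comm, ← Matrix.mul_assoc, hU, Matrix.one_mul, Matrix.trace_diagonal]
  have t2 : (H * H).trace = ∑ a, d a * d a := by
    have : H * H = U * (Matrix.diagonal d * Matrix.diagonal d) * Uᵀ := by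
      rw [hd]
      calc _ = U * Matrix.diagonal d * (Uᵀ * U) * Matrix.diagonal d * Uᵀ := by
            simp only [Matrix.mul_assoc]
        _ = _ := by rw [hU, Matrix.mul_one]; simp only [Matrix.mul_assoc]
    rw [this, Matrix.trace_mul_comm, ← Matrix.mul_assoc, hU, Matrix.one_mul,
      Matrix.diagonal_mul_diagonal, Matrix.trace_diagonal]
  rw [← integral_comp_orthogonal hU]
  simp_rw [dotProduct_orthogonal hU, quadratic_orthogonal_diagonal hU hd, e]
  rw [integral_finsetSum _ fun a _ => integrable_finsetSum _ fun b _ => (hi a b).const_mul _]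
  simp_rw [integral_finsetSum _ fun b _ => (hi _ b).const_mul _, integral_const_mul,
    Finset.mul_sum, mul_left_comm _ (d _ * d _), integral_radial_sq_mul_sq h hI, t1, t2,
    Finset.sum_mul_sum, ← mul_assoc, ← Finset.sum_mul, mul_add, Finset.sum_add_distrib]
  simp
  ring_nf
  simp [Finset.sum_mul]

/-- `E[(wᵀ H w) (wᵀ K w)]` under a spherical law. -/
theorem integral_radial_quadratic_mul (h : ℝ → ℝ)
    (hI : Integrable fun w : ι → ℝ => h (w ⬝ᵥ w) * (w ⬝ᵥ w) ^ 2) {H K : Matrix ι ι ℝ}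
    (hH : H.IsSymm) (hK : K.IsSymm) :
    (Fintype.card ι * (Fintype.card ι + 2) : ℝ) *
      ∫ w : ι → ℝ, h (w ⬝ᵥ w) * ((w ⬝ᵥ (H *ᵥ w)) * (w ⬝ᵥ (K *ᵥ w))) =
      (2 * (H * K).trace + H.trace * K.trace) * ∫ w : ι → ℝ, h (w ⬝ᵥ w) * (w ⬝ᵥ w) ^ 2 := by
  -- Polarisation: the cases `H + K`, `H` and `K` are combined.
  have h1 := integral_radial_quadratic_sq h hI (hH.add hK)
  have h2 := integral_radial_quadratic_sq h hI hH
  have h3 := integral_radial_quadratic_sq h hI hK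
  have e : ∀ w : ι → ℝ, h (w ⬝ᵥ w) * ((w ⬝ᵥ ((H + K) *ᵥ w)) * (w ⬝ᵥ ((H + K) *ᵥ w))) =
      h (w ⬝ᵥ w) * ((w ⬝ᵥ (H *ᵥ w)) * (w ⬝ᵥ (H *ᵥ w))) +
      (2 * (h (w ⬝ᵥ w) * ((w ⬝ᵥ (H *ᵥ w)) * (w ⬝ᵥ (K *ᵥ w)))) +
      h (w ⬝ᵥ w) * ((w ⬝ᵥ (K *ᵥ w)) * (w ⬝ᵥ (K *ᵥ w)))) := fun w => by
    rw [Matrix.add_mulVec, dotProduct_add]; ring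
  have i := integrable_radial_mul_quadratic_mul hI
  simp_rw [e] at h1
  rw [integral_add (i H H) (by exact ((i H K).const_mul 2).add (i K K)),
    integral_add ((i H K).const_mul 2) (i K K), integral_const_mul] at h1
  have ht : ((H + K) * (H + K)).trace = (H * H).trace + 2 * (H * K).trace + (K * K).trace := by
    rw [add_mul, mul_add, mul_add, Matrix.trace_add, Matrix.trace_add, Matrix.trace_add,
      Matrix.trace_mul_comm K H]
    ring
  rw [ht, Matrix.trace_add] at h1
  linear_combination (h1 - h2 - h3) / 2

end Moments

/-! ### Real elliptical densities and their whitening -/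

section Elliptic

variable {ι : Type*} [Fintype ι] [DecidableEq ι]

/-- Real elliptical density with scatter matrix `P`, in even dimension `2M`. -/
noncomputable def ellipticDensity (M : ℕ) (g : ℝ → ℝ) (P : Matrix ι ι ℝ) (x : ι → ℝ) : ℝ :=
  cesConst M g * (Real.sqrt P.det)⁻¹ * g (x ⬝ᵥ (P⁻¹ *ᵥ x))

/-- Derivative of the logarithm of `ellipticDensity` when the scatter matrix moves along `D`. -/
noncomputable def ellipticScore (g : ℝ → ℝ) (P D : Matrix ι ι ℝ) (x : ι → ℝ) : ℝ :=
  -(1 / 2) * (P⁻¹ * D).trace -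
    logDerivGen g (x ⬝ᵥ (P⁻¹ *ᵥ x)) * (x ⬝ᵥ ((P⁻¹ * D * P⁻¹) *ᵥ x))

open scoped MatrixOrder in
theorem exists_mul_conjTranspose_of_posDef {𝕜 : Type*} [RCLike 𝕜] {P : Matrix ι ι 𝕜}
    (hP : P.PosDef) : ∃ L : Matrix ι ι 𝕜, L.det ≠ 0 ∧ P = L * Lᴴ := by
  obtain ⟨B, hB⟩ := CStarAlgebra.nonneg_iff_eq_mul_star_self.mp hP.posSemidef.nonneg
  refine ⟨B, fun h => ?_, hB⟩
  have := hP.det_pos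
  rw [hB, Matrix.det_mul, h, zero_mul] at this
  exact lt_irrefl _ this

theorem exists_mul_transpose_of_posDef {P : Matrix ι ι ℝ} (hP : P.PosDef) :
    ∃ L : Matrix ι ι ℝ, L.det ≠ 0 ∧ P = L * Lᵀ := by
  simpa [Matrix.conjTranspose_eq_transpose_of_trivial] using exists_mul_conjTranspose_of_posDef hP

section Factor

variable {L : Matrix ι ι ℝ}

theorem transpose_inv_mul_inv (L : Matrix ι ι ℝ) :
    (L * Lᵀ)⁻¹ = (L⁻¹)ᵀ * L⁻¹ := by
  rw [Matrix.mul_inv_rev, Matrix.transpose_nonsing_inv]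

/-- Under `x = L w` the two outer inverses absorb `L` and `Lᵀ`. The direction `D` enters only
through `L⁻¹ D L⁻ᵀ`, which stays symmetric when `D` is. -/
theorem dotProduct_factor (hL : L.det ≠ 0) (D : Matrix ι ι ℝ) (w : ι → ℝ) :
    (L *ᵥ w) ⬝ᵥ ((L * Lᵀ)⁻¹ * D * (L * Lᵀ)⁻¹) *ᵥ (L *ᵥ w) =
      w ⬝ᵥ ((L⁻¹ * D * (L⁻¹)ᵀ) *ᵥ w) := by
  have hu : IsUnit L.det := isUnit_iff_ne_zero.2 hL
  have h1 : Lᵀ * (L⁻¹)ᵀ = 1 := by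
    rw [← Matrix.transpose_mul, Matrix.nonsing_inv_mul _ hu, Matrix.transpose_one]
  rw [transpose_inv_mul_inv, Matrix.mulVec_mulVec, Matrix.dotProduct_mulVec,
    Matrix.vecMul_mulVec, ← Matrix.dotProduct_mulVec]
  congr 2
  calc Lᵀ * ((L⁻¹)ᵀ * L⁻¹ * D * ((L⁻¹)ᵀ * L⁻¹) * L)
      = (Lᵀ * (L⁻¹)ᵀ) * (L⁻¹ * D * (L⁻¹)ᵀ) * (L⁻¹ * L) := by simp only [Matrix.mul_assoc]
    _ = _ := by rw [h1, Matrix.nonsing_inv_mul _ hu, one_mul, mul_one]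

theorem dotProduct_factor_inv (hL : L.det ≠ 0) (w : ι → ℝ) :
    (L *ᵥ w) ⬝ᵥ ((L * Lᵀ)⁻¹ *ᵥ (L *ᵥ w)) = w ⬝ᵥ w := by
  have hu : IsUnit L.det := isUnit_iff_ne_zero.2 hL
  have h1 : Lᵀ * (L⁻¹)ᵀ = 1 := by
    rw [← Matrix.transpose_mul, Matrix.nonsing_inv_mul _ hu, Matrix.transpose_one]
  rw [transpose_inv_mul_inv, Matrix.mulVec_mulVec, Matrix.dotProduct_mulVec,
    Matrix.vecMul_mulVec, ← Matrix.dotProduct_mulVec, Matrix.mul_assoc,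
    Matrix.nonsing_inv_mul _ hu, mul_one, h1, Matrix.one_mulVec]

theorem trace_factor (L D : Matrix ι ι ℝ) :
    ((L * Lᵀ)⁻¹ * D).trace = (L⁻¹ * D * (L⁻¹)ᵀ).trace := by
  rw [transpose_inv_mul_inv, Matrix.mul_assoc, Matrix.trace_mul_comm]

theorem trace_mul_factor (L D E : Matrix ι ι ℝ) :
    ((L * Lᵀ)⁻¹ * D * (L * Lᵀ)⁻¹ * E).trace =
      ((L⁻¹ * D * (L⁻¹)ᵀ) * (L⁻¹ * E * (L⁻¹)ᵀ)).trace := by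
  rw [transpose_inv_mul_inv]
  calc ((L⁻¹)ᵀ * L⁻¹ * D * ((L⁻¹)ᵀ * L⁻¹) * E).trace
      = ((L⁻¹)ᵀ * (L⁻¹ * D * (L⁻¹)ᵀ * L⁻¹ * E)).trace := by simp only [Matrix.mul_assoc]
    _ = _ := by rw [Matrix.trace_mul_comm]; simp only [Matrix.mul_assoc]

theorem isSymm_factor (L : Matrix ι ι ℝ) {D : Matrix ι ι ℝ} (hD : D.IsSymm) :
    (L⁻¹ * D * (L⁻¹)ᵀ).IsSymm := by
  rw [Matrix.IsSymm, Matrix.transpose_mul, Matrix.transpose_mul, Matrix.transpose_transpose, hD.eq,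
    Matrix.mul_assoc]

theorem ellipticScore_factor (hL : L.det ≠ 0) (g : ℝ → ℝ) (D : Matrix ι ι ℝ) (w : ι → ℝ) :
    ellipticScore g (L * Lᵀ) D (L *ᵥ w) = -(1 / 2) * (L⁻¹ * D * (L⁻¹)ᵀ).trace -
      logDerivGen g (w ⬝ᵥ w) * (w ⬝ᵥ ((L⁻¹ * D * (L⁻¹)ᵀ) *ᵥ w)) := by
  rw [ellipticScore, dotProduct_factor_inv hL, dotProduct_factor hL, trace_factor]

variable (M : ℕ) (g : ℝ → ℝ)

theorem ellipticDensity_factor (hL : L.det ≠ 0) (w : ι → ℝ) :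
    ellipticDensity M g (L * Lᵀ) (L *ᵥ w) = |L.det|⁻¹ * (cesConst M g * g (w ⬝ᵥ w)) := by
  rw [ellipticDensity, dotProduct_factor_inv hL, Matrix.det_mul, Matrix.det_transpose,
    Real.sqrt_mul_self_eq_abs]
  ring

/-- The Jacobian of `w ↦ L w` cancels the normalisation `(det P)^(-1/2)`. -/
theorem integral_ellipticDensity_mul (hL : L.det ≠ 0) (S : (ι → ℝ) → ℝ) :
    ∫ x, S x * ellipticDensity M g (L * Lᵀ) x =
      cesConst M g * ∫ w : ι → ℝ, S (L *ᵥ w) * g (w ⬝ᵥ w) := by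
  have h := integral_comp_mulVec hL fun x => S x * ellipticDensity M g (L * Lᵀ) x
  have hp : |L.det|⁻¹ ≠ 0 := inv_ne_zero (abs_ne_zero.2 hL)
  refine mul_left_cancel₀ hp ?_
  rw [← h, ← integral_const_mul, ← integral_const_mul]
  simp_rw [ellipticDensity_factor M g hL]
  congr 1; ext w; ring

theorem integrable_ellipticDensity_mul (hL : L.det ≠ 0) {S : (ι → ℝ) → ℝ}
    (hS : Integrable fun w : ι → ℝ => S (L *ᵥ w) * g (w ⬝ᵥ w)) :
    Integrable fun x => S x * ellipticDensity M g (L * Lᵀ) x := by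
  rw [← integrable_comp_mulVec_iff hL]
  refine (hS.const_mul (|L.det|⁻¹ * cesConst M g)).congr
    (Filter.Eventually.of_forall fun w => ?_)
  simp only
  rw [ellipticDensity_factor M g hL]
  ring

end Factor

variable {M : ℕ} {g : ℝ → ℝ}

theorem cesConst_mul (hM : 0 < M) (hg : IsDensityGenerator M g) :
    cesConst M g * (Real.pi ^ M / Real.Gamma M) * genMoment M g = 1 := by
  have h0 := hg.genMoment_pos.ne'
  have h1 : Real.Gamma M ≠ 0 := (Real.Gamma_pos_of_pos (by exact_mod_cast hM)).ne'
  have := Real.pi_pos.ne'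
  unfold cesConst
  field_simp

end Elliptic

/-! ### Mean and covariance of the elliptical score -/

section EllipticMoments

/-- `φ(t)ⁿ g(t)`. -/
noncomputable def logDerivWeight (g : ℝ → ℝ) (n : ℕ) (t : ℝ) : ℝ := logDerivGen g t ^ n * g t

variable {ι : Type*} [Fintype ι] {M : ℕ} {g : ℝ → ℝ}

theorem integrable_generator (hM : 0 < M) (hι : Fintype.card ι = 2 * M)
    (hg : IsDensityGenerator M g) : Integrable fun w : ι → ℝ => g (w ⬝ᵥ w) :=
  (integrable_dotProduct_self_iff hM hι g).2 hg.integrable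

theorem integral_generator (hM : 0 < M) (hι : Fintype.card ι = 2 * M)
    (hg : IsDensityGenerator M g) : cesConst M g * ∫ w : ι → ℝ, g (w ⬝ᵥ w) = 1 := by
  rw [integral_dotProduct_self hM hι, ← cesConst_mul hM hg, genMoment]
  ring

theorem integrable_generator_one (hM : 0 < M) (hι : Fintype.card ι = 2 * M)
    (hg : IsDensityGenerator M g) (hξ : FiniteXi₂ M g) :
    Integrable fun w : ι → ℝ => logDerivWeight g 1 (w ⬝ᵥ w) * (w ⬝ᵥ w) := by
  refine (integrable_dotProduct_self_iff hM hι fun t => logDerivWeight g 1 t * t).2 ?_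
  refine (integrableOn_deriv_generator hg hξ).congr (Filter.Eventually.of_forall fun t => ?_)
  simp only [logDerivWeight]
  ring

theorem integral_generator_one (hM : 0 < M) (hι : Fintype.card ι = 2 * M)
    (hg : IsDensityGenerator M g) (hξ : FiniteXi₂ M g) :
    cesConst M g *
      ∫ w : ι → ℝ, logDerivWeight g 1 (w ⬝ᵥ w) * (w ⬝ᵥ w) = -M := by
  have h := integral_dotProduct_self hM hι fun t => logDerivWeight g 1 t * t
  have e : ∫ t in Set.Ioi (0 : ℝ), t ^ (M - 1) * (logDerivWeight g 1 t * t) =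
      -M * genMoment M g := by
    rw [← integral_deriv_generator hM hg hξ]
    congr 1; ext t; rw [logDerivWeight]; ring
  rw [h, e]
  linear_combination (-M : ℝ) * cesConst_mul hM hg

theorem integrable_generator_two (hM : 0 < M) (hι : Fintype.card ι = 2 * M)
    (hg : IsDensityGenerator M g) (hξ : FiniteXi₂ M g) :
    Integrable fun w : ι → ℝ => logDerivWeight g 2 (w ⬝ᵥ w) * (w ⬝ᵥ w) ^ 2 := by
  refine (integrable_dotProduct_self_iff hM hι fun t => logDerivWeight g 2 t * t ^ 2).2 ?_
  refine (hξ.integrableOn hg).congr (Filter.Eventually.of_forall fun t => ?_)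
  simp only [logDerivWeight]
  ring

theorem integral_generator_two (hM : 0 < M) (hι : Fintype.card ι = 2 * M)
    (hg : IsDensityGenerator M g) :
    cesConst M g *
      ∫ w : ι → ℝ, logDerivWeight g 2 (w ⬝ᵥ w) * (w ⬝ᵥ w) ^ 2 =
      M * (M + 1) * xi₂ M g := by
  have h := integral_dotProduct_self hM hι fun t => logDerivWeight g 2 t * t ^ 2
  have e : ∫ t in Set.Ioi (0 : ℝ), t ^ (M - 1) * (logDerivWeight g 2 t * t ^ 2) =
      M * (M + 1) * xi₂ M g * genMoment M g := by
    rw [← integral_sq_logDerivGen hM hg]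
    congr 1; ext t; rw [logDerivWeight]; ring
  rw [h, e]
  linear_combination (M * (M + 1) * xi₂ M g : ℝ) * cesConst_mul hM hg

variable [DecidableEq ι]

theorem integrable_ellipticDensity (hM : 0 < M) (hι : Fintype.card ι = 2 * M)
    (hg : IsDensityGenerator M g) {P : Matrix ι ι ℝ} (hP : P.PosDef) :
    Integrable (ellipticDensity M g P) := by
  obtain ⟨L, hL, rfl⟩ := exists_mul_transpose_of_posDef hP
  simpa using integrable_ellipticDensity_mul M g hL (S := fun _ => 1)
    (by simpa using integrable_generator hM hι hg)

theorem integral_ellipticDensity (hM : 0 < M) (hι : Fintype.card ι = 2 * M)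
    (hg : IsDensityGenerator M g) {P : Matrix ι ι ℝ} (hP : P.PosDef) :
    ∫ x, ellipticDensity M g P x = 1 := by
  obtain ⟨L, hL, rfl⟩ := exists_mul_transpose_of_posDef hP
  have := integral_ellipticDensity_mul M g hL fun _ => 1
  simp only [one_mul] at this
  rw [this, integral_generator hM hι hg]

theorem integrable_ellipticScore (hM : 0 < M) (hι : Fintype.card ι = 2 * M)
    (hg : IsDensityGenerator M g) (hξ : FiniteXi₂ M g) {P : Matrix ι ι ℝ} (hP : P.PosDef)
    (D : Matrix ι ι ℝ) :
    Integrable fun x => ellipticScore g P D x * ellipticDensity M g P x := by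
  obtain ⟨L, hL, rfl⟩ := exists_mul_transpose_of_posDef hP
  refine integrable_ellipticDensity_mul M g hL ?_
  simp_rw [ellipticScore_factor hL]
  set H := L⁻¹ * D * (L⁻¹)ᵀ
  refine (((integrable_generator hM hι hg).const_mul (-(1 / 2) * H.trace)).sub
    (integrable_radial_mul_quadratic (integrable_generator_one hM hι hg hξ) H)).congr
    (Filter.Eventually.of_forall fun w => ?_)
  simp only [Pi.sub_apply, logDerivWeight]
  ring

/-- Each whitened quadratic form averages to `tr H / (2M)` times `E[Qφ(Q)] = -M`, which cancels the
constant `-tr H / 2`. -/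
theorem integral_ellipticScore (hM : 0 < M) (hι : Fintype.card ι = 2 * M)
    (hg : IsDensityGenerator M g) (hξ : FiniteXi₂ M g) {P : Matrix ι ι ℝ} (hP : P.PosDef)
    {D : Matrix ι ι ℝ} (hD : D.IsSymm) :
    ∫ x, ellipticScore g P D x * ellipticDensity M g P x = 0 := by
  obtain ⟨L, hL, rfl⟩ := exists_mul_transpose_of_posDef hP
  rw [integral_ellipticDensity_mul M g hL]
  simp_rw [ellipticScore_factor hL]
  have hH := isSymm_factor L hD
  set H := L⁻¹ * D * (L⁻¹)ᵀ
  have i0 := integrable_generator hM hι hg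
  have i1 := integrable_generator_one hM hι hg hξ
  have e : ∀ w : ι → ℝ, (-(1 / 2) * H.trace - logDerivGen g (w ⬝ᵥ w) * (w ⬝ᵥ H *ᵥ w)) *
      g (w ⬝ᵥ w) = -(1 / 2) * H.trace * g (w ⬝ᵥ w) -
      logDerivWeight g 1 (w ⬝ᵥ w) * (w ⬝ᵥ H *ᵥ w) := fun w => by
    simp only [logDerivWeight]; ring
  simp_rw [e]
  rw [integral_sub (i0.const_mul _) (integrable_radial_mul_quadratic i1 H), integral_const_mul]
  have m0 := integral_generator hM hι hg
  have m1 := integral_generator_one hM hι hg hξ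
  have s1 := integral_radial_quadratic _ i1 hH
  rw [hι] at s1
  push_cast at s1
  have hMr : (M : ℝ) ≠ 0 := by positivity
  refine mul_left_cancel₀ (mul_ne_zero two_ne_zero hMr) ?_
  linear_combination (-(M : ℝ) * H.trace) * m0 - cesConst M g * s1 - H.trace * m1

theorem integrable_ellipticScore_mul (hM : 0 < M) (hι : Fintype.card ι = 2 * M)
    (hg : IsDensityGenerator M g) (hξ : FiniteXi₂ M g) {P : Matrix ι ι ℝ} (hP : P.PosDef)
    (D E : Matrix ι ι ℝ) :
    Integrable fun x =>
      ellipticScore g P D x * ellipticScore g P E x * ellipticDensity M g P x := by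
  obtain ⟨L, hL, rfl⟩ := exists_mul_transpose_of_posDef hP
  refine integrable_ellipticDensity_mul M g hL
    (S := fun x => ellipticScore g (L * Lᵀ) D x * ellipticScore g (L * Lᵀ) E x) ?_
  simp_rw [ellipticScore_factor hL]
  set H := L⁻¹ * D * (L⁻¹)ᵀ
  set K := L⁻¹ * E * (L⁻¹)ᵀ
  have i1 := integrable_radial_mul_quadratic (integrable_generator_one hM hι hg hξ)
  refine ((((integrable_generator hM hι hg).const_mul (1 / 4 * H.trace * K.trace)).add
    (((i1 H).const_mul (1 / 2 * K.trace)).add ((i1 K).const_mul (1 / 2 * H.trace)))).add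
    (integrable_radial_mul_quadratic_mul (integrable_generator_two hM hι hg hξ) H K)).congr
    (Filter.Eventually.of_forall fun w => ?_)
  simp only [Pi.add_apply, logDerivWeight]
  ring

/-- Expanding the product of scores, the constant term gives `tr H tr K / 4`, the two cross terms
`-tr H tr K / 2` together, and the fourth moments `ξ₂/4 (2 tr(HK) + tr H tr K)`. -/
theorem integral_ellipticScore_mul (hM : 0 < M) (hι : Fintype.card ι = 2 * M)
    (hg : IsDensityGenerator M g) (hξ : FiniteXi₂ M g) {P : Matrix ι ι ℝ} (hP : P.PosDef)
    {D E : Matrix ι ι ℝ} (hD : D.IsSymm) (hE : E.IsSymm) :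
    ∫ x, ellipticScore g P D x * ellipticScore g P E x * ellipticDensity M g P x =
      xi₂ M g / 2 * (P⁻¹ * D * P⁻¹ * E).trace +
        (xi₂ M g - 1) / 4 * ((P⁻¹ * D).trace * (P⁻¹ * E).trace) := by
  obtain ⟨L, hL, rfl⟩ := exists_mul_transpose_of_posDef hP
  rw [integral_ellipticDensity_mul M g hL
    (fun x => ellipticScore g (L * Lᵀ) D x * ellipticScore g (L * Lᵀ) E x),
    trace_mul_factor, trace_factor, trace_factor]
  simp_rw [ellipticScore_factor hL]
  have hH := isSymm_factor L hD
  have hK := isSymm_factor L hE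
  set H := L⁻¹ * D * (L⁻¹)ᵀ
  set K := L⁻¹ * E * (L⁻¹)ᵀ
  have i0 := integrable_generator hM hι hg
  have i1 := integrable_generator_one hM hι hg hξ
  have i2 := integrable_generator_two hM hι hg hξ
  have e : ∀ w : ι → ℝ, (-(1 / 2) * H.trace - logDerivGen g (w ⬝ᵥ w) * (w ⬝ᵥ H *ᵥ w)) *
      (-(1 / 2) * K.trace - logDerivGen g (w ⬝ᵥ w) * (w ⬝ᵥ K *ᵥ w)) * g (w ⬝ᵥ w) =
      (1 / 4 * H.trace * K.trace) * g (w ⬝ᵥ w) +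
      ((1 / 2 * K.trace) * (logDerivWeight g 1 (w ⬝ᵥ w) * (w ⬝ᵥ H *ᵥ w)) +
      ((1 / 2 * H.trace) * (logDerivWeight g 1 (w ⬝ᵥ w) * (w ⬝ᵥ K *ᵥ w)) +
      logDerivWeight g 2 (w ⬝ᵥ w) * ((w ⬝ᵥ H *ᵥ w) * (w ⬝ᵥ K *ᵥ w)))) :=
    fun w => by simp only [logDerivWeight]; ring
  simp_rw [e]
  have jH := (integrable_radial_mul_quadratic i1 H).const_mul (1 / 2 * K.trace)
  have jK := (integrable_radial_mul_quadratic i1 K).const_mul (1 / 2 * H.trace)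
  have jHK := integrable_radial_mul_quadratic_mul i2 H K
  rw [integral_add (i0.const_mul _) (by exact jH.add (jK.add jHK)),
    integral_add jH (by exact jK.add jHK), integral_add jK jHK, integral_const_mul,
    integral_const_mul, integral_const_mul]
  have m0 := integral_generator hM hι hg
  have m1 := integral_generator_one hM hι hg hξ
  have m2 := integral_generator_two hM hι hg
  have s1 := integral_radial_quadratic _ i1 hH
  have s2 := integral_radial_quadratic _ i1 hK
  have s3 := integral_radial_quadratic_mul _ i2 hH hK
  rw [hι] at s1 s2 s3
  push_cast at s1 s2 s3
  have hMr : (M : ℝ) ≠ 0 := by positivity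
  -- `4M(M+1)` is `n(n+2)` for the real dimension `n = 2M`, the denominator of the fourth moments.
  refine mul_left_cancel₀ (show 4 * (M : ℝ) * (M + 1) ≠ 0 by positivity) ?_
  linear_combination (M * (M + 1) * H.trace * K.trace : ℝ) * m0 +
    cesConst M g * (M + 1) * (K.trace * s1 + H.trace * s2) +
    2 * (M + 1) * H.trace * K.trace * m1 + cesConst M g * s3 +
    (2 * (H * K).trace + H.trace * K.trace) * m2

end EllipticMoments

/-! ### Differentiating the density along a path of scatter matrices -/

section MatrixDeriv

variable {ι : Type*} [Fintype ι] [DecidableEq ι]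

theorem hasDerivAt_det_one_add_smul (D : Matrix ι ι ℝ) :
    HasDerivAt (fun t : ℝ => (1 + t • D).det) D.trace 0 := by
  have h := ((1 + (Polynomial.X : Polynomial ℝ) • D.map Polynomial.C).det).hasDerivAt 0
  rw [Matrix.derivative_det_one_add_X_smul] at h
  refine h.congr_of_eventuallyEq (Filter.Eventually.of_forall fun t => ?_)
  change _ = Polynomial.evalRingHom t _
  rw [RingHom.map_det]
  refine congrArg Matrix.det ?_
  ext i j
  simp [Matrix.one_apply, apply_ite]
  ring

/-- Jacobi's formula along a differentiable path. -/
theorem hasDerivAt_det {P : ℝ → Matrix ι ι ℝ} {D : Matrix ι ι ℝ} {t₀ : ℝ}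
    (hP : ∀ i j, HasDerivAt (fun t => P t i j) (D i j) t₀) (h0 : (P t₀).det ≠ 0) :
    HasDerivAt (fun t => (P t).det) ((P t₀).det * ((P t₀)⁻¹ * D).trace) t₀ := by
  let f : (ι → ι → ℝ) → ℝ := fun A => Matrix.det (Matrix.of A)
  have hf : Differentiable ℝ f := by
    simp only [f, Matrix.det_apply, Matrix.of_apply]
    fun_prop
  have h1 : HasDerivAt (fun t => f (P t)) (fderiv ℝ f (P t₀) D) t₀ :=
    (hf _).hasFDerivAt.comp_hasDerivAt t₀
      (hasDerivAt_pi.2 fun i => hasDerivAt_pi.2 fun j => hP i j)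
  -- The differential of the determinant depends only on the velocity `D`, so it may be computed on
  -- the affine path, where `P t₀` factors out.
  have h2 : HasDerivAt (fun t : ℝ => f (P t₀ + t • D)) (fderiv ℝ f (P t₀) D) 0 := by
    have hl : HasDerivAt (fun (t : ℝ) i j => P t₀ i j + t * D i j) (fun i j => D i j) 0 :=
      hasDerivAt_pi.2 fun i => hasDerivAt_pi.2 fun j => by
        simpa using ((hasDerivAt_id (0 : ℝ)).mul_const (D i j)).const_add (P t₀ i j)
    have := (hf fun i j => P t₀ i j + 0 * D i j).hasFDerivAt.comp_hasDerivAt (0 : ℝ) hl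
    have e : (fun i j => P t₀ i j + 0 * D i j) = P t₀ := by ext i j; simp
    rw [e] at this
    exact this
  have h3 : HasDerivAt (fun t : ℝ => f (P t₀ + t • D)) ((P t₀).det * ((P t₀)⁻¹ * D).trace) 0 := by
    refine ((hasDerivAt_det_one_add_smul ((P t₀)⁻¹ * D)).const_mul (P t₀).det).congr_of_eventuallyEq
      (Filter.Eventually.of_forall fun t => ?_)
    change (P t₀ + t • D).det = _
    simp only
    rw [← Matrix.det_mul, mul_add, mul_one, Matrix.mul_smul, ← mul_assoc,
      Matrix.mul_nonsing_inv _ (isUnit_iff_ne_zero.2 h0), one_mul]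
  rw [← h2.unique h3]
  exact h1

/-- Derivative of `xᵀ P⁻¹ x` along a differentiable path. -/
theorem hasDerivAt_inv_quadratic {P : ℝ → Matrix ι ι ℝ} {D : Matrix ι ι ℝ} {t₀ : ℝ}
    (hP : ∀ i j, HasDerivAt (fun t => P t i j) (D i j) t₀) (h0 : (P t₀).det ≠ 0) (x : ι → ℝ) :
    HasDerivAt (fun t => x ⬝ᵥ ((P t)⁻¹ *ᵥ x)) (-(x ⬝ᵥ (((P t₀)⁻¹ * D * (P t₀)⁻¹) *ᵥ x))) t₀ := by
  have hdet := hasDerivAt_det hP h0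
  have hcont : ContinuousAt P t₀ :=
    continuousAt_pi.2 fun i => continuousAt_pi.2 fun j => (hP i j).continuousAt
  have hne : ∀ᶠ t in nhds t₀, (P t).det ≠ 0 := hdet.continuousAt.eventually_ne h0
  have hinv : ContinuousAt (fun t => (P t)⁻¹) t₀ := by
    simp only [Matrix.inv_def, Ring.inverse_eq_inv']
    exact (hdet.continuousAt.inv₀ h0).smul
      ((continuous_id.matrix_adjugate).continuousAt.comp hcont)
  rw [hasDerivAt_iff_tendsto_slope]
  obtain ⟨S, hS⟩ : ∃ S : ℝ → Matrix ι ι ℝ, ∀ t, S t = (t - t₀)⁻¹ • (P t - P t₀) := ⟨_, fun _ => rfl⟩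
  have hslope : Filter.Tendsto S (nhdsWithin t₀ {t₀}ᶜ) (nhds D) := by
    refine tendsto_pi_nhds.2 fun i => tendsto_pi_nhds.2 fun j => ?_
    refine (hasDerivAt_iff_tendsto_slope.1 (hP i j)).congr fun t => ?_
    rw [hS, slope_def_field, Matrix.smul_apply, Matrix.sub_apply, smul_eq_mul]
    ring
  have hpair := hslope.prodMk_nhds (hinv.tendsto.mono_left (nhdsWithin_le_nhds (s := {t₀}ᶜ)))
  -- By the resolvent identity the difference quotient of the inverse is `-(P t₀)⁻¹ S(t) (P t)⁻¹`,
  -- so continuity of the inverse suffices.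
  have hc : Continuous fun q : Matrix ι ι ℝ × Matrix ι ι ℝ =>
      -(x ⬝ᵥ (((P t₀)⁻¹ * q.1 * q.2) *ᵥ x)) := by fun_prop
  have hlim := (hc.tendsto (D, (P t₀)⁻¹)).comp hpair
  refine hlim.congr' ?_
  filter_upwards [hne.filter_mono nhdsWithin_le_nhds] with t ht
  simp only [Function.comp]
  rw [hS, Matrix.mul_smul, Matrix.smul_mul, mul_sub, sub_mul,
    Matrix.nonsing_inv_mul _ (isUnit_iff_ne_zero.2 h0), one_mul, mul_assoc,
    Matrix.mul_nonsing_inv _ (isUnit_iff_ne_zero.2 ht), mul_one, Matrix.smul_mulVec,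
    dotProduct_smul, Matrix.sub_mulVec, dotProduct_sub, slope_def_field, smul_eq_mul]
  ring

/-- The density is differentiated rather than its logarithm, so that points where `g` vanishes are
covered. The condition `x ≠ 0` keeps the quadratic form in `(0, ∞)`, where `g` is differentiable. -/
theorem hasDerivAt_ellipticDensity {M : ℕ} {g : ℝ → ℝ} (hg : IsDensityGenerator M g)
    {P : ℝ → Matrix ι ι ℝ} {D : Matrix ι ι ℝ} {t₀ : ℝ}
    (hP : ∀ i j, HasDerivAt (fun t => P t i j) (D i j) t₀) (h0 : (P t₀).PosDef) {x : ι → ℝ}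
    (hx : x ≠ 0) :
    HasDerivAt (fun t => ellipticDensity M g (P t) x)
      (ellipticScore g (P t₀) D x * ellipticDensity M g (P t₀) x) t₀ := by
  have hd := h0.det_pos
  have h1 := hasDerivAt_det hP hd.ne'
  have h2 := hasDerivAt_inv_quadratic hP hd.ne' x
  have hq : 0 < x ⬝ᵥ ((P t₀)⁻¹ *ᵥ x) := by
    simpa using h0.inv.dotProduct_mulVec_pos hx
  have h3 := (hg.differentiable _ hq).hasDerivAt.comp t₀ h2
  have h4 := (((h1.sqrt hd.ne').inv (Real.sqrt_pos.2 hd).ne').const_mul (cesConst M g)).mul h3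
  refine h4.congr_deriv ?_
  have hs := Real.sqrt_pos.2 hd
  have hsq := Real.sq_sqrt hd.le
  simp only [Function.comp, Pi.inv_apply, ellipticScore, ellipticDensity, ← hg.logDerivGen_mul hq]
  clear h4
  generalize hT : ((P t₀)⁻¹ * D).trace = T
  generalize hr : Real.sqrt (P t₀).det = r at *
  rw [← hsq]
  field_simp
  ring

end MatrixDeriv

/-! ### Independent observations -/

section Iid

variable {ι X : Type*}

theorem hasDerivAt_iidDensity {T : ℕ} {p : (ι → ℝ) → X → ℝ} {α v : ι → ℝ} {s : X → ℝ}
    {z : Fin T → X}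
    (hd : ∀ t, HasDerivAt (fun r : ℝ => p (α + r • v) (z t)) (s (z t) * p α (z t)) 0) :
    HasDerivAt (fun r : ℝ => iidDensity T p (α + r • v) z)
      ((∑ t, s (z t)) * iidDensity T p α z) 0 := by
  have h := HasDerivAt.fun_finsetProd (u := Finset.univ) fun t _ => hd t
  refine h.congr_deriv ?_
  rw [Finset.sum_mul]
  refine Finset.sum_congr rfl fun t ht => ?_
  simp only [zero_smul, add_zero, smul_eq_mul, iidDensity]
  rw [← Finset.mul_prod_erase _ _ ht]
  ring

variable [DecidableEq ι] [MeasureSpace X] [SigmaFinite (volume : Measure X)]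

/-- For independent observations whose scores have mean zero, Fisher informations add up. -/
theorem fisherInformation_iidDensity (T : ℕ) {p : (ι → ℝ) → X → ℝ} {α : ι → ℝ} {s : ι → X → ℝ}
    {F : Matrix ι ι ℝ}
    (hd : ∀ i, ∀ᵐ x, HasDerivAt (fun r : ℝ => p (α + r • Pi.single i 1) x) (s i x * p α x) 0)
    (h0 : Integrable (p α)) (h0' : ∫ x, p α x = 1)
    (h1 : ∀ i, Integrable fun x => s i x * p α x) (h1' : ∀ i, ∫ x, s i x * p α x = 0)
    (h2 : ∀ i j, Integrable fun x => s i x * s j x * p α x)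
    (h2' : ∀ i j, ∫ x, s i x * s j x * p α x = F i j) :
    FisherRegular (iidDensity T p) α ∧ fisherInformation (iidDensity T p) α = (T : ℝ) • F := by
  have hae : ∀ i, ∀ᵐ z : Fin T → X, ∀ t,
      HasDerivAt (fun r : ℝ => p (α + r • Pi.single i 1) (z t)) (s i (z t) * p α (z t)) 0 :=
    fun i => ae_all_iff.2 fun t =>
      (Measure.quasiMeasurePreserving_eval (μ := fun _ : Fin T => (volume : Measure X)) t).ae (hd i)
  have hlog : ∀ i, ∀ᵐ z : Fin T → X, iidDensity T p α z ≠ 0 →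
      HasLineDerivAt ℝ (fun a => Real.log (iidDensity T p a z)) (∑ t, s i (z t)) α
        (Pi.single i 1) := by
    intro i
    filter_upwards [hae i] with z hz h
    have := (hasDerivAt_iidDensity hz).log (by simpa using h)
    refine this.congr_deriv ?_
    simp only [zero_smul, add_zero]
    field_simp
  -- The integrand is written as a double sum of products over the observations, to which Fubini
  -- applies factor by factor.
  have hscore : ∀ i j, (fun z : Fin T → X => ∑ t, ∑ u, ∏ v,
      ((if v = t then s i (z v) else 1) * (if v = u then s j (z v) else 1) * p α (z v))) =ᵐ[volume]
      fun z => score (iidDensity T p) α i z * score (iidDensity T p) α j z * iidDensity T p α z := by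
    intro i j
    filter_upwards [hlog i, hlog j] with z hi hj
    have e : ∑ t, ∑ u, ∏ v,
        ((if v = t then s i (z v) else 1) * (if v = u then s j (z v) else 1) * p α (z v)) =
        (∑ t, s i (z t)) * (∑ u, s j (z u)) * iidDensity T p α z := by
      simp only [Finset.prod_mul_distrib, Finset.prod_ite_eq', Finset.mem_univ, if_true,
        ← Finset.sum_mul, ← Finset.mul_sum, iidDensity]
    rw [e]
    -- Where the joint density vanishes, `score` may be meaningless, but both sides are zero.
    by_cases h : iidDensity T p α z = 0
    · rw [h, mul_zero, mul_zero]
    · rw [score, score, (hi h).lineDeriv, (hj h).lineDeriv]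
  have hf : ∀ i j (t u v : Fin T), Integrable fun x =>
      (if v = t then s i x else 1) * (if v = u then s j x else 1) * p α x := by
    intro i j t u v
    by_cases h : v = t <;> by_cases h' : v = u
    · simpa only [if_pos h, if_pos h'] using h2 i j
    · simpa only [if_pos h, if_neg h', mul_one] using h1 i
    · simpa only [if_neg h, if_pos h', one_mul] using h1 j
    · simpa only [if_neg h, if_neg h', one_mul] using h0
  have hval : ∀ i j (t u : Fin T), ∏ v, ∫ x,
      (if v = t then s i x else 1) * (if v = u then s j x else 1) * p α x =
      if t = u then F i j else 0 := by
    intro i j t u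
    split_ifs with h
    · subst h
      rw [Finset.prod_eq_single t]
      · simpa using h2' i j
      · intro v _ hv; simpa [hv] using h0'
      · simp
    -- For `t ≠ u` the factor at `t` is the mean of a single score.
    · refine Finset.prod_eq_zero (Finset.mem_univ t) ?_
      simpa [h] using h1' i
  have hint : ∀ i j (t u : Fin T), Integrable fun z : Fin T → X => ∏ v,
      ((if v = t then s i (z v) else 1) * (if v = u then s j (z v) else 1) * p α (z v)) :=
    fun i j t u => Integrable.fintype_prod (hf i j t u)
  refine ⟨⟨fun i => ?_, fun i j => ?_⟩, ?_⟩
  · filter_upwards [hlog i] with z hz h using (hz h).lineDifferentiableAt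
  · exact (integrable_finsetSum _ fun t _ => integrable_finsetSum _ fun u _ =>
      hint i j t u).congr (hscore i j)
  · ext i j
    rw [fisherInformation, Matrix.of_apply, ← integral_congr_ae (hscore i j),
      integral_finsetSum _ fun t _ => integrable_finsetSum _ fun u _ => hint i j t u]
    simp_rw [integral_finsetSum _ fun u _ => hint i j _ u]
    have : ∀ t u : Fin T, ∫ z : Fin T → X, ∏ v,
        ((if v = t then s i (z v) else 1) * (if v = u then s j (z v) else 1) * p α (z v)) =
        if t = u then F i j else 0 := fun t u => by
      rw [← hval i j t u]
      exact integral_fintype_prod_volume_eq_prod fun v x =>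
        (if v = t then s i x else 1) * (if v = u then s j x else 1) * p α x
    simp_rw [this]
    simp

end Iid

/-! ### From augmented complex matrices to real ones -/

section RealCoordinates

/-- Real coordinates `(Re z, Im z)` on `ℂ^M`. -/
noncomputable def realCoords (M : ℕ) : (Fin M → ℂ) ≃ᵐ (Fin M ⊕ Fin M → ℝ) :=
  ((MeasurableEquiv.piCongrRight fun _ => Complex.measurableEquivRealProd).trans
    (MeasurableEquiv.arrowProdEquivProdArrow ℝ ℝ (Fin M))).trans
    (MeasurableEquiv.sumPiEquivProdPi fun _ : Fin M ⊕ Fin M => ℝ).symm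

variable {M : ℕ}

theorem realCoords_inl (z : Fin M → ℂ) (i : Fin M) : realCoords M z (.inl i) = (z i).re := rfl

theorem realCoords_inr (z : Fin M → ℂ) (i : Fin M) : realCoords M z (.inr i) = (z i).im := rfl

theorem measurePreserving_realCoords : MeasurePreserving (realCoords M) :=
  ((volume_preserving_pi fun _ : Fin M => Complex.volume_preserving_equiv_real_prod).trans
    (volume_measurePreserving_arrowProdEquivProdArrow ℝ ℝ (Fin M))).trans
    (volume_measurePreserving_sumPiEquivProdPi_symm fun _ : Fin M ⊕ Fin M => ℝ)

theorem realCoords_ne_zero {z : Fin M → ℂ} (hz : z ≠ 0) : realCoords M z ≠ 0 := by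
  intro h
  refine hz (funext fun i => Complex.ext ?_ ?_)
  · simpa [realCoords_inl] using congrFun h (.inl i)
  · simpa [realCoords_inr] using congrFun h (.inr i)

/-- The matrix taking `(Re z, Im z)` to `(z, z*)`. -/
def augTransform (M : ℕ) : Matrix (Fin M ⊕ Fin M) (Fin M ⊕ Fin M) ℂ :=
  Matrix.fromBlocks 1 (Complex.I • 1) 1 (-Complex.I • 1)

theorem augTransform_mulVec (z : Fin M → ℂ) :
    augTransform M *ᵥ (fun i => (realCoords M z i : ℂ)) = augVec z := by
  have h : (fun i => (realCoords M z i : ℂ)) =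
      Sum.elim (fun i => ((z i).re : ℂ)) (fun i => ((z i).im : ℂ)) := by
    ext (i | i) <;> rfl
  rw [h, augTransform, Matrix.fromBlocks_mulVec]
  ext (i | i)
  · simp [augVec, Matrix.smul_mulVec, mul_comm Complex.I]
  · simp [augVec, Matrix.neg_mulVec, Matrix.smul_mulVec, Complex.ext_iff]

theorem augTransform_conjTranspose_mul : (augTransform M)ᴴ * augTransform M = (2 : ℂ) • 1 := by
  rw [augTransform, Matrix.fromBlocks_conjTranspose, Matrix.fromBlocks_multiply,
    ← Matrix.fromBlocks_one, Matrix.fromBlocks_smul]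
  congr 1 <;>
  · simp [Matrix.conjTranspose_smul, smul_smul]
    try norm_num [two_smul]

theorem half_conjTranspose_mul_augTransform :
    ((1 / 2 : ℂ) • (augTransform M)ᴴ) * augTransform M = 1 := by
  rw [Matrix.smul_mul, augTransform_conjTranspose_mul, smul_smul]
  norm_num

theorem augTransform_mul_half_conjTranspose :
    augTransform M * ((1 / 2 : ℂ) • (augTransform M)ᴴ) = 1 :=
  mul_eq_one_comm.1 half_conjTranspose_mul_augTransform

/-- The `ℂ`-matrices commuting with the conjugation `(u, v) ↦ (v*, u*)`. -/
def IsAugmented {m n : Type*} (G : Matrix (m ⊕ m) (n ⊕ n) ℂ) : Prop :=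
  ∃ B C : Matrix m n ℂ, G = augMat B C

/-- The real matrix of the `ℝ`-linear map `z ↦ B z + C z*` in real coordinates, for
`G = augMat B C`. -/
noncomputable def realMatrix (G : Matrix (Fin M ⊕ Fin M) (Fin M ⊕ Fin M) ℂ) :
    Matrix (Fin M ⊕ Fin M) (Fin M ⊕ Fin M) ℝ :=
  (((1 / 2 : ℂ) • (augTransform M)ᴴ) * G * augTransform M).map Complex.re

/-- The augmented structure makes all entries of the conjugated matrix real, so taking real parts
discards nothing. As `½Tᴴ` is the inverse of `T = augTransform M`, the real matrix is similar to
`G`; determinants, inverses and traces of products therefore transfer. -/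
theorem map_realMatrix {G : Matrix (Fin M ⊕ Fin M) (Fin M ⊕ Fin M) ℂ} (hG : IsAugmented G) :
    (realMatrix G).map Complex.ofRealHom =
      ((1 / 2 : ℂ) • (augTransform M)ᴴ) * G * augTransform M := by
  obtain ⟨B, C, rfl⟩ := hG
  ext i j
  refine Complex.ext rfl ?_
  change 0 = _
  rw [augTransform, Matrix.fromBlocks_conjTranspose, Matrix.fromBlocks_smul, augMat,
    Matrix.fromBlocks_multiply, Matrix.fromBlocks_multiply]
  rcases i with i | i <;> rcases j with j | j <;>
  · simp [Matrix.conjTranspose_smul]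
    try ring

theorem map_inv_ofReal {n : Type*} [Fintype n] [DecidableEq n] (P : Matrix n n ℝ) :
    (P⁻¹).map Complex.ofRealHom = (P.map Complex.ofRealHom)⁻¹ := by
  have hdet : (P.map Complex.ofRealHom).det = Complex.ofRealHom P.det :=
    (RingHom.map_det Complex.ofRealHom P).symm
  by_cases h : P.det = 0
  · rw [Matrix.nonsing_inv_apply_not_isUnit _ (by simp [h]),
      Matrix.nonsing_inv_apply_not_isUnit _ (by simp [hdet, h])]
    ext; simp
  · symm
    refine Matrix.inv_eq_left_inv ?_
    rw [← Matrix.map_mul, Matrix.nonsing_inv_mul _ (isUnit_iff_ne_zero.2 h)]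
    simp

variable {G : Matrix (Fin M ⊕ Fin M) (Fin M ⊕ Fin M) ℂ}

theorem map_realMatrix_inv (hG : IsAugmented G) :
    ((realMatrix G)⁻¹).map Complex.ofRealHom =
      ((1 / 2 : ℂ) • (augTransform M)ᴴ) * G⁻¹ * augTransform M := by
  rw [map_inv_ofReal, map_realMatrix hG, Matrix.mul_inv_rev, Matrix.mul_inv_rev,
    Matrix.inv_eq_left_inv augTransform_mul_half_conjTranspose,
    Matrix.inv_eq_left_inv half_conjTranspose_mul_augTransform, Matrix.mul_assoc]

theorem det_realMatrix (hG : IsAugmented G) : ((realMatrix G).det : ℂ) = G.det := by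
  have h : (realMatrix G).det = ((realMatrix G).map Complex.ofRealHom).det :=
    RingHom.map_det Complex.ofRealHom (realMatrix G)
  rw [h, map_realMatrix hG, Matrix.det_mul_comm, ← Matrix.mul_assoc,
    augTransform_mul_half_conjTranspose, one_mul]

theorem trace_realMatrix_inv_mul (hG : IsAugmented G)
    {D : Matrix (Fin M ⊕ Fin M) (Fin M ⊕ Fin M) ℂ} (hD : IsAugmented D) :
    (((realMatrix G)⁻¹ * realMatrix D).trace : ℂ) = (G⁻¹ * D).trace := by
  have h : ∀ P : Matrix (Fin M ⊕ Fin M) (Fin M ⊕ Fin M) ℝ,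
      (P.trace : ℂ) = (P.map Complex.ofRealHom).trace := fun P => by simp [Matrix.trace]
  rw [h, Matrix.map_mul, map_realMatrix_inv hG, map_realMatrix hD]
  set W := (1 / 2 : ℂ) • (augTransform M)ᴴ
  have hW : augTransform M * W = 1 := augTransform_mul_half_conjTranspose
  calc (W * G⁻¹ * augTransform M * (W * D * augTransform M)).trace
      = (W * (G⁻¹ * (augTransform M * W) * D * augTransform M)).trace := by
        simp only [Matrix.mul_assoc]
    _ = _ := by rw [hW, mul_one, Matrix.trace_mul_comm, Matrix.mul_assoc, hW, mul_one]

theorem trace_realMatrix_inv_mul_mul (hG : IsAugmented G)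
    {D E : Matrix (Fin M ⊕ Fin M) (Fin M ⊕ Fin M) ℂ} (hD : IsAugmented D) (hE : IsAugmented E) :
    (((realMatrix G)⁻¹ * realMatrix D * (realMatrix G)⁻¹ * realMatrix E).trace : ℂ) =
      (G⁻¹ * D * G⁻¹ * E).trace := by
  have h : ∀ P : Matrix (Fin M ⊕ Fin M) (Fin M ⊕ Fin M) ℝ,
      (P.trace : ℂ) = (P.map Complex.ofRealHom).trace := fun P => by simp [Matrix.trace]
  rw [h, Matrix.map_mul, Matrix.map_mul, Matrix.map_mul, map_realMatrix_inv hG, map_realMatrix hD,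
    map_realMatrix hE]
  set W := (1 / 2 : ℂ) • (augTransform M)ᴴ
  have hW : augTransform M * W = 1 := augTransform_mul_half_conjTranspose
  calc (W * G⁻¹ * augTransform M * (W * D * augTransform M) * (W * G⁻¹ * augTransform M) *
        (W * E * augTransform M)).trace
      = (W * (G⁻¹ * (augTransform M * W) * D * (augTransform M * W) * G⁻¹ *
          (augTransform M * W) * E * augTransform M)).trace := by simp only [Matrix.mul_assoc]
    _ = _ := by
        rw [hW, mul_one, mul_one, mul_one, Matrix.trace_mul_comm, Matrix.mul_assoc, hW, mul_one]

theorem isSymm_realMatrix (hG : IsAugmented G) (hH : G.IsHermitian) : (realMatrix G).IsSymm := by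
  have h : ((realMatrix G)ᵀ).map Complex.ofRealHom = (realMatrix G).map Complex.ofRealHom := by
    have e : ((realMatrix G)ᵀ).map Complex.ofRealHom = ((realMatrix G).map Complex.ofRealHom)ᴴ := by
      ext i j; simp
    rw [e, map_realMatrix hG, Matrix.conjTranspose_mul, Matrix.conjTranspose_mul, hH.eq,
      Matrix.conjTranspose_smul, Matrix.conjTranspose_conjTranspose, Matrix.mul_smul,
      Matrix.mul_smul, Matrix.smul_mul, Matrix.smul_mul, Matrix.mul_assoc]
    simp
  exact Matrix.map_injective Complex.ofRealHom.injective h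

/-- The real quadratic form at `x` is half the Hermitian form of `G` at `T x`, and `T` is injective.
-/
theorem posDef_realMatrix (hG : IsAugmented G) (hP : G.PosDef) : (realMatrix G).PosDef := by
  refine Matrix.PosDef.of_dotProduct_mulVec_pos ?_ fun x hx => ?_
  · have := isSymm_realMatrix hG hP.isHermitian
    rwa [Matrix.IsHermitian, Matrix.conjTranspose_eq_transpose_of_trivial]
  · set y : Fin M ⊕ Fin M → ℂ := fun i => (x i : ℂ) with hy
    have e : ((star x ⬝ᵥ (realMatrix G *ᵥ x) : ℝ) : ℂ) =
        1 / 2 * (star (augTransform M *ᵥ y) ⬝ᵥ (G *ᵥ (augTransform M *ᵥ y))) := by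
      have h1 : ((star x ⬝ᵥ (realMatrix G *ᵥ x) : ℝ) : ℂ) =
          star y ⬝ᵥ ((realMatrix G).map Complex.ofRealHom *ᵥ y) := by
        simp [dotProduct, Matrix.mulVec, hy]
      rw [h1, map_realMatrix hG, Matrix.smul_mul, Matrix.smul_mul, Matrix.smul_mulVec,
        dotProduct_smul, smul_eq_mul, Matrix.star_mulVec, ← Matrix.dotProduct_mulVec,
        Matrix.mulVec_mulVec, Matrix.mulVec_mulVec, Matrix.mul_assoc]
    have hne : augTransform M *ᵥ y ≠ 0 := by
      intro h0
      have : y = 0 := by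
        rw [← Matrix.one_mulVec y, ← half_conjTranspose_mul_augTransform, ← Matrix.mulVec_mulVec,
          h0, Matrix.mulVec_zero]
      refine hx (funext fun i => ?_)
      simpa [hy] using congrFun this i
    have h2 := hP.re_dotProduct_pos hne
    have h3 := congrArg Complex.re e
    rw [Complex.ofReal_re] at h3
    rw [h3]
    have h4 : (1 / 2 : ℂ) = ((1 / 2 : ℝ) : ℂ) := by norm_num
    rw [h4, Complex.re_ofReal_mul]
    exact mul_pos (by norm_num) h2

/-- The `½` inside the noncircular density is the `½` in the inverse of `augTransform`. -/
theorem noncircularCESDensity_eq (g : ℝ → ℝ) (hG : IsAugmented G) (z : Fin M → ℂ) :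
    noncircularCESDensity g G z = ellipticDensity M g (realMatrix G) (realCoords M z) := by
  have hdet : G.det.re = (realMatrix G).det := by rw [← det_realMatrix hG, Complex.ofReal_re]
  set y : Fin M ⊕ Fin M → ℂ := fun i => (realCoords M z i : ℂ) with hy
  have e : ((realCoords M z ⬝ᵥ ((realMatrix G)⁻¹ *ᵥ realCoords M z) : ℝ) : ℂ) =
      1 / 2 * (star (augVec z) ⬝ᵥ (G⁻¹ *ᵥ augVec z)) := by
    have h1 : ((realCoords M z ⬝ᵥ ((realMatrix G)⁻¹ *ᵥ realCoords M z) : ℝ) : ℂ) =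
        star y ⬝ᵥ (((realMatrix G)⁻¹).map Complex.ofRealHom *ᵥ y) := by
      simp [dotProduct, Matrix.mulVec, hy]
    rw [h1, map_realMatrix_inv hG, Matrix.smul_mul, Matrix.smul_mul, Matrix.smul_mulVec,
      dotProduct_smul, smul_eq_mul, ← augTransform_mulVec z, Matrix.star_mulVec,
      ← Matrix.dotProduct_mulVec, Matrix.mulVec_mulVec, Matrix.mulVec_mulVec, Matrix.mul_assoc]
  have h3 := congrArg Complex.re e
  have h4 : (1 / 2 : ℂ) = ((1 / 2 : ℝ) : ℂ) := by norm_num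
  rw [Complex.ofReal_re, h4, Complex.re_ofReal_mul] at h3
  rw [noncircularCESDensity, ellipticDensity, hdet, h3]

theorem hasDerivAt_realMatrix {Γ : ℝ → Matrix (Fin M ⊕ Fin M) (Fin M ⊕ Fin M) ℂ}
    {D : Matrix (Fin M ⊕ Fin M) (Fin M ⊕ Fin M) ℂ} {t₀ : ℝ}
    (h : ∀ a b, HasDerivAt (fun t => Γ t a b) (D a b) t₀) (i j : Fin M ⊕ Fin M) :
    HasDerivAt (fun t => realMatrix (Γ t) i j) (realMatrix D i j) t₀ := by
  have h1 : HasDerivAt (fun t => (((1 / 2 : ℂ) • (augTransform M)ᴴ) * Γ t * augTransform M) i j)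
      ((((1 / 2 : ℂ) • (augTransform M)ᴴ) * D * augTransform M) i j) t₀ := by
    simp only [Matrix.mul_apply]
    exact HasDerivAt.fun_sum fun k _ => (HasDerivAt.fun_sum fun l _ =>
      (h l k).const_mul _).mul_const _
  exact Complex.reCLM.hasFDerivAt.comp_hasDerivAt t₀ h1

end RealCoordinates

/-! ### Fisher information of a scatter model -/

section ScatterModel

variable {M : ℕ} {g : ℝ → ℝ} {ι : Type*} [DecidableEq ι]

/-- Fisher information of a parametrized augmented scatter matrix. -/
theorem fisherInformation_scatter (hM : 0 < M) (hg : IsDensityGenerator M g)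
    (hξ : FiniteXi₂ M g) (T : ℕ) {p : (ι → ℝ) → (Fin M → ℂ) → ℝ} {α : ι → ℝ}
    {G : Matrix (Fin M ⊕ Fin M) (Fin M ⊕ Fin M) ℂ}
    {Γ : ι → ℝ → Matrix (Fin M ⊕ Fin M) (Fin M ⊕ Fin M) ℂ}
    {D : ι → Matrix (Fin M ⊕ Fin M) (Fin M ⊕ Fin M) ℂ}
    (hp : ∀ i, ∀ᶠ r in nhds (0 : ℝ), ∀ z,
      p (α + r • Pi.single i 1) z = noncircularCESDensity g (Γ i r) z)
    (hp0 : ∀ z, p α z = noncircularCESDensity g G z)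
    (hΓ0 : ∀ i, Γ i 0 = G) (hΓ : ∀ i r, IsAugmented (Γ i r)) (hG : IsAugmented G)
    (hpos : G.PosDef) (hder : ∀ i a b, HasDerivAt (fun r => Γ i r a b) (D i a b) 0)
    (hD : ∀ i, IsAugmented (D i)) (hDh : ∀ i, (D i).IsHermitian) :
    FisherRegular (iidDensity T p) α ∧ fisherInformation (iidDensity T p) α =
      (T : ℝ) • Matrix.of fun i j => xi₂ M g / 2 * (G⁻¹ * D i * G⁻¹ * D j).trace.re +
        (xi₂ M g - 1) / 4 * ((G⁻¹ * D i).trace.re * (G⁻¹ * D j).trace.re) := by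
  have hι : Fintype.card (Fin M ⊕ Fin M) = 2 * M := by simp; ring
  have hP := posDef_realMatrix hG hpos
  have hDs := fun i => isSymm_realMatrix (hD i) (hDh i)
  have mp := measurePreserving_realCoords (M := M)
  have me := (realCoords M).measurableEmbedding
  have hp0' : ∀ z, p α z = ellipticDensity M g (realMatrix G) (realCoords M z) := fun z => by
    rw [hp0, noncircularCESDensity_eq g hG]
  have hI : ∀ F : (Fin M ⊕ Fin M → ℝ) → ℝ, ∫ z, F (realCoords M z) = ∫ x, F x :=
    fun F => mp.integral_comp me F
  have hint : ∀ F : (Fin M ⊕ Fin M → ℝ) → ℝ, Integrable F → Integrable fun z => F (realCoords M z) :=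
    fun F hF => (mp.integrable_comp_emb me).2 hF
  refine fisherInformation_iidDensity T
    (s := fun i z => ellipticScore g (realMatrix G) (realMatrix (D i)) (realCoords M z))
    (fun i => ?_) ?_ ?_ (fun i => ?_) (fun i => ?_) (fun i j => ?_) (fun i j => ?_)
  -- The origin, where the generator need not be differentiable, is a null set because `M > 0`.
  · have hne : ∀ᵐ z : Fin M → ℂ, z ≠ 0 := by
      have : Nonempty (Fin M) := ⟨⟨0, hM⟩⟩
      exact Measure.ae_ne volume 0
    filter_upwards [hne] with z hz
    have h := hasDerivAt_ellipticDensity hg (P := fun r => realMatrix (Γ i r))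
      (hasDerivAt_realMatrix (hder i)) (by simpa [hΓ0] using hP) (realCoords_ne_zero hz)
    simp only [hΓ0] at h
    rw [hp0']
    refine h.congr_of_eventuallyEq ?_
    filter_upwards [hp i] with r hr
    rw [hr, noncircularCESDensity_eq g (hΓ i r)]
  · rw [funext hp0']
    exact hint _ (integrable_ellipticDensity hM hι hg hP)
  · simp_rw [hp0']
    rw [hI, integral_ellipticDensity hM hι hg hP]
  · simp_rw [hp0']
    exact hint _ (integrable_ellipticScore hM hι hg hξ hP (realMatrix (D i)))
  · simp_rw [hp0']
    rw [hI fun x => ellipticScore g (realMatrix G) (realMatrix (D i)) x *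
      ellipticDensity M g (realMatrix G) x, integral_ellipticScore hM hι hg hξ hP (hDs i)]
  · simp_rw [hp0']
    exact hint _ (integrable_ellipticScore_mul hM hι hg hξ hP (realMatrix (D i))
      (realMatrix (D j)))
  · simp_rw [hp0']
    rw [hI fun x => ellipticScore g (realMatrix G) (realMatrix (D i)) x *
      ellipticScore g (realMatrix G) (realMatrix (D j)) x *
      ellipticDensity M g (realMatrix G) x,
      integral_ellipticScore_mul hM hι hg hξ hP (hDs i) (hDs j), Matrix.of_apply,
      ← trace_realMatrix_inv_mul hG (hD i), ← trace_realMatrix_inv_mul hG (hD j),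
      ← trace_realMatrix_inv_mul_mul hG (hD i) (hD j)]
    simp only [Complex.ofReal_re]

end ScatterModel

/-! ### Schur complements and the Cramér–Rao block -/

section BlockInformation

variable {ι ν : Type*} [Fintype ι] [Fintype ν] [DecidableEq ι] [DecidableEq ν]

/-- The determinant of `J` is that of the nuisance block times that of the Schur complement. -/
theorem isUnit_iff_isUnit_efficientInformation {J : Matrix (ι ⊕ ν) (ι ⊕ ν) ℝ}
    (h : IsUnit J.toBlocks₂₂) : IsUnit J ↔ IsUnit (efficientInformation J) := by
  have := h.invertible
  have hd := Matrix.det_fromBlocks₂₂ J.toBlocks₁₁ J.toBlocks₁₂ J.toBlocks₂₁ J.toBlocks₂₂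
  rw [Matrix.fromBlocks_toBlocks, Matrix.invOf_eq_nonsing_inv] at hd
  rw [Matrix.isUnit_iff_isUnit_det, Matrix.isUnit_iff_isUnit_det, hd, IsUnit.mul_iff,
    efficientInformation]
  exact and_iff_right ((Matrix.isUnit_iff_isUnit_det _).1 h)

theorem crbBlock_eq {J : Matrix (ι ⊕ ν) (ι ⊕ ν) ℝ} (h : IsUnit J.toBlocks₂₂) (hJ : IsUnit J) :
    crbBlock J = (efficientInformation J)⁻¹ := by
  have i1 := h.invertible
  have i2 : Invertible (J.toBlocks₁₁ - J.toBlocks₁₂ * ⅟J.toBlocks₂₂ * J.toBlocks₂₁) := by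
    rw [Matrix.invOf_eq_nonsing_inv]
    exact ((isUnit_iff_isUnit_efficientInformation h).1 hJ).invertible
  have i3 : Invertible (Matrix.fromBlocks J.toBlocks₁₁ J.toBlocks₁₂ J.toBlocks₂₁ J.toBlocks₂₂) := by
    rw [Matrix.fromBlocks_toBlocks]; exact hJ.invertible
  have := Matrix.invOf_fromBlocks₂₂_eq J.toBlocks₁₁ J.toBlocks₁₂ J.toBlocks₂₁ J.toBlocks₂₂
  have h2 := congrArg Matrix.toBlocks₁₁ this
  rw [Matrix.toBlocks_fromBlocks₁₁, Matrix.invOf_eq_nonsing_inv, Matrix.invOf_eq_nonsing_inv,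
    Matrix.fromBlocks_toBlocks, Matrix.invOf_eq_nonsing_inv] at h2
  exact h2

/-- What an efficient information `T F` says about the Cramér–Rao bound. -/
theorem crb_of_efficientInformation {T : ℕ} (hT : 0 < T) {J : Matrix (ι ⊕ ν) (ι ⊕ ν) ℝ}
    {F : Matrix ι ι ℝ} (h : IsUnit J.toBlocks₂₂) (hF : efficientInformation J = (T : ℝ) • F) :
    IsUnit J.toBlocks₂₂ ∧ (∀ k l, 1 / (T : ℝ) * efficientInformation J k l = F k l) ∧
      (IsUnit J ↔ IsUnit F) ∧
      (IsUnit J → IsUnit (crbBlock J) ∧ ∀ k l, 1 / (T : ℝ) * (crbBlock J)⁻¹ k l = F k l) := by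
  have hT' : (T : ℝ) ≠ 0 := by positivity
  have hiff := isUnit_iff_isUnit_efficientInformation h
  have heff : ∀ k l, 1 / (T : ℝ) * efficientInformation J k l = F k l := fun k l => by
    rw [hF, Matrix.smul_apply, smul_eq_mul]; field_simp
  refine ⟨h, heff, ?_, fun hJ => ?_⟩
  · rw [hiff, hF, Matrix.isUnit_iff_isUnit_det, Matrix.isUnit_iff_isUnit_det, Matrix.det_smul,
      IsUnit.mul_iff]
    exact and_iff_right (isUnit_iff_ne_zero.2 (pow_ne_zero _ hT'))
  · have hu := hiff.1 hJ
    rw [crbBlock_eq h hJ]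
    refine ⟨(Matrix.isUnit_nonsing_inv_iff).2 hu, ?_⟩
    rwa [Matrix.nonsing_inv_nonsing_inv _ ((Matrix.isUnit_iff_isUnit_det _).1 hu)]

end BlockInformation

/-! ### The information form and its positivity -/

section InformationForm

variable {m : Type*} [Fintype m] [DecidableEq m]

/-- The Fisher information form on tangent scatter matrices. -/
noncomputable def infoForm (a b : ℝ) (G X Y : Matrix m m ℂ) : ℝ :=
  a * (G⁻¹ * X * G⁻¹ * Y).trace.re + b * ((G⁻¹ * X).trace.re * (G⁻¹ * Y).trace.re)

variable (a b : ℝ) (G : Matrix m m ℂ)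

theorem infoForm_comm (X Y : Matrix m m ℂ) : infoForm a b G X Y = infoForm a b G Y X := by
  have h : (G⁻¹ * X * G⁻¹ * Y).trace = (G⁻¹ * Y * G⁻¹ * X).trace := by
    rw [Matrix.mul_assoc (G⁻¹ * X), Matrix.trace_mul_comm]
    simp only [Matrix.mul_assoc]
  rw [infoForm, infoForm, h]
  ring

theorem infoForm_add_left (X X' Y : Matrix m m ℂ) :
    infoForm a b G (X + X') Y = infoForm a b G X Y + infoForm a b G X' Y := by
  simp only [infoForm, mul_add, add_mul, Matrix.trace_add, Complex.add_re]
  ring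

theorem infoForm_smul_left (r : ℝ) (X Y : Matrix m m ℂ) :
    infoForm a b G (r • X) Y = r * infoForm a b G X Y := by
  simp only [infoForm, Matrix.mul_smul, Matrix.smul_mul, Matrix.trace_smul, Complex.real_smul,
    Complex.re_ofReal_mul]
  ring

/-- `infoForm` as a bilinear form. -/
noncomputable def infoBilin : LinearMap.BilinForm ℝ (Matrix m m ℂ) :=
  LinearMap.mk₂ ℝ (infoForm a b G) (infoForm_add_left a b G)
    (fun r X Y => infoForm_smul_left a b G r X Y)
    (fun X Y Y' => by simp only [infoForm_comm a b G X, infoForm_add_left])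
    (fun r X Y => by simp only [infoForm_comm a b G X, infoForm_smul_left, smul_eq_mul])

theorem infoBilin_apply (X Y : Matrix m m ℂ) : infoBilin a b G X Y = infoForm a b G X Y := rfl

variable {a b G}

/-- With `G = L Lᴴ` and `H = L⁻¹ X L⁻ᴴ` the form is `a‖H‖² + b (tr H)²` in the Frobenius norm.
Cauchy–Schwarz, `(tr H)² ≤ card m · ‖H‖²`, controls the second term when `b < 0`. -/
theorem infoForm_self_pos (hG : G.PosDef) (ha : 0 < a) (hab : 0 < a + b * Fintype.card m)
    {X : Matrix m m ℂ} (hX : X.IsHermitian) (h0 : X ≠ 0) : 0 < infoForm a b G X X := by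
  obtain ⟨L, hL, rfl⟩ := exists_mul_conjTranspose_of_posDef hG
  have hu : IsUnit L.det := isUnit_iff_ne_zero.2 hL
  set H := L⁻¹ * X * (L⁻¹)ᴴ with hHdef
  have hinv : (L * Lᴴ)⁻¹ = (L⁻¹)ᴴ * L⁻¹ := by
    rw [Matrix.mul_inv_rev, Matrix.conjTranspose_nonsing_inv]
  have hH : Hᴴ = H := by
    rw [hHdef, Matrix.conjTranspose_mul, Matrix.conjTranspose_mul, hX.eq,
      Matrix.conjTranspose_conjTranspose, Matrix.mul_assoc]
  have t1 : ((L * Lᴴ)⁻¹ * X).trace = H.trace := by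
    rw [hinv, Matrix.mul_assoc, Matrix.trace_mul_comm]
  have t2 : ((L * Lᴴ)⁻¹ * X * (L * Lᴴ)⁻¹ * X).trace = (H * Hᴴ).trace := by
    rw [hinv, hH]
    calc ((L⁻¹)ᴴ * L⁻¹ * X * ((L⁻¹)ᴴ * L⁻¹) * X).trace
        = ((L⁻¹)ᴴ * (L⁻¹ * X * (L⁻¹)ᴴ * L⁻¹ * X)).trace := by simp only [Matrix.mul_assoc]
      _ = _ := by rw [Matrix.trace_mul_comm]; simp only [hHdef, Matrix.mul_assoc]
  have hne : H ≠ 0 := by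
    intro h
    apply h0
    have h1 : (L⁻¹)ᴴ * Lᴴ = 1 := by
      rw [← Matrix.conjTranspose_mul, Matrix.mul_nonsing_inv _ hu, Matrix.conjTranspose_one]
    calc X = (L * L⁻¹) * X * ((L⁻¹)ᴴ * Lᴴ) := by
          rw [h1, Matrix.mul_nonsing_inv _ hu, one_mul, mul_one]
      _ = L * H * Lᴴ := by simp only [hHdef, Matrix.mul_assoc]
      _ = 0 := by rw [h, mul_zero, zero_mul]
  have t3 : (H * Hᴴ).trace.re = ∑ i, ∑ j, Complex.normSq (H i j) := by
    simp only [Matrix.trace, Matrix.diag, Matrix.mul_apply, Matrix.conjTranspose_apply,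
      Complex.re_sum]
    refine Finset.sum_congr rfl fun i _ => Finset.sum_congr rfl fun j _ => ?_
    rw [RCLike.star_def, Complex.mul_conj, Complex.ofReal_re]
  set τ := (H * Hᴴ).trace.re with hτ
  have hτpos : 0 < τ := by
    obtain ⟨i, j, hij⟩ : ∃ i j, H i j ≠ 0 := by
      by_contra hcon
      push Not at hcon
      exact hne (Matrix.ext hcon)
    rw [t3]
    refine Finset.sum_pos' (fun i _ => Finset.sum_nonneg fun j _ => Complex.normSq_nonneg _)
      ⟨i, Finset.mem_univ i, Finset.sum_pos' (fun j _ => Complex.normSq_nonneg _)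
        ⟨j, Finset.mem_univ j, Complex.normSq_pos.2 hij⟩⟩
  have hcs : H.trace.re * H.trace.re ≤ Fintype.card m * τ := by
    have e : H.trace.re = ∑ i, (H i i).re := by simp [Matrix.trace]
    have h1 := sq_sum_le_card_mul_sum_sq (s := Finset.univ) (f := fun i => (H i i).re)
    rw [Finset.card_univ, ← e, sq] at h1
    refine h1.trans (mul_le_mul_of_nonneg_left ?_ (Nat.cast_nonneg _))
    rw [t3]
    refine Finset.sum_le_sum fun i _ => ?_
    refine le_trans ?_ (Finset.single_le_sum (fun j _ => Complex.normSq_nonneg (H i j))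
      (Finset.mem_univ i))
    rw [Complex.normSq_apply, sq]
    nlinarith [mul_self_nonneg (H i i).im]
  rw [infoForm, t1, t2]
  rcases le_or_gt 0 b with hb | hb
  · have := mul_self_nonneg H.trace.re
    have := mul_pos ha hτpos
    have := mul_nonneg hb (mul_self_nonneg H.trace.re)
    linarith
  · nlinarith [mul_pos hab hτpos]

end InformationForm

/-! ### Projection off the nuisance tangent space -/

section SchurComplement

variable {m ι ν : Type*} [Fintype m] [DecidableEq m] [Fintype ν] [DecidableEq ν]
  {a b : ℝ} {G : Matrix m m ℂ}

/-- A kernel vector yields a real combination of the `D i` on which the form vanishes. Positivity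
makes that combination zero, and independence makes the vector zero. -/
theorem isUnit_information (hG : G.PosDef) (ha : 0 < a) (hab : 0 < a + b * Fintype.card m)
    {D : ν → Matrix m m ℂ} (hD : ∀ i, (D i).IsHermitian) (hli : LinearIndependent ℝ D) {T : ℕ}
    (hT : 0 < T) :
    IsUnit ((T : ℝ) • Matrix.of fun i j => infoForm a b G (D i) (D j)) := by
  have hT' : (T : ℝ) ≠ 0 := by positivity
  rw [Matrix.isUnit_iff_isUnit_det, isUnit_iff_ne_zero]
  intro hdet
  obtain ⟨v, hv, hv0⟩ := Matrix.exists_mulVec_eq_zero_iff.2 hdet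
  rw [Matrix.smul_mulVec] at hv0
  have hv1 := (smul_eq_zero.1 hv0).resolve_left hT'
  set X := ∑ i, v i • D i with hX
  have hq : infoForm a b G X X = 0 := by
    have h1 : infoForm a b G X X = ∑ i, v i * ∑ j, infoForm a b G (D i) (D j) * v j := by
      rw [← infoBilin_apply, hX]
      simp only [map_sum, map_smul, LinearMap.sum_apply, LinearMap.smul_apply, smul_eq_mul,
        infoBilin_apply, Finset.mul_sum]
      rw [Finset.sum_comm]
      exact Finset.sum_congr rfl fun i _ => Finset.sum_congr rfl fun j _ => by ring
    rw [h1]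
    refine Finset.sum_eq_zero fun i _ => ?_
    have := congrFun hv1 i
    simp only [Matrix.mulVec, dotProduct, Matrix.of_apply, Pi.zero_apply] at this
    rw [this, mul_zero]
  have hXH : X.IsHermitian := by
    rw [Matrix.IsHermitian, hX, Matrix.conjTranspose_sum]
    refine Finset.sum_congr rfl fun i _ => ?_
    rw [Matrix.conjTranspose_smul, (hD i).eq, star_trivial]
  by_cases h0 : X = 0
  · exact hv (funext fun i => Fintype.linearIndependent_iff.1 hli v h0 i)
  · exact (infoForm_self_pos hG ha hab hXH h0).ne' hq

/-- The efficient information is the information form on the components orthogonal to the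
nuisance tangent space. -/
theorem efficientInformation_eq {D : ι ⊕ ν → Matrix m m ℂ} {Y : ι → Matrix m m ℂ} {T : ℕ}
    {w : ι → ν → ℝ} (hw : ∀ k, D (.inl k) = Y k + ∑ c, w k c • D (.inr c))
    (hY : ∀ k c, infoForm a b G (Y k) (D (.inr c)) = 0)
    (hu : IsUnit ((T : ℝ) • Matrix.of fun i j => infoForm a b G (D (.inr i)) (D (.inr j)))) :
    efficientInformation ((T : ℝ) • Matrix.of fun i j => infoForm a b G (D i) (D j)) =
      (T : ℝ) • Matrix.of fun k l => infoForm a b G (Y k) (Y l) := by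
  set J22 := (T : ℝ) • Matrix.of fun i j => infoForm a b G (D (.inr i)) (D (.inr j)) with hJ
  set W : Matrix ι ν ℝ := Matrix.of w
  have e12 : ∀ k c, infoForm a b G (D (.inl k)) (D (.inr c)) =
      ∑ c', w k c' * infoForm a b G (D (.inr c')) (D (.inr c)) := fun k c => by
    rw [hw, infoForm_add_left, hY, zero_add, ← infoBilin_apply]
    simp only [map_sum, map_smul, LinearMap.sum_apply, LinearMap.smul_apply, smul_eq_mul,
      infoBilin_apply]
  have e11 : ∀ k l, infoForm a b G (D (.inl k)) (D (.inl l)) = infoForm a b G (Y k) (Y l) +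
      ∑ c, infoForm a b G (D (.inl k)) (D (.inr c)) * w l c := fun k l => by
    rw [infoForm_comm, hw l, infoForm_add_left, ← infoBilin_apply a b G (∑ c, _)]
    simp only [map_sum, map_smul, LinearMap.sum_apply, LinearMap.smul_apply, smul_eq_mul,
      infoBilin_apply]
    congr 1
    · rw [infoForm_comm, hw k, infoForm_add_left, ← infoBilin_apply a b G (∑ c, _)]
      simp only [map_sum, map_smul, LinearMap.sum_apply, LinearMap.smul_apply, smul_eq_mul,
        infoBilin_apply, infoForm_comm a b G _ (Y l), hY, mul_zero, Finset.sum_const_zero, add_zero]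
    · exact Finset.sum_congr rfl fun c _ => by rw [infoForm_comm, mul_comm]
  -- Orthogonality gives `J₁₂ = W J₂₂` and `J₁₁ = T⟨Y, Y⟩ + J₁₂ Wᵀ`; the subtracted term `J₁₂ J₂₂⁻¹
  -- J₂₁` is then `J₁₂ Wᵀ`.
  have h12 : ((T : ℝ) • Matrix.of fun i j => infoForm a b G (D i) (D j)).toBlocks₁₂ = W * J22 := by
    ext k c
    simp only [Matrix.toBlocks₁₂, Matrix.of_apply, Matrix.smul_apply, smul_eq_mul,
      Matrix.mul_apply, hJ, W, e12, Finset.mul_sum]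
    exact Finset.sum_congr rfl fun c' _ => by ring
  have h21 : ((T : ℝ) • Matrix.of fun i j => infoForm a b G (D i) (D j)).toBlocks₂₁ =
      (((T : ℝ) • Matrix.of fun i j => infoForm a b G (D i) (D j)).toBlocks₁₂)ᵀ := by
    ext c k
    simp [Matrix.toBlocks₁₂, Matrix.toBlocks₂₁, infoForm_comm a b G (D (.inr c))]
  have h11 : ((T : ℝ) • Matrix.of fun i j => infoForm a b G (D i) (D j)).toBlocks₁₁ =
      (T : ℝ) • (Matrix.of fun k l => infoForm a b G (Y k) (Y l)) +
      ((T : ℝ) • Matrix.of fun i j => infoForm a b G (D i) (D j)).toBlocks₁₂ * Wᵀ := by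
    ext k l
    simp only [Matrix.toBlocks₁₁, Matrix.toBlocks₁₂, Matrix.of_apply, Matrix.smul_apply,
      smul_eq_mul, Matrix.mul_apply, Matrix.add_apply, Matrix.transpose_apply, W, e11, mul_add,
      Finset.mul_sum]
    congr 1
    exact Finset.sum_congr rfl fun c _ => by ring
  have h22 : ((T : ℝ) • Matrix.of fun i j => infoForm a b G (D i) (D j)).toBlocks₂₂ = J22 := rfl
  have hs : J22ᵀ = J22 := by
    ext i j
    simp [hJ, infoForm_comm a b G (D (.inr j))]
  rw [efficientInformation, h21, h11, h22, h12, Matrix.transpose_mul, hs,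
    Matrix.mul_nonsing_inv_cancel_right _ _ ((Matrix.isUnit_iff_isUnit_det _).1 hu),
    Matrix.mul_assoc, add_sub_cancel_right]

end SchurComplement

/-! ### Tangent geometry of the noisy mixture -/

section Mixture

variable {m n : Type*} [Fintype m] [Fintype n] [DecidableEq m] [DecidableEq n]

section Projection

variable {B : Matrix m n ℂ}

theorem projPerp_mul (hB : IsUnit (Bᴴ * B)) : projPerp B * B = 0 := by
  rw [projPerp, Matrix.sub_mul, Matrix.one_mul, Matrix.mul_assoc, Matrix.mul_assoc,
    Matrix.nonsing_inv_mul _ ((Matrix.isUnit_iff_isUnit_det _).1 hB), Matrix.mul_one, sub_self]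

theorem projPerp_conjTranspose (B : Matrix m n ℂ) : (projPerp B)ᴴ = projPerp B := by
  rw [projPerp, Matrix.conjTranspose_sub, Matrix.conjTranspose_one, Matrix.conjTranspose_mul,
    Matrix.conjTranspose_mul, Matrix.conjTranspose_nonsing_inv, Matrix.conjTranspose_mul,
    Matrix.conjTranspose_conjTranspose, Matrix.mul_assoc]

theorem conjTranspose_mul_projPerp (hB : IsUnit (Bᴴ * B)) : Bᴴ * projPerp B = 0 := by
  rw [← Matrix.conjTranspose_conjTranspose (Bᴴ * projPerp B), Matrix.conjTranspose_mul,
    Matrix.conjTranspose_conjTranspose, projPerp_conjTranspose, projPerp_mul hB,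
    Matrix.conjTranspose_zero]

theorem projPerp_mul_self (hB : IsUnit (Bᴴ * B)) : projPerp B * projPerp B = projPerp B := by
  nth_rw 2 [projPerp]
  rw [Matrix.mul_sub, Matrix.mul_one, ← Matrix.mul_assoc, ← Matrix.mul_assoc, projPerp_mul hB,
    Matrix.zero_mul, Matrix.zero_mul, sub_zero]

end Projection

variable {B : Matrix m n ℂ} {R : Matrix n n ℂ} {s : ℝ}

theorem mixtureScatter_posDef {m n : Type*} [Fintype m] [Fintype n] [DecidableEq m]
    {B : Matrix m n ℂ} {R : Matrix n n ℂ} {s : ℝ} (hR : R.PosSemidef) (hs : 0 < s) :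
    (mixtureScatter B R s).PosDef := by
  refine Matrix.PosDef.posSemidef_add (hR.mul_mul_conjTranspose_same B) ?_
  exact Matrix.PosDef.one.smul (by exact_mod_cast hs)

theorem mixtureScatter_mul_projPerp (hB : IsUnit (Bᴴ * B)) :
    mixtureScatter B R s * projPerp B = (s : ℂ) • projPerp B := by
  rw [mixtureScatter, Matrix.add_mul, Matrix.mul_assoc, conjTranspose_mul_projPerp hB,
    Matrix.mul_zero, zero_add, Matrix.smul_mul, Matrix.one_mul]

/-- On the noise subspace the scatter matrix acts as the scalar `s`, hence its inverse as `1/s`. -/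
theorem inv_mixtureScatter_mul_projPerp (hB : IsUnit (Bᴴ * B)) (hR : R.PosSemidef) (hs : 0 < s) :
    (mixtureScatter B R s)⁻¹ * projPerp B = (s : ℂ)⁻¹ • projPerp B := by
  have hs' : (s : ℂ) ≠ 0 := by exact_mod_cast hs.ne'
  have hu := (Matrix.isUnit_iff_isUnit_det _).1 (mixtureScatter_posDef (B := B) hR hs).isUnit
  have h := congrArg (fun X => (s : ℂ)⁻¹ • ((mixtureScatter B R s)⁻¹ * X))
    (mixtureScatter_mul_projPerp (R := R) (s := s) hB)
  rw [Matrix.nonsing_inv_mul_cancel_left _ _ hu, Matrix.mul_smul, smul_smul,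
    inv_mul_cancel₀ hs', one_smul] at h
  exact h.symm

theorem projPerp_mul_inv_mixtureScatter (hB : IsUnit (Bᴴ * B)) (hR : R.PosSemidef) (hs : 0 < s) :
    projPerp B * (mixtureScatter B R s)⁻¹ = (s : ℂ)⁻¹ • projPerp B := by
  have h := congrArg Matrix.conjTranspose (inv_mixtureScatter_mul_projPerp hB hR hs)
  rw [Matrix.conjTranspose_mul, projPerp_conjTranspose, Matrix.conjTranspose_nonsing_inv,
    (mixtureScatter_posDef hR hs).isHermitian.eq, Matrix.conjTranspose_smul,
    projPerp_conjTranspose] at h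
  rw [h]
  simp

/-- The component of the tangent vector `C Bᴴ + B Cᴴ` orthogonal to the nuisance tangent space. -/
noncomputable def perpTangent (B C : Matrix m n ℂ) : Matrix m m ℂ :=
  projPerp B * C * Bᴴ + B * Cᴴ * projPerp B

/-- Cycling the trace brings `Bᴴ` and `Π⊥` together. As a consequence the product-of-traces term of
`infoForm` never contributes to the bound. -/
theorem trace_inv_mul_perpTangent (hB : IsUnit (Bᴴ * B)) (hR : R.PosSemidef) (hs : 0 < s)
    (C : Matrix m n ℂ) : ((mixtureScatter B R s)⁻¹ * perpTangent B C).trace = 0 := by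
  have h1 := inv_mixtureScatter_mul_projPerp hB hR hs
  have h2 := projPerp_mul_inv_mixtureScatter hB hR hs
  set Γ := (mixtureScatter B R s)⁻¹
  set P := projPerp B
  have hPB : P * B = 0 := projPerp_mul hB
  have hBP : Bᴴ * P = 0 := conjTranspose_mul_projPerp hB
  have e1 : (Γ * (P * C * Bᴴ)).trace = 0 := by
    calc (Γ * (P * C * Bᴴ)).trace = (Γ * P * C * Bᴴ).trace := by simp only [Matrix.mul_assoc]
      _ = (Bᴴ * ((s : ℂ)⁻¹ • P * C)).trace := by rw [h1, Matrix.trace_mul_comm]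
      _ = (s : ℂ)⁻¹ • (Bᴴ * P * C).trace := by
        rw [Matrix.smul_mul, Matrix.mul_smul, Matrix.trace_smul, Matrix.mul_assoc]
      _ = 0 := by rw [hBP]; simp
  have e2 : (Γ * (B * Cᴴ * P)).trace = 0 := by
    calc (Γ * (B * Cᴴ * P)).trace = (P * Γ * B * Cᴴ).trace := by
          rw [← Matrix.mul_assoc, Matrix.trace_mul_comm]; simp only [Matrix.mul_assoc]
      _ = (s : ℂ)⁻¹ • (P * B * Cᴴ).trace := by
        rw [h2, Matrix.smul_mul, Matrix.smul_mul, Matrix.trace_smul]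
      _ = 0 := by rw [hPB]; simp
  rw [perpTangent, Matrix.mul_add, Matrix.trace_add, e1, e2, add_zero]

theorem inv_mul_perpTangent_mul_inv (hB : IsUnit (Bᴴ * B)) (hR : R.PosSemidef) (hs : 0 < s)
    (C : Matrix m n ℂ) :
    (mixtureScatter B R s)⁻¹ * perpTangent B C * (mixtureScatter B R s)⁻¹ =
      (s : ℂ)⁻¹ • (projPerp B * C * Bᴴ * (mixtureScatter B R s)⁻¹ +
        (mixtureScatter B R s)⁻¹ * B * Cᴴ * projPerp B) := by
  have h1 := inv_mixtureScatter_mul_projPerp hB hR hs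
  have h2 := projPerp_mul_inv_mixtureScatter hB hR hs
  set Γ := (mixtureScatter B R s)⁻¹
  set P := projPerp B
  calc Γ * (P * C * Bᴴ + B * Cᴴ * P) * Γ
      = (Γ * P) * C * Bᴴ * Γ + Γ * B * Cᴴ * (P * Γ) := by
        simp only [Matrix.mul_add, Matrix.add_mul, Matrix.mul_assoc]
    _ = _ := by
        rw [h1, h2, smul_add]
        simp only [Matrix.smul_mul, Matrix.mul_smul]

theorem infoForm_perpTangent_mul (a b : ℝ) (hB : IsUnit (Bᴴ * B)) (hR : R.PosSemidef) (hs : 0 < s)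
    (C : Matrix m n ℂ) (E : Matrix n n ℂ) :
    infoForm a b (mixtureScatter B R s) (perpTangent B C) (B * E * Bᴴ) = 0 := by
  have hPB : projPerp B * B = 0 := projPerp_mul hB
  have hBP : Bᴴ * projPerp B = 0 := conjTranspose_mul_projPerp hB
  rw [infoForm, trace_inv_mul_perpTangent hB hR hs, inv_mul_perpTangent_mul_inv hB hR hs]
  set Γ := (mixtureScatter B R s)⁻¹
  set P := projPerp B
  have e1 : (P * C * Bᴴ * Γ * (B * E * Bᴴ)).trace = 0 := by
    calc (P * C * Bᴴ * Γ * (B * E * Bᴴ)).trace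
        = (P * (C * Bᴴ * Γ * B * E * Bᴴ)).trace := by simp only [Matrix.mul_assoc]
      _ = (C * Bᴴ * Γ * B * E * (Bᴴ * P)).trace := by
        rw [Matrix.trace_mul_comm]; simp only [Matrix.mul_assoc]
      _ = 0 := by rw [hBP]; simp
  have e2 : Γ * B * Cᴴ * P * (B * E * Bᴴ) = 0 := by
    calc Γ * B * Cᴴ * P * (B * E * Bᴴ) = Γ * B * Cᴴ * (P * B) * E * Bᴴ := by
          simp only [Matrix.mul_assoc]
      _ = 0 := by rw [hPB]; simp
  rw [Matrix.smul_mul, Matrix.add_mul, e2, add_zero, Matrix.trace_smul, e1]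
  simp

theorem infoForm_perpTangent_one (a b : ℝ) (hB : IsUnit (Bᴴ * B)) (hR : R.PosSemidef) (hs : 0 < s)
    (C : Matrix m n ℂ) : infoForm a b (mixtureScatter B R s) (perpTangent B C) 1 = 0 := by
  have h1 := inv_mixtureScatter_mul_projPerp hB hR hs
  have h2 := projPerp_mul_inv_mixtureScatter hB hR hs
  have hPB : projPerp B * B = 0 := projPerp_mul hB
  have hBP : Bᴴ * projPerp B = 0 := conjTranspose_mul_projPerp hB
  rw [infoForm, trace_inv_mul_perpTangent hB hR hs, inv_mul_perpTangent_mul_inv hB hR hs]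
  set Γ := (mixtureScatter B R s)⁻¹
  set P := projPerp B
  have e1 : (P * C * Bᴴ * Γ).trace = 0 := by
    calc (P * C * Bᴴ * Γ).trace = (P * (C * Bᴴ * Γ)).trace := by simp only [Matrix.mul_assoc]
      _ = (C * Bᴴ * (Γ * P)).trace := by
        rw [Matrix.trace_mul_comm]; simp only [Matrix.mul_assoc]
      _ = (s : ℂ)⁻¹ • (C * (Bᴴ * P)).trace := by
        rw [h1, Matrix.mul_smul, Matrix.trace_smul, Matrix.mul_assoc]
      _ = 0 := by rw [hBP]; simp
  have e2 : (Γ * B * Cᴴ * P).trace = 0 := by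
    calc (Γ * B * Cᴴ * P).trace = (P * Γ * (B * Cᴴ)).trace := by
          rw [Matrix.trace_mul_comm]; simp only [Matrix.mul_assoc]
      _ = (s : ℂ)⁻¹ • (P * B * Cᴴ).trace := by
        rw [h2, Matrix.smul_mul, Matrix.trace_smul, Matrix.mul_assoc]
      _ = 0 := by rw [hPB]; simp
  rw [Matrix.mul_one, Matrix.trace_smul, Matrix.trace_add, e1, e2]
  simp

/-- Of the four products only the two mixed ones survive; their traces are complex conjugates,
whence the factor `2`. -/
theorem infoForm_perpTangent (a b : ℝ) (hB : IsUnit (Bᴴ * B)) (hR : R.PosSemidef) (hs : 0 < s)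
    (C C' : Matrix m n ℂ) :
    infoForm a b (mixtureScatter B R s) (perpTangent B C) (perpTangent B C') =
      2 * a / s * (projPerp B * C' * Bᴴ * (mixtureScatter B R s)⁻¹ * B * Cᴴ).trace.re := by
  have h1 := inv_mixtureScatter_mul_projPerp hB hR hs
  have hPB : projPerp B * B = 0 := projPerp_mul hB
  have hBP : Bᴴ * projPerp B = 0 := conjTranspose_mul_projPerp hB
  have hPP := projPerp_mul_self hB
  have hPH := projPerp_conjTranspose B
  have hΓH : ((mixtureScatter B R s)⁻¹)ᴴ = (mixtureScatter B R s)⁻¹ := by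
    rw [Matrix.conjTranspose_nonsing_inv, (mixtureScatter_posDef hR hs).isHermitian.eq]
  rw [infoForm, trace_inv_mul_perpTangent hB hR hs, inv_mul_perpTangent_mul_inv hB hR hs,
    perpTangent]
  set Γ := (mixtureScatter B R s)⁻¹
  set P := projPerp B
  have e1 : P * C * Bᴴ * Γ * (P * C' * Bᴴ) = 0 := by
    calc P * C * Bᴴ * Γ * (P * C' * Bᴴ) = P * C * Bᴴ * (Γ * P) * C' * Bᴴ := by
          simp only [Matrix.mul_assoc]
      _ = (s : ℂ)⁻¹ • (P * C * (Bᴴ * P) * C' * Bᴴ) := by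
        rw [h1]; simp only [Matrix.mul_smul, Matrix.smul_mul, Matrix.mul_assoc]
      _ = 0 := by rw [hBP]; simp
  have e2 : Γ * B * Cᴴ * P * (B * C'ᴴ * P) = 0 := by
    calc Γ * B * Cᴴ * P * (B * C'ᴴ * P) = Γ * B * Cᴴ * (P * B) * C'ᴴ * P := by
          simp only [Matrix.mul_assoc]
      _ = 0 := by rw [hPB]; simp
  have e3 : (Γ * B * Cᴴ * P * (P * C' * Bᴴ)).trace = (P * C' * Bᴴ * Γ * B * Cᴴ).trace := by
    calc (Γ * B * Cᴴ * P * (P * C' * Bᴴ)).trace = (Γ * B * Cᴴ * (P * P * C' * Bᴴ)).trace := by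
          simp only [Matrix.mul_assoc]
      _ = _ := by rw [hPP, Matrix.trace_mul_comm]; simp only [Matrix.mul_assoc]
  have e4 : (P * C * Bᴴ * Γ * (B * C'ᴴ * P)).trace =
      star (P * C' * Bᴴ * Γ * B * Cᴴ).trace := by
    rw [← Matrix.trace_conjTranspose]
    simp only [Matrix.conjTranspose_mul, Matrix.conjTranspose_conjTranspose, hPH, hΓH]
    calc (P * C * Bᴴ * Γ * (B * C'ᴴ * P)).trace = (P * (C * Bᴴ * Γ * B * C'ᴴ * P)).trace := by
          simp only [Matrix.mul_assoc]
      _ = (C * Bᴴ * Γ * B * C'ᴴ * (P * P)).trace := by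
        rw [Matrix.trace_mul_comm]; simp only [Matrix.mul_assoc]
      _ = _ := by rw [hPP]; simp only [Matrix.mul_assoc]
  have h5 : ∀ z : ℂ, ((s : ℂ)⁻¹ * z).re = s⁻¹ * z.re := fun z => by
    rw [← Complex.ofReal_inv, Complex.re_ofReal_mul]
  rw [Matrix.smul_mul, Matrix.add_mul, Matrix.mul_add, Matrix.mul_add, e1, e2, zero_add, add_zero,
    Matrix.trace_smul, Matrix.trace_add, e3, e4, smul_eq_mul, h5, Complex.add_re,
    RCLike.star_def, Complex.conj_re]
  simp only [Complex.zero_re, zero_mul, mul_zero, add_zero]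
  ring

theorem mul_conjTranspose_injective {m n : Type*} [Fintype m] [Fintype n] [DecidableEq n]
    {B : Matrix m n ℂ} (hB : IsUnit (Bᴴ * B)) {X : Matrix n n ℂ}
    (h : B * X * Bᴴ = 0) : X = 0 := by
  have hd := (Matrix.isUnit_iff_isUnit_det _).1 hB
  calc X = ((Bᴴ * B)⁻¹ * (Bᴴ * B)) * X * ((Bᴴ * B) * (Bᴴ * B)⁻¹) := by
        rw [Matrix.nonsing_inv_mul _ hd, Matrix.mul_nonsing_inv _ hd, Matrix.one_mul,
          Matrix.mul_one]
    _ = (Bᴴ * B)⁻¹ * Bᴴ * (B * X * Bᴴ) * (B * (Bᴴ * B)⁻¹) := by simp only [Matrix.mul_assoc]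
    _ = 0 := by rw [h]; simp

/-- Otherwise the identity of order `card m` would factor through `B`, whose rank is at most `card
n`. -/
theorem projPerp_ne_zero (B : Matrix m n ℂ) (hc : Fintype.card n < Fintype.card m) :
    projPerp B ≠ 0 := by
  intro h
  rw [projPerp, sub_eq_zero, Matrix.mul_assoc] at h
  have h1 := Matrix.rank_mul_le_left B ((Bᴴ * B)⁻¹ * Bᴴ)
  rw [← h, Matrix.rank_one] at h1
  exact absurd (h1.trans (Matrix.rank_le_card_width B)) (not_le.2 hc)

/-- Multiplying a relation by `Π⊥` kills the source directions and leaves the noise coefficient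
times `Π⊥ ≠ 0`; this is where more sensors than sources are needed. -/
theorem linearIndependent_nuisance {κ : Type*} [Fintype κ] (hB : IsUnit (Bᴴ * B))
    (hc : Fintype.card n < Fintype.card m) {E : κ → Matrix n n ℂ} (hE : LinearIndependent ℝ E) :
    LinearIndependent ℝ (Sum.elim (fun c => B * E c * Bᴴ) fun _ : Unit => (1 : Matrix m m ℂ)) := by
  rw [Fintype.linearIndependent_iff] at hE ⊢
  intro v hv
  simp only [Fintype.sum_sum_type, Sum.elim_inl, Sum.elim_inr, Finset.univ_unique,
    Finset.sum_singleton] at hv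
  have hsum : ∑ c, v (.inl c) • (B * E c * Bᴴ) = B * (∑ c, v (.inl c) • E c) * Bᴴ := by
    rw [Matrix.mul_sum, Matrix.sum_mul]
    exact Finset.sum_congr rfl fun c _ => by rw [Matrix.mul_smul, Matrix.smul_mul]
  rw [hsum] at hv
  have h1 := congrArg (projPerp B * ·) hv
  simp only [Matrix.mul_add, Matrix.mul_smul, Matrix.mul_one, Matrix.mul_zero,
    ← Matrix.mul_assoc, projPerp_mul hB, Matrix.zero_mul, zero_add] at h1
  have hv2 : v (.inr default) = 0 := (smul_eq_zero.1 h1).resolve_right (projPerp_ne_zero B hc)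
  rw [hv2, zero_smul, add_zero] at hv
  have h3 := hE _ (mul_conjTranspose_injective hB hv)
  rintro (c | u)
  · exact h3 c
  · exact hv2

/-- The coordinates of the nuisance component of the tangent vector `C Bᴴ + B Cᴴ`. -/
noncomputable def nuisanceTangent (B C : Matrix m n ℂ) : Matrix n n ℂ :=
  (Bᴴ * B)⁻¹ * Bᴴ * C + ((Bᴴ * B)⁻¹ * Bᴴ * C)ᴴ

/-- Split `C = Π⊥C + B(BᴴB)⁻¹BᴴC` in each term: the range part gives the Hermitian source
perturbation `nuisanceTangent`. -/
theorem tangent_eq (B C : Matrix m n ℂ) :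
    C * Bᴴ + B * Cᴴ = perpTangent B C + B * nuisanceTangent B C * Bᴴ := by
  have h : ((Bᴴ * B)⁻¹ * Bᴴ * C)ᴴ = Cᴴ * B * (Bᴴ * B)⁻¹ := by
    rw [Matrix.conjTranspose_mul, Matrix.conjTranspose_mul, Matrix.conjTranspose_nonsing_inv,
      Matrix.conjTranspose_mul, Matrix.conjTranspose_conjTranspose, Matrix.mul_assoc]
  rw [perpTangent, nuisanceTangent, h, projPerp]
  simp only [Matrix.sub_mul, Matrix.mul_sub, Matrix.mul_add, Matrix.add_mul, Matrix.one_mul,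
    Matrix.mul_one, Matrix.mul_assoc]
  abel

/-- The concentrated Fisher information of a mixture model whose information matrix is given by
`infoForm`. -/
theorem efficientInformation_mixture {ι κ : Type*} [Fintype ι] [DecidableEq ι] [Fintype κ]
    [DecidableEq κ] {a b : ℝ} (ha : 0 < a) (hab : 0 < a + b * Fintype.card m)
    (hB : IsUnit (Bᴴ * B)) (hc : Fintype.card n < Fintype.card m) (hR : R.PosSemidef) (hs : 0 < s)
    {B' : ι → Matrix m n ℂ} {E : κ → Matrix n n ℂ} (hEh : ∀ c, (E c).IsHermitian)
    (hE : LinearIndependent ℝ E)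
    (hspan : ∀ k, nuisanceTangent B (B' k * R) ∈ Submodule.span ℝ (Set.range E))
    {D : ι ⊕ (κ ⊕ Unit) → Matrix m m ℂ}
    (hDk : ∀ k, D (.inl k) = B' k * R * Bᴴ + B * (B' k * R)ᴴ)
    (hDc : ∀ c, D (.inr (.inl c)) = B * E c * Bᴴ) (hD1 : D (.inr (.inr ())) = 1) {T : ℕ}
    (hT : 0 < T) {J : Matrix (ι ⊕ (κ ⊕ Unit)) (ι ⊕ (κ ⊕ Unit)) ℝ}
    (hJ : J = (T : ℝ) • Matrix.of fun i j => infoForm a b (mixtureScatter B R s) (D i) (D j)) :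
    IsUnit J.toBlocks₂₂ ∧ efficientInformation J = (T : ℝ) • Matrix.of fun k l => 2 * a / s *
      (projPerp B * B' l * R * Bᴴ * (mixtureScatter B R s)⁻¹ * B * R * (B' k)ᴴ).trace.re := by
  have hDr : (fun c => D (.inr c)) =
      Sum.elim (fun c => B * E c * Bᴴ) fun _ : Unit => (1 : Matrix m m ℂ) := by
    ext (c | c) : 1
    · exact hDc c
    · exact hD1
  have hu : IsUnit ((T : ℝ) • Matrix.of fun i j =>
      infoForm a b (mixtureScatter B R s) (D (.inr i)) (D (.inr j))) := by
    refine isUnit_information (mixtureScatter_posDef hR hs) ha hab (D := fun c => D (.inr c)) ?_ ?_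
      hT
    · rintro (c | c)
      · rw [hDc, Matrix.IsHermitian, Matrix.conjTranspose_mul, Matrix.conjTranspose_mul,
          Matrix.conjTranspose_conjTranspose, (hEh c).eq, Matrix.mul_assoc]
      · exact hD1 ▸ Matrix.isHermitian_one
    · rw [hDr]
      exact linearIndependent_nuisance hB hc hE
  have hw : ∀ k, ∃ w : κ → ℝ, ∑ c, w c • E c = nuisanceTangent B (B' k * R) := fun k =>
    (Submodule.mem_span_range_iff_exists_fun ℝ).1 (hspan k)
  choose w hw using hw
  subst hJ
  refine ⟨hu, ?_⟩
  rw [efficientInformation_eq (Y := fun k => perpTangent B (B' k * R))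
    -- The noise direction has coefficient `0`: the decomposition uses source directions only.
    (w := fun k => Sum.elim (w k) 0) (fun k => ?_) (fun k c => ?_) hu]
  · congr 1
    ext k l
    rw [Matrix.of_apply, Matrix.of_apply, infoForm_perpTangent a b hB hR hs,
      Matrix.conjTranspose_mul, hR.isHermitian.eq]
    simp only [Matrix.mul_assoc]
  · rw [hDk, tangent_eq, ← hw k, Matrix.mul_sum, Matrix.sum_mul, Fintype.sum_sum_type]
    simp [hDc, Matrix.mul_smul, Matrix.smul_mul]
  · rcases c with c | c
    · rw [hDc, infoForm_perpTangent_mul a b hB hR hs]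
    · exact hD1 ▸ infoForm_perpTangent_one a b hB hR hs _

end Mixture

/-! ### Algebra of augmented matrices -/

section Augmented

variable {l m n : Type*}

theorem augMat_mul [Fintype m] (B C : Matrix l m ℂ) (B' C' : Matrix m n ℂ) :
    augMat B C * augMat B' C' =
      augMat (B * B' + C * C'.map conj) (B * C' + C * B'.map conj) := by
  rw [augMat, augMat, augMat, Matrix.fromBlocks_multiply]
  have h : ∀ X : Matrix m n ℂ, (X.map conj).map conj = X := fun X => by ext; simp
  have hm : ∀ (X : Matrix l m ℂ) (Y : Matrix m n ℂ), (X * Y).map conj = X.map conj * Y.map conj :=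
    fun X Y => Matrix.map_mul (f := starRingEnd ℂ)
  have ha : ∀ X Y : Matrix l n ℂ, (X + Y).map conj = X.map conj + Y.map conj :=
    fun X Y => Matrix.map_add (starRingEnd ℂ) (map_add _) X Y
  rw [ha, ha, hm, hm, hm, hm, h, h, add_comm (C.map conj * B'), add_comm (C.map conj * C')]

theorem augMat_zero_mul [Fintype m] (B : Matrix l m ℂ) (B' C' : Matrix m n ℂ) :
    augMat B 0 * augMat B' C' = augMat (B * B') (B * C') := by
  rw [augMat_mul]; simp

theorem augMat_mul_zero [Fintype m] (B C : Matrix l m ℂ) (B' : Matrix m n ℂ) :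
    augMat B C * augMat B' 0 = augMat (B * B') (C * B'.map conj) := by
  rw [augMat_mul]; simp

theorem augMat_add (B C B' C' : Matrix m n ℂ) :
    augMat B C + augMat B' C' = augMat (B + B') (C + C') := by
  rw [augMat, augMat, augMat, Matrix.fromBlocks_add]
  congr 1 <;> ext <;> simp

theorem augMat_smul (r : ℝ) (B C : Matrix m n ℂ) :
    r • augMat B C = augMat (r • B) (r • C) := by
  ext (i | i) (j | j) <;> simp [augMat]

theorem augMat_conjTranspose (B C : Matrix m n ℂ) : (augMat B C)ᴴ = augMat Bᴴ Cᵀ := by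
  ext (i | i) (j | j) <;> simp [augMat]

theorem augMat_one [DecidableEq m] : augMat (1 : Matrix m m ℂ) 0 = 1 := by
  rw [augMat, ← Matrix.fromBlocks_one]
  congr 1
  · ext; simp
  · ext i j; simp [Matrix.one_apply, apply_ite]

theorem augMat_inj {B C B' C' : Matrix m n ℂ} :
    augMat B C = augMat B' C' ↔ B = B' ∧ C = C' := by
  refine ⟨fun h => ?_, fun h => by rw [h.1, h.2]⟩
  have := Matrix.fromBlocks_inj.1 h
  exact ⟨this.1, this.2.1⟩

theorem trace_augMat_re [Fintype m] (B C : Matrix m m ℂ) :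
    (augMat B C).trace.re = 2 * B.trace.re := by
  simp [augMat, Matrix.trace, two_mul]

theorem inv_augMat_zero [Fintype m] [DecidableEq m] {S : Matrix m m ℂ} (hS : IsUnit S) :
    (augMat S 0)⁻¹ = augMat S⁻¹ 0 := by
  refine Matrix.inv_eq_left_inv ?_
  rw [augMat_zero_mul, Matrix.nonsing_inv_mul _ ((Matrix.isUnit_iff_isUnit_det _).1 hS),
    Matrix.mul_zero, augMat_one]

theorem isUnit_augMat_zero [Fintype m] [DecidableEq m] {S : Matrix m m ℂ} (hS : IsUnit S) :
    IsUnit (augMat S 0) := by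
  refine IsUnit.of_mul_eq_one (augMat S⁻¹ 0) ?_
  rw [augMat_zero_mul, Matrix.mul_nonsing_inv _ ((Matrix.isUnit_iff_isUnit_det _).1 hS),
    Matrix.mul_zero, augMat_one]

theorem det_augMat_zero [Fintype m] [DecidableEq m] (S : Matrix m m ℂ) :
    (augMat S 0).det = (Complex.normSq S.det : ℂ) := by
  have h : (S.map conj).det = conj S.det := (RingHom.map_det (starRingEnd ℂ) S).symm
  rw [augMat, Matrix.det_fromBlocks_zero₁₂, h, Complex.mul_conj]

theorem IsAugmented.mul [Fintype m] {X : Matrix (l ⊕ l) (m ⊕ m) ℂ} {Y : Matrix (m ⊕ m) (n ⊕ n) ℂ}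
    (hX : IsAugmented X) (hY : IsAugmented Y) : IsAugmented (X * Y) := by
  obtain ⟨B, C, rfl⟩ := hX
  obtain ⟨B', C', rfl⟩ := hY
  exact ⟨_, _, augMat_mul B C B' C'⟩

theorem IsAugmented.add {X Y : Matrix (m ⊕ m) (n ⊕ n) ℂ}
    (hX : IsAugmented X) (hY : IsAugmented Y) : IsAugmented (X + Y) := by
  obtain ⟨B, C, rfl⟩ := hX
  obtain ⟨B', C', rfl⟩ := hY
  exact ⟨_, _, augMat_add B C B' C'⟩

theorem IsAugmented.conjTranspose {X : Matrix (m ⊕ m) (n ⊕ n) ℂ} (hX : IsAugmented X) :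
    IsAugmented Xᴴ := by
  obtain ⟨B, C, rfl⟩ := hX
  exact ⟨_, _, augMat_conjTranspose B C⟩

theorem isAugmented_augMat (B C : Matrix m n ℂ) : IsAugmented (augMat B C) := ⟨B, C, rfl⟩

theorem isAugmented_smul_one [DecidableEq m] (s : ℝ) :
    IsAugmented ((s : ℂ) • (1 : Matrix (m ⊕ m) (m ⊕ m) ℂ)) := by
  refine ⟨s • 1, s • 0, ?_⟩
  rw [← augMat_smul, augMat_one]
  ext; simp

/-- Augmented matrices are the fixed points of entrywise conjugation combined with swapping both
halves. This operation commutes with inversion, so inverses stay augmented without any block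
formula. -/
theorem isAugmented_iff {X : Matrix (m ⊕ m) (n ⊕ n) ℂ} :
    IsAugmented X ↔ (X.map conj).submatrix Sum.swap Sum.swap = X := by
  constructor
  · rintro ⟨B, C, rfl⟩
    ext (i | i) (j | j) <;> simp [augMat]
  · intro h
    refine ⟨X.toBlocks₁₁, X.toBlocks₁₂, ?_⟩
    ext (i | i) (j | j)
    · rfl
    · rfl
    · rw [← h]; simp [augMat, Matrix.toBlocks₁₂, ← congrFun (congrFun h (.inl i)) (.inr j)]
    · rw [← h]; simp [augMat, Matrix.toBlocks₁₁, ← congrFun (congrFun h (.inl i)) (.inl j)]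

theorem IsAugmented.inv [Fintype m] [DecidableEq m] {X : Matrix (m ⊕ m) (m ⊕ m) ℂ}
    (hX : IsAugmented X) : IsAugmented X⁻¹ := by
  rw [isAugmented_iff] at hX ⊢
  have h : ∀ Y : Matrix (m ⊕ m) (m ⊕ m) ℂ, Y.map conj = Yᴴᵀ := fun Y => by ext; simp
  have h2 : (X⁻¹).map conj = (X.map conj)⁻¹ := by
    rw [h, h, Matrix.conjTranspose_nonsing_inv, Matrix.transpose_nonsing_inv]
  have h3 := Matrix.inv_submatrix_equiv (X.map conj) (Equiv.sumComm m m) (Equiv.sumComm m m)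
  rw [h2]
  exact h3.symm.trans (congrArg _ hX)

theorem augMat_zero_posDef [Fintype m] [DecidableEq m] {S : Matrix m m ℂ} (hS : S.PosDef) :
    (augMat S 0).PosDef := by
  obtain ⟨L, -, hL⟩ := exists_mul_conjTranspose_of_posDef hS
  have h : augMat S 0 = augMat L 0 * (augMat L 0)ᴴ := by
    rw [augMat_conjTranspose, Matrix.transpose_zero, augMat_zero_mul, Matrix.mul_zero, hL]
  have hp : (augMat S 0).PosSemidef := h ▸ Matrix.posSemidef_self_mul_conjTranspose _
  exact hp.posDef_iff_isUnit.2 (isUnit_augMat_zero hS.isUnit)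

theorem isUnit_of_rank_eq_card [Fintype m] [DecidableEq m] {S : Matrix m m ℂ}
    (h : S.rank = Fintype.card m) : IsUnit S := by
  rw [← Matrix.mulVec_surjective_iff_isUnit]
  have : LinearMap.range S.mulVecLin = ⊤ :=
    Submodule.eq_top_of_finrank_eq (by rw [Module.finrank_fintype_fun_eq_card]; exact h)
  exact LinearMap.range_eq_top.1 this

theorem projPerp_augMat [Fintype m] [Fintype n] [DecidableEq m] [DecidableEq n]
    {B : Matrix m n ℂ} (hB : IsUnit (Bᴴ * B)) : projPerp (augMat B 0) = augMat (projPerp B) 0 := by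
  rw [projPerp, augMat_conjTranspose, Matrix.transpose_zero, augMat_zero_mul, Matrix.mul_zero,
    inv_augMat_zero hB, augMat_zero_mul, Matrix.mul_zero, augMat_zero_mul, Matrix.mul_zero,
    sub_eq_iff_eq_add, augMat_add, projPerp, sub_add_cancel, add_zero, augMat_one]

end Augmented

/-! ### Circular laws as noncircular ones -/

section CircularAsNoncircular

/-- The augmented determinant is `|det S|²`, with square root `det S` by positivity, and the doubled
quadratic form is compensated by the `½`. -/
theorem circularCESDensity_eq {M : ℕ} (g : ℝ → ℝ) {S : Matrix (Fin M) (Fin M) ℂ}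
    (hS : S.IsHermitian) (hd : 0 < S.det.re) (z : Fin M → ℂ) :
    circularCESDensity g S z = noncircularCESDensity g (augMat S 0) z := by
  have him : S.det.im = 0 := by
    have h := congrArg Matrix.det hS.eq
    rw [Matrix.det_conjTranspose] at h
    exact Complex.conj_eq_iff_im.1 h
  have hu : IsUnit S := by
    rw [Matrix.isUnit_iff_isUnit_det, isUnit_iff_ne_zero]
    intro h; simp [h] at hd
  have hs : Real.sqrt (augMat S 0).det.re = S.det.re := by
    rw [det_augMat_zero, Complex.ofReal_re, Complex.normSq_apply, him, mul_zero, add_zero,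
      Real.sqrt_mul_self hd.le]
  have hq : (star (augVec z) ⬝ᵥ ((augMat S 0)⁻¹ *ᵥ augVec z)).re =
      2 * (star z ⬝ᵥ (S⁻¹ *ᵥ z)).re := by
    rw [inv_augMat_zero hu]
    simp [dotProduct, Matrix.mulVec, augVec, augMat, two_mul]
    simp only [← neg_add, Finset.sum_neg_distrib, mul_neg, sub_neg_eq_add, Finset.sum_add_distrib]
  rw [circularCESDensity, noncircularCESDensity, hs, hq]
  congr 2
  ring

end CircularAsNoncircular

/-! ### Derivatives of scatter matrices -/

section Derivatives

variable {l m n : Type*}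

theorem hasDerivAt_matrix_mul [Fintype m] {X : ℝ → Matrix l m ℂ} {Y : ℝ → Matrix m n ℂ}
    {X' : Matrix l m ℂ} {Y' : Matrix m n ℂ} {t₀ : ℝ}
    (hX : ∀ i j, HasDerivAt (fun t => X t i j) (X' i j) t₀)
    (hY : ∀ i j, HasDerivAt (fun t => Y t i j) (Y' i j) t₀) (i : l) (j : n) :
    HasDerivAt (fun t => (X t * Y t) i j) ((X' * Y t₀ + X t₀ * Y') i j) t₀ := by
  simp only [Matrix.add_apply, Matrix.mul_apply, ← Finset.sum_add_distrib]
  exact HasDerivAt.fun_sum fun k _ => (hX i k).mul (hY k j)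

theorem hasDerivAt_mixtureScatter [Fintype n] [DecidableEq m] {B : ℝ → Matrix m n ℂ}
    {R : ℝ → Matrix n n ℂ} {s : ℝ → ℝ} {B' : Matrix m n ℂ} {R' : Matrix n n ℂ} {s' : ℝ} {t₀ : ℝ}
    (hB : ∀ i j, HasDerivAt (fun t => B t i j) (B' i j) t₀)
    (hR : ∀ i j, HasDerivAt (fun t => R t i j) (R' i j) t₀) (hs : HasDerivAt s s' t₀) (i j : m) :
    HasDerivAt (fun t => mixtureScatter (B t) (R t) (s t) i j)
      (((B' * R t₀ + B t₀ * R') * (B t₀)ᴴ + B t₀ * R t₀ * B'ᴴ + (s' : ℂ) • 1 :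
        Matrix m m ℂ) i j) t₀ := by
  have h1 := hasDerivAt_matrix_mul (hasDerivAt_matrix_mul hB hR)
    (Y := fun t => (B t)ᴴ) (Y' := B'ᴴ) (fun i j => (hB j i).star) i j
  have h2 : HasDerivAt (fun t => ((s t : ℂ) • (1 : Matrix m m ℂ)) i j)
      (((s' : ℂ) • (1 : Matrix m m ℂ)) i j) t₀ := by
    simpa using hs.ofReal_comp.mul_const ((1 : Matrix m m ℂ) i j)
  exact h1.add h2

theorem hasDerivAt_augMat {X Y : ℝ → Matrix m n ℂ} {X' Y' : Matrix m n ℂ} {t₀ : ℝ}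
    (hX : ∀ i j, HasDerivAt (fun t => X t i j) (X' i j) t₀)
    (hY : ∀ i j, HasDerivAt (fun t => Y t i j) (Y' i j) t₀) (i : m ⊕ m) (j : n ⊕ n) :
    HasDerivAt (fun t => augMat (X t) (Y t) i j) (augMat X' Y' i j) t₀ := by
  rcases i with i | i <;> rcases j with j | j
  · exact hX i j
  · exact hY i j
  · exact (hY i j).star
  · exact (hX i j).star

end Derivatives

/-! ### Real coordinates of the source matrices -/

section Coordinates

variable {K : ℕ} {κ κ' : Type*} [Fintype κ] [Fintype κ']
  (b : Module.Basis κ ℝ (selfAdjoint (Matrix (Fin K) (Fin K) ℂ)))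
  (c : Module.Basis κ' ℝ (symmetricMatrices K))

theorem hermitianOf_eq_sum (ρ : κ → ℝ) :
    hermitianOf b ρ = ∑ a, ρ a • (b a : Matrix (Fin K) (Fin K) ℂ) := by
  rw [hermitianOf, AddSubgroup.val_finsetSum]
  simp

theorem symmetricOf_eq_sum (ρ : κ' → ℝ) :
    symmetricOf c ρ = ∑ a, ρ a • (c a : Matrix (Fin K) (Fin K) ℂ) := by
  simp [symmetricOf]

theorem hermitianOf_isHermitian (ρ : κ → ℝ) : (hermitianOf b ρ).IsHermitian :=
  (∑ a, ρ a • b a : selfAdjoint (Matrix (Fin K) (Fin K) ℂ)).2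

theorem symmetricOf_transpose (ρ : κ' → ℝ) : (symmetricOf c ρ)ᵀ = symmetricOf c ρ :=
  (∑ a, ρ a • c a : symmetricMatrices K).2

theorem exists_hermitianOf_eq {Z : Matrix (Fin K) (Fin K) ℂ} (hZ : Z.IsHermitian) :
    ∃ ρ, hermitianOf b ρ = Z :=
  ⟨b.repr ⟨Z, hZ⟩, congrArg Subtype.val (b.sum_repr ⟨Z, hZ⟩)⟩

theorem exists_symmetricOf_eq {Z : Matrix (Fin K) (Fin K) ℂ} (hZ : Zᵀ = Z) :
    ∃ ρ, symmetricOf c ρ = Z :=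
  ⟨c.repr ⟨Z, hZ⟩, congrArg Subtype.val (c.sum_repr ⟨Z, hZ⟩)⟩

theorem hermitianOf_eq_zero {ρ : κ → ℝ} (h : hermitianOf b ρ = 0) : ρ = 0 :=
  funext (Fintype.linearIndependent_iff.1 b.linearIndependent ρ (Subtype.ext h))

theorem symmetricOf_eq_zero {ρ : κ' → ℝ} (h : symmetricOf c ρ = 0) : ρ = 0 :=
  funext (Fintype.linearIndependent_iff.1 c.linearIndependent ρ (Subtype.ext h))

theorem hasDerivAt_hermitianOf {ρ : ℝ → κ → ℝ} {v : κ → ℝ} {t₀ : ℝ}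
    (h : ∀ a, HasDerivAt (fun t => ρ t a) (v a) t₀) (i j : Fin K) :
    HasDerivAt (fun t => hermitianOf b (ρ t) i j) (hermitianOf b v i j) t₀ := by
  simp only [hermitianOf_eq_sum, Matrix.sum_apply, Matrix.smul_apply, Complex.real_smul]
  exact HasDerivAt.fun_sum fun a _ => (h a).ofReal_comp.mul_const _

theorem hasDerivAt_symmetricOf {ρ : ℝ → κ' → ℝ} {v : κ' → ℝ} {t₀ : ℝ}
    (h : ∀ a, HasDerivAt (fun t => ρ t a) (v a) t₀) (i j : Fin K) :
    HasDerivAt (fun t => symmetricOf c (ρ t) i j) (symmetricOf c v i j) t₀ := by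
  simp only [symmetricOf_eq_sum, Matrix.sum_apply, Matrix.smul_apply, Complex.real_smul]
  exact HasDerivAt.fun_sum fun a _ => (h a).ofReal_comp.mul_const _

end Coordinates

/-! ### Tangent directions of the two models -/

section Tangents

theorem hasDerivAt_add_smul_apply {ι : Type*} (α v : ι → ℝ) (x : ι) :
    HasDerivAt (fun r : ℝ => (α + r • v) x) (v x) 0 := by
  simpa using ((hasDerivAt_id (0 : ℝ)).mul_const (v x)).const_add (α x)

theorem hasDerivAt_steering {L M K : ℕ} {ν : Type*} [DecidableEq ν]
    {A : (Fin L → ℝ) → Matrix (Fin M) (Fin K) ℂ} {θ : Fin L → ℝ}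
    (hA : ∀ k i j, LineDifferentiableAt ℝ (fun a => A a i j) θ (Pi.single k 1)) (β : ν → ℝ)
    (i : Fin L ⊕ ν) (x : Fin M) (y : Fin K) :
    HasDerivAt (fun r : ℝ => A (fun k => (Sum.elim θ β + r • Pi.single i 1 : Fin L ⊕ ν → ℝ) (.inl k)) x y)
      (Sum.elim (partialMat A θ) (fun _ => 0) i x y) 0 := by
  rcases i with k | j
  · have h := (hA k x y).hasLineDerivAt
    refine HasDerivAt.congr_of_eventuallyEq h (Filter.Eventually.of_forall fun r => ?_)
    refine congrArg (fun a => A a x y) (funext fun k' => ?_)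
    simp [Pi.single_apply]
  · simpa using! hasDerivAt_const (0 : ℝ) (A θ x y)

theorem isHermitian_mixtureScatter {m n : Type*} [Fintype n] [DecidableEq m] (B : Matrix m n ℂ)
    {R : Matrix n n ℂ} (hR : R.IsHermitian) (s : ℝ) : (mixtureScatter B R s).IsHermitian := by
  rw [mixtureScatter, Matrix.IsHermitian, Matrix.conjTranspose_add, Matrix.conjTranspose_mul,
    Matrix.conjTranspose_mul, Matrix.conjTranspose_conjTranspose, hR.eq, Matrix.mul_assoc,
    Matrix.conjTranspose_smul, Matrix.conjTranspose_one]
  simp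

theorem isHermitian_tangent {m n : Type*} [Fintype n] [DecidableEq m] (B B' : Matrix m n ℂ)
    {R R' : Matrix n n ℂ} (hR : R.IsHermitian) (hR' : R'.IsHermitian) (s : ℝ) :
    ((B' * R + B * R') * Bᴴ + B * R * B'ᴴ + (s : ℂ) • (1 : Matrix m m ℂ)).IsHermitian := by
  have h : (s : ℂ) • (1 : Matrix m m ℂ) = ((s : ℂ) • (1 : Matrix m m ℂ))ᴴ := by
    rw [Matrix.conjTranspose_smul, Matrix.conjTranspose_one]; simp
  rw [Matrix.IsHermitian, Matrix.conjTranspose_add, ← h]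
  congr 1
  simp only [Matrix.conjTranspose_add, Matrix.conjTranspose_mul, Matrix.conjTranspose_conjTranspose,
    hR.eq, hR'.eq, Matrix.add_mul, Matrix.mul_assoc]
  abel

theorem isAugmented_mixtureScatter {m n : Type*} [Fintype n] [DecidableEq m]
    {B : Matrix (m ⊕ m) (n ⊕ n) ℂ} {R : Matrix (n ⊕ n) (n ⊕ n) ℂ} (hB : IsAugmented B)
    (hR : IsAugmented R) (s : ℝ) : IsAugmented (mixtureScatter B R s) :=
  ((hB.mul hR).mul hB.conjTranspose).add (isAugmented_smul_one s)

theorem nuisanceTangent_isHermitian {m n : Type*} [Fintype m] [Fintype n] [DecidableEq n]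
    (B C : Matrix m n ℂ) : (nuisanceTangent B C).IsHermitian := by
  rw [nuisanceTangent, Matrix.IsHermitian, Matrix.conjTranspose_add,
    Matrix.conjTranspose_conjTranspose, add_comm]

theorem sum_augMat {m n μ : Type*} (s : Finset μ) (X Y : μ → Matrix m n ℂ) :
    ∑ x ∈ s, augMat (X x) (Y x) = augMat (∑ x ∈ s, X x) (∑ x ∈ s, Y x) := by
  classical
  induction s using Finset.induction_on with
  | empty => ext (i | i) (j | j) <;> simp [augMat]
  | insert x s hx ih => rw [Finset.sum_insert hx, Finset.sum_insert hx, Finset.sum_insert hx, ih,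
      augMat_add]

variable {K : ℕ} {κ κ' : Type*} [Fintype κ] [Fintype κ']
  (b : Module.Basis κ ℝ (selfAdjoint (Matrix (Fin K) (Fin K) ℂ)))
  (c : Module.Basis κ' ℝ (symmetricMatrices K))

theorem hermitianOf_single [DecidableEq κ] (a : κ) : hermitianOf b (Pi.single a 1) = b a := by
  rw [hermitianOf_eq_sum]; simp [Pi.single_apply]

theorem symmetricOf_single [DecidableEq κ'] (a : κ') : symmetricOf c (Pi.single a 1) = c a := by
  rw [symmetricOf_eq_sum]; simp [Pi.single_apply]

/-- The directions `augMat (b a) 0`, `augMat 0 (c a')` of the augmented source scatter matrix. -/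
noncomputable def augDirection : κ ⊕ κ' → Matrix (Fin K ⊕ Fin K) (Fin K ⊕ Fin K) ℂ :=
  Sum.elim (fun a => augMat (b a) 0) fun a => augMat 0 (c a)

theorem sum_augDirection (v : κ ⊕ κ' → ℝ) : ∑ x, v x • augDirection b c x =
    augMat (hermitianOf b fun a => v (.inl a)) (symmetricOf c fun a => v (.inr a)) := by
  simp only [Fintype.sum_sum_type, augDirection, Sum.elim_inl, Sum.elim_inr, augMat_smul, smul_zero]
  rw [sum_augMat, sum_augMat, augMat_add, hermitianOf_eq_sum, symmetricOf_eq_sum]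
  simp

theorem linearIndependent_augDirection : LinearIndependent ℝ (augDirection b c) := by
  rw [Fintype.linearIndependent_iff]
  intro v hv
  rw [sum_augDirection] at hv
  have h0 : (0 : Matrix (Fin K ⊕ Fin K) (Fin K ⊕ Fin K) ℂ) = augMat 0 0 := by
    ext (i | i) (j | j) <;> simp [augMat]
  rw [h0, augMat_inj] at hv
  rintro (a | a)
  · exact congrFun (hermitianOf_eq_zero b hv.1) a
  · exact congrFun (symmetricOf_eq_zero c hv.2) a

/-- An augmented matrix is Hermitian exactly when its blocks are Hermitian and complex symmetric, so
the nuisance coordinates reach every perturbation that the tangent decomposition requires. -/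
theorem mem_span_augDirection {Z : Matrix (Fin K ⊕ Fin K) (Fin K ⊕ Fin K) ℂ} (hZ : IsAugmented Z)
    (hH : Z.IsHermitian) : Z ∈ Submodule.span ℝ (Set.range (augDirection b c)) := by
  obtain ⟨B, C, rfl⟩ := hZ
  rw [Matrix.IsHermitian, augMat_conjTranspose, augMat_inj] at hH
  obtain ⟨v, hv⟩ := exists_hermitianOf_eq b hH.1
  obtain ⟨w, hw⟩ := exists_symmetricOf_eq c hH.2
  refine (Submodule.mem_span_range_iff_exists_fun ℝ).2 ⟨Sum.elim v w, ?_⟩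
  rw [sum_augDirection]
  simp [hv, hw]

theorem isHermitian_augMat {B C : Matrix (Fin K) (Fin K) ℂ} (hB : B.IsHermitian) (hC : Cᵀ = C) :
    (augMat B C).IsHermitian := by
  rw [Matrix.IsHermitian, augMat_conjTranspose, hB.eq, hC]

theorem linearIndependent_hermitian :
    LinearIndependent ℝ fun a => (b a : Matrix (Fin K) (Fin K) ℂ) := by
  rw [Fintype.linearIndependent_iff]
  intro v hv
  rw [← hermitianOf_eq_sum] at hv
  exact fun a => congrFun (hermitianOf_eq_zero b hv) a

theorem mem_span_hermitian {Z : Matrix (Fin K) (Fin K) ℂ} (hH : Z.IsHermitian) :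
    Z ∈ Submodule.span ℝ (Set.range fun a => (b a : Matrix (Fin K) (Fin K) ℂ)) := by
  obtain ⟨v, hv⟩ := exists_hermitianOf_eq b hH
  exact (Submodule.mem_span_range_iff_exists_fun ℝ).2 ⟨v, by rw [← hermitianOf_eq_sum, hv]⟩

end Tangents

/-! ### Efficient information in the two cases -/

section Models

variable {L M K T : ℕ} {κ κ' : Type*} [Fintype κ] [DecidableEq κ] [Fintype κ'] [DecidableEq κ']

theorem isUnit_conjTranspose_mul_self {A : Matrix (Fin M) (Fin K) ℂ} (h : A.rank = K) :
    IsUnit (Aᴴ * A) :=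
  isUnit_of_rank_eq_card (by rw [Matrix.rank_conjTranspose_mul_self, h, Fintype.card_fin])

theorem circular_efficientInformation (hKM : K < M) (hT : 0 < T)
    (b : Module.Basis κ ℝ (selfAdjoint (Matrix (Fin K) (Fin K) ℂ)))
    (g : ℝ → ℝ) (hg : IsDensityGenerator M g) (hξ : FiniteXi₂ M g)
    (A : (Fin L → ℝ) → Matrix (Fin M) (Fin K) ℂ) (θ : Fin L → ℝ)
    (hA : ∀ k i j, LineDifferentiableAt ℝ (fun a => A a i j) θ (Pi.single k 1))
    (hrank : (A θ).rank = K) (σ2 : ℝ) (hσ : 0 < σ2) (ρ : κ → ℝ)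
    (hR : (hermitianOf b ρ).PosSemidef) :
    let p := iidDensity T (circularModel g A b)
    let α : Fin L ⊕ (κ ⊕ Unit) → ℝ := Sum.elim θ (Sum.elim ρ fun _ => σ2)
    let J := fisherInformation p α
    FisherRegular p α ∧ IsUnit J.toBlocks₂₂ ∧
      efficientInformation J = (T : ℝ) • Matrix.of fun k l => 2 * xi₂ M g / σ2 *
        (projPerp (A θ) * partialMat A θ l * hermitianOf b ρ * (A θ)ᴴ *
          (mixtureScatter (A θ) (hermitianOf b ρ) σ2)⁻¹ * A θ * hermitianOf b ρ *
            (partialMat A θ k)ᴴ).trace.re := by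
  intro p α J
  have hM : 0 < M := by omega
  have hMr : (0 : ℝ) < M := by exact_mod_cast hM
  have hxi := lt_succ_mul_xi₂ hM hg hξ
  have hxi0 : 0 < xi₂ M g := by
    by_contra h
    nlinarith [mul_nonneg (show (0 : ℝ) ≤ M + 1 by positivity) (sub_nonneg.2 (not_lt.1 h))]
  set R := hermitianOf b ρ
  have hB := isUnit_conjTranspose_mul_self hrank
  have hS := mixtureScatter_posDef (B := A θ) hR hσ
  let DB : Fin L ⊕ (κ ⊕ Unit) → Matrix (Fin M) (Fin K) ℂ :=
    Sum.elim (partialMat A θ) fun _ => 0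
  let DR : Fin L ⊕ (κ ⊕ Unit) → Matrix (Fin K) (Fin K) ℂ := fun i =>
    hermitianOf b fun a => (Pi.single i 1 : Fin L ⊕ (κ ⊕ Unit) → ℝ) (.inr (.inl a))
  let D : Fin L ⊕ (κ ⊕ Unit) → Matrix (Fin M) (Fin M) ℂ := fun i =>
    (DB i * R + A θ * DR i) * (A θ)ᴴ + A θ * R * (DB i)ᴴ +
      (((Pi.single i 1 : Fin L ⊕ (κ ⊕ Unit) → ℝ) (.inr (.inr ())) : ℝ) : ℂ) • 1
  let S : Fin L ⊕ (κ ⊕ Unit) → ℝ → Matrix (Fin M) (Fin M) ℂ := fun i r =>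
    let β : Fin L ⊕ (κ ⊕ Unit) → ℝ := α + r • Pi.single i 1
    mixtureScatter (A fun k => β (.inl k)) (hermitianOf b fun a => β (.inr (.inl a)))
      (β (.inr (.inr ())))
  have hder : ∀ i x y, HasDerivAt (fun r => S i r x y) (D i x y) 0 := by
    intro i x y
    have h := hasDerivAt_mixtureScatter (hasDerivAt_steering hA (Sum.elim ρ fun _ => σ2) i)
      (hasDerivAt_hermitianOf b fun a =>
        hasDerivAt_add_smul_apply α (Pi.single i 1) (.inr (.inl a)))
      (hasDerivAt_add_smul_apply α (Pi.single i 1) (.inr (.inr ()))) x y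
    simp only [zero_smul, add_zero] at h
    exact h
  have hS0 : ∀ i, S i 0 = mixtureScatter (A θ) R σ2 := fun i => by
    simp only [S, zero_smul, add_zero]
    rfl
  -- The rewriting needs a positive determinant, known only near the true parameter by continuity;
  -- `R_s` may be singular there, so perturbed source matrices need not be semidefinite.
  have hcirc : ∀ i, ∀ᶠ r in nhds (0 : ℝ), ∀ z, circularModel g A b (α + r • Pi.single i 1) z =
      noncircularCESDensity g (augMat (S i r) 0) z := by
    intro i
    have hc : ContinuousAt (S i) 0 :=
      continuousAt_pi.2 fun x => continuousAt_pi.2 fun y => (hder i x y).continuousAt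
    have hd : ContinuousAt (fun r => (S i r).det.re) 0 :=
      (Complex.continuous_re.comp (continuous_id.matrix_det)).continuousAt.comp hc
    have hpos : 0 < (S i 0).det.re := by
      rw [hS0 i]
      exact (Complex.pos_iff.1 hS.det_pos).1
    filter_upwards [hd.eventually (lt_mem_nhds hpos)] with r hr z
    exact circularCESDensity_eq g
      (isHermitian_mixtureScatter _ (hermitianOf_isHermitian b _) _) hr z
  have hp0 : ∀ z, circularModel g A b α z =
      noncircularCESDensity g (augMat (mixtureScatter (A θ) R σ2) 0) z := fun z =>
    circularCESDensity_eq g hS.isHermitian (Complex.pos_iff.1 hS.det_pos).1 z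
  have hDh : ∀ i, (D i).IsHermitian := fun i =>
    isHermitian_tangent _ _ hR.isHermitian (hermitianOf_isHermitian b _) _
  obtain ⟨hreg, hJ⟩ := fisherInformation_scatter hM hg hξ T (α := α)
    (D := fun i => augMat (D i) 0) hcirc hp0
    (fun i => by rw [hS0 i]) (fun i r => isAugmented_augMat _ _) (isAugmented_augMat _ _)
    (augMat_zero_posDef hS)
    (fun i => hasDerivAt_augMat (hder i) fun x y => hasDerivAt_const _ _)
    (fun i => isAugmented_augMat _ _) fun i => by
      rw [Matrix.IsHermitian, augMat_conjTranspose, (hDh i).eq, Matrix.transpose_zero]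
  -- Each augmented trace doubles, so the coefficients `ξ₂/2` and `(ξ₂-1)/4` become `ξ₂` and `ξ₂-1`.
  have hJ' : J = (T : ℝ) • Matrix.of fun i j =>
      infoForm (xi₂ M g) (xi₂ M g - 1) (mixtureScatter (A θ) R σ2) (D i) (D j) := by
    refine hJ.trans ?_
    congr 1
    ext i j
    simp only [Matrix.of_apply]
    rw [inv_augMat_zero hS.isUnit]
    simp only [augMat_zero_mul, Matrix.mul_zero, trace_augMat_re, infoForm]
    ring
  refine ⟨hreg, efficientInformation_mixture (a := xi₂ M g) (b := xi₂ M g - 1)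
    (E := fun a => (b a : Matrix (Fin K) (Fin K) ℂ)) (D := D) hxi0 ?_ hB
    (by simpa using hKM) hR hσ (fun a => (b a).2) (linearIndependent_hermitian b)
    (fun k => mem_span_hermitian b (nuisanceTangent_isHermitian _ _)) ?_ ?_ ?_ hT hJ'⟩
  -- The positivity condition `ξ₂ + (ξ₂-1)M > 0` is `(M+1)ξ₂ > M`.
  · rw [Fintype.card_fin]; linarith
  · intro k
    have h0 : DR (.inl k) = 0 := by
      simp [DR, hermitianOf_eq_sum]
    simp [D, DB, h0, Matrix.mul_assoc, hR.isHermitian.eq]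
  · intro a
    have h1 : DR (.inr (.inl a)) = b a := by
      rw [← hermitianOf_single b a]
      simp only [DR]
      congr 1
      ext a'
      simp [Pi.single_apply]
    simp [D, DB, h1]
  · have h0 : DR (.inr (.inr ())) = 0 := by
      simp [DR, hermitianOf_eq_sum]
    simp [D, DB, h0]

theorem noncircular_efficientInformation (hKM : K < M) (hT : 0 < T)
    (b : Module.Basis κ ℝ (selfAdjoint (Matrix (Fin K) (Fin K) ℂ)))
    (c : Module.Basis κ' ℝ (symmetricMatrices K))
    (g : ℝ → ℝ) (hg : IsDensityGenerator M g) (hξ : FiniteXi₂ M g)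
    (A : (Fin L → ℝ) → Matrix (Fin M) (Fin K) ℂ) (θ : Fin L → ℝ)
    (hA : ∀ k i j, LineDifferentiableAt ℝ (fun a => A a i j) θ (Pi.single k 1))
    (hrank : (A θ).rank = K) (σ2 : ℝ) (hσ : 0 < σ2) (ρ : κ → ℝ) (ρ' : κ' → ℝ)
    (hR : (augMat (hermitianOf b ρ) (symmetricOf c ρ')).PosSemidef) :
    let p := iidDensity T (noncircularModel g A b c)
    let α : Fin L ⊕ ((κ ⊕ κ') ⊕ Unit) → ℝ :=
      Sum.elim θ (Sum.elim (Sum.elim ρ ρ') fun _ => σ2)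
    let J := fisherInformation p α
    let R := augMat (hermitianOf b ρ) (symmetricOf c ρ')
    let B := augMat (A θ) 0
    let B' := fun k => augMat (partialMat A θ k) 0
    FisherRegular p α ∧ IsUnit J.toBlocks₂₂ ∧
      efficientInformation J = (T : ℝ) • Matrix.of fun k l => xi₂ M g / σ2 *
        (projPerp B * B' l * R * Bᴴ * (mixtureScatter B R σ2)⁻¹ * B * R * (B' k)ᴴ).trace.re := by
  intro p α J R B B'
  have hM : 0 < M := by omega
  have hMr : (0 : ℝ) < M := by exact_mod_cast hM
  have hxi := lt_succ_mul_xi₂ hM hg hξ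
  have hxi0 : 0 < xi₂ M g := by
    by_contra h
    nlinarith [mul_nonneg (show (0 : ℝ) ≤ M + 1 by positivity) (sub_nonneg.2 (not_lt.1 h))]
  have hB0 := isUnit_conjTranspose_mul_self hrank
  have hBB : Bᴴ * B = augMat ((A θ)ᴴ * A θ) 0 := by
    simp only [B]
    rw [augMat_conjTranspose, Matrix.transpose_zero, augMat_zero_mul, Matrix.mul_zero]
  have hB : IsUnit (Bᴴ * B) := hBB ▸ isUnit_augMat_zero hB0
  have hG := mixtureScatter_posDef (B := B) hR hσ
  let DB : Fin L ⊕ ((κ ⊕ κ') ⊕ Unit) → Matrix (Fin M) (Fin K) ℂ :=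
    Sum.elim (partialMat A θ) fun _ => 0
  let DR : Fin L ⊕ ((κ ⊕ κ') ⊕ Unit) → Matrix (Fin K) (Fin K) ℂ := fun i =>
    hermitianOf b fun a => (Pi.single i 1 : Fin L ⊕ ((κ ⊕ κ') ⊕ Unit) → ℝ) (.inr (.inl (.inl a)))
  let DC : Fin L ⊕ ((κ ⊕ κ') ⊕ Unit) → Matrix (Fin K) (Fin K) ℂ := fun i =>
    symmetricOf c fun a => (Pi.single i 1 : Fin L ⊕ ((κ ⊕ κ') ⊕ Unit) → ℝ) (.inr (.inl (.inr a)))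
  let D : Fin L ⊕ ((κ ⊕ κ') ⊕ Unit) → Matrix (Fin M ⊕ Fin M) (Fin M ⊕ Fin M) ℂ := fun i =>
    (augMat (DB i) 0 * R + B * augMat (DR i) (DC i)) * Bᴴ + B * R * (augMat (DB i) 0)ᴴ +
      (((Pi.single i 1 : Fin L ⊕ ((κ ⊕ κ') ⊕ Unit) → ℝ) (.inr (.inr ())) : ℝ) : ℂ) • 1
  let Γ : Fin L ⊕ ((κ ⊕ κ') ⊕ Unit) → ℝ → Matrix (Fin M ⊕ Fin M) (Fin M ⊕ Fin M) ℂ := fun i r =>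
    let β : Fin L ⊕ ((κ ⊕ κ') ⊕ Unit) → ℝ := α + r • Pi.single i 1
    mixtureScatter (augMat (A fun k => β (.inl k)) 0)
      (augMat (hermitianOf b fun a => β (.inr (.inl (.inl a))))
        (symmetricOf c fun a => β (.inr (.inl (.inr a)))))
      (β (.inr (.inr ())))
  have hder : ∀ i x y, HasDerivAt (fun r => Γ i r x y) (D i x y) 0 := by
    intro i x y
    have h := hasDerivAt_mixtureScatter
      (hasDerivAt_augMat
        (hasDerivAt_steering hA (Sum.elim (Sum.elim ρ ρ') fun _ => σ2) i)
        (Y := fun _ => 0) (Y' := 0) fun x y => hasDerivAt_const _ _)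
      (hasDerivAt_augMat
        (hasDerivAt_hermitianOf b fun a =>
          hasDerivAt_add_smul_apply α (Pi.single i 1) (.inr (.inl (.inl a))))
        (hasDerivAt_symmetricOf c fun a =>
          hasDerivAt_add_smul_apply α (Pi.single i 1) (.inr (.inl (.inr a)))))
      (hasDerivAt_add_smul_apply α (Pi.single i 1) (.inr (.inr ()))) x y
    simp only [zero_smul, add_zero] at h
    exact h
  have hΓ0 : ∀ i, Γ i 0 = mixtureScatter B R σ2 := fun i => by
    simp only [Γ, zero_smul, add_zero]
    rfl
  obtain ⟨hreg, hJ⟩ := fisherInformation_scatter hM hg hξ T (p := noncircularModel g A b c)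
    (α := α) (G := mixtureScatter B R σ2) (Γ := Γ) (D := D)
    (fun i => Filter.Eventually.of_forall fun r z => rfl) (fun z => rfl) hΓ0
    (fun i r => isAugmented_mixtureScatter (isAugmented_augMat _ _) (isAugmented_augMat _ _) _)
    (isAugmented_mixtureScatter (isAugmented_augMat _ _) (isAugmented_augMat _ _) _) hG hder
    (fun i => (((((isAugmented_augMat _ _).mul (isAugmented_augMat _ _)).add
      ((isAugmented_augMat _ _).mul (isAugmented_augMat _ _))).mul
        (isAugmented_augMat _ _).conjTranspose).add (((isAugmented_augMat _ _).mul
          (isAugmented_augMat _ _)).mul (isAugmented_augMat _ _).conjTranspose)).add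
            (isAugmented_smul_one _))
    fun i => isHermitian_tangent _ _ hR.isHermitian (isHermitian_augMat
      (hermitianOf_isHermitian b _) (symmetricOf_transpose c _)) _
  have haug0 : (augMat 0 0 : Matrix (Fin K ⊕ Fin K) (Fin K ⊕ Fin K) ℂ) = 0 := by
    ext (i | i) (j | j) <;> simp [augMat]
  have haug0' : (augMat 0 0 : Matrix (Fin M ⊕ Fin M) (Fin K ⊕ Fin K) ℂ) = 0 := by
    ext (i | i) (j | j) <;> simp [augMat]
  -- The order is now `2M`, so `a + b·2M` is half of its circular counterpart and the same
  -- inequality applies.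
  have key := efficientInformation_mixture (a := xi₂ M g / 2) (b := (xi₂ M g - 1) / 4) (B' := B')
    (E := augDirection b c) (D := D) (by positivity) (by
      rw [Fintype.card_sum, Fintype.card_fin]; push_cast; linarith) hB
    (by simp only [Fintype.card_sum, Fintype.card_fin]; omega) hR hσ
    (by
      rintro (a | a)
      · exact isHermitian_augMat (b a).2 Matrix.transpose_zero
      · exact isHermitian_augMat Matrix.isHermitian_zero (c a).2)
    (linearIndependent_augDirection b c)
    (fun k => mem_span_augDirection b c (by
      have h : IsAugmented ((Bᴴ * B)⁻¹ * Bᴴ * (B' k * R)) :=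
        (((((isAugmented_augMat _ _).conjTranspose).mul (isAugmented_augMat _ _)).inv).mul
          (isAugmented_augMat _ _).conjTranspose).mul
            ((isAugmented_augMat _ _).mul (isAugmented_augMat _ _))
      exact h.add h.conjTranspose) (nuisanceTangent_isHermitian _ _))
    (by
      intro k
      have h0 : DR (.inl k) = 0 := by simp [DR, hermitianOf_eq_sum]
      have h1 : DC (.inl k) = 0 := by simp [DC, symmetricOf_eq_sum]
      simp [D, DB, B', h0, h1, haug0, Matrix.mul_assoc, hR.isHermitian.eq, R])
    (by
      rintro (a | a)
      · have h0 : DR (.inr (.inl (.inl a))) = b a := by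
          rw [← hermitianOf_single b a]
          simp only [DR]
          congr 1
          ext a'
          simp [Pi.single_apply]
        have h1 : DC (.inr (.inl (.inl a))) = 0 := by simp [DC, symmetricOf_eq_sum]
        simp [D, DB, h0, h1, haug0', augDirection]
      · have h0 : DR (.inr (.inl (.inr a))) = 0 := by simp [DR, hermitianOf_eq_sum]
        have h1 : DC (.inr (.inl (.inr a))) = c a := by
          rw [← symmetricOf_single c a]
          simp only [DC]
          congr 1
          ext a'
          simp [Pi.single_apply]
        simp [D, DB, h0, h1, haug0', augDirection])
    (by
      have h0 : DR (.inr (.inr ())) = 0 := by simp [DR, hermitianOf_eq_sum]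
      have h1 : DC (.inr (.inr ())) = 0 := by simp [DC, symmetricOf_eq_sum]
      simp [D, DB, h0, h1, haug0, haug0'])
    hT hJ
  rw [mul_div_cancel₀ _ (two_ne_zero' ℝ)] at key
  exact ⟨hreg, key⟩

/-- The two expressions of the information in the noncircular case. -/
theorem trace_augmented_information {A A' A'' : Matrix (Fin M) (Fin K) ℂ} (hA : IsUnit (Aᴴ * A))
    (R C : Matrix (Fin K) (Fin K) ℂ) (s : ℝ) :
    (projPerp (augMat A 0) * augMat A' 0 * augMat R C * (augMat A 0)ᴴ *
      (mixtureScatter (augMat A 0) (augMat R C) s)⁻¹ * augMat A 0 * augMat R C *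
        (augMat A'' 0)ᴴ).trace.re =
    2 * (projPerp A * A' * (Matrix.fromCols (R * Aᴴ) (C * Aᵀ) *
      (mixtureScatter (augMat A 0) (augMat R C) s)⁻¹ *
        Matrix.fromRows (A * R) (A.map conj * C.map conj)) * A''ᴴ).trace.re := by
  set G := mixtureScatter (augMat A 0) (augMat R C) s with hG
  have hGa : IsAugmented G⁻¹ :=
    (isAugmented_mixtureScatter (isAugmented_augMat _ _) (isAugmented_augMat _ _) _).inv
  have hRA : augMat R C * (augMat A 0)ᴴ = augMat (R * Aᴴ) (C * Aᵀ) := by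
    rw [augMat_conjTranspose, Matrix.transpose_zero, augMat_mul_zero]
    congr 2
    ext; simp
  have hAR : augMat A 0 * augMat R C = augMat (A * R) (A * C) := augMat_zero_mul _ _ _
  have hconj : (A * C).map conj = A.map conj * C.map conj := Matrix.map_mul (f := starRingEnd ℂ)
  -- The middle product is augmented and its first block is the matrix `H` of the statement. The
  -- outer factors are block diagonal, so only that block enters the trace.
  obtain ⟨X, Y, hN⟩ := ((isAugmented_augMat (R * Aᴴ) (C * Aᵀ)).mul hGa).mul
    (isAugmented_augMat (A * R) (A * C))
  have hX : X = Matrix.fromCols (R * Aᴴ) (C * Aᵀ) * G⁻¹ *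
      Matrix.fromRows (A * R) (A.map conj * C.map conj) := by
    have h := congrArg Matrix.toBlocks₁₁ hN
    rw [show (augMat X Y).toBlocks₁₁ = X from rfl] at h
    rw [← h, ← hconj]
    ext i j
    simp only [Matrix.toBlocks₁₁, Matrix.of_apply, Matrix.mul_apply, Fintype.sum_sum_type]
    rfl
  calc _ = (projPerp (augMat A 0) * augMat A' 0 * (augMat R C * (augMat A 0)ᴴ * G⁻¹ *
        (augMat A 0 * augMat R C)) * (augMat A'' 0)ᴴ).trace.re := by
        simp only [Matrix.mul_assoc]
    _ = _ := by
        rw [hRA, hAR, hN, projPerp_augMat hA, augMat_conjTranspose, Matrix.transpose_zero,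
          augMat_zero_mul, Matrix.mul_zero, augMat_zero_mul, augMat_mul_zero, trace_augMat_re, ← hX]

end Models

theorem mainTheorem2 {L M K T : ℕ} (hKM : K < M) (hT : 0 < T)
    {κ κ' : Type*} [Fintype κ] [DecidableEq κ] [Fintype κ'] [DecidableEq κ']
    (b : Module.Basis κ ℝ (selfAdjoint (Matrix (Fin K) (Fin K) ℂ)))
    (c : Module.Basis κ' ℝ (symmetricMatrices K))
    (g : ℝ → ℝ) (hg : IsDensityGenerator M g) (hξ : FiniteXi₂ M g)
    (A : (Fin L → ℝ) → Matrix (Fin M) (Fin K) ℂ) (θ : Fin L → ℝ)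
    (hA : ∀ k i j, LineDifferentiableAt ℝ (fun a => A a i j) θ (Pi.single k 1))
    (hrank : (A θ).rank = K) (σ2 : ℝ) (hσ : 0 < σ2) :
    -- circular case
    (∀ ρ : κ → ℝ, (hermitianOf b ρ).PosSemidef →
      let p := iidDensity T (circularModel g A b)
      let α : Fin L ⊕ (κ ⊕ Unit) → ℝ := Sum.elim θ (Sum.elim ρ fun _ => σ2)
      let J := fisherInformation p α
      let R := hermitianOf b ρ
      let S := mixtureScatter (A θ) R σ2
      let F : Matrix (Fin L) (Fin L) ℝ := Matrix.of fun k l =>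
        2 * xi₂ M g / σ2 *
          (projPerp (A θ) * partialMat A θ l * R * (A θ)ᴴ * S⁻¹ * A θ * R *
            (partialMat A θ k)ᴴ).trace.re
      FisherRegular p α ∧ IsUnit J.toBlocks₂₂ ∧
      (∀ k l, 1 / (T : ℝ) * efficientInformation J k l = F k l) ∧
      (IsUnit J ↔ IsUnit F) ∧
      (IsUnit J → IsUnit (crbBlock J) ∧ ∀ k l, 1 / (T : ℝ) * (crbBlock J)⁻¹ k l = F k l)) ∧
    -- noncircular case
    (∀ (ρ : κ → ℝ) (ρ' : κ' → ℝ), (augMat (hermitianOf b ρ) (symmetricOf c ρ')).PosSemidef →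
      let p := iidDensity T (noncircularModel g A b c)
      let α : Fin L ⊕ ((κ ⊕ κ') ⊕ Unit) → ℝ :=
        Sum.elim θ (Sum.elim (Sum.elim ρ ρ') fun _ => σ2)
      let J := fisherInformation p α
      let R := hermitianOf b ρ
      let C := symmetricOf c ρ'
      let B := augMat (A θ) 0
      let B' := fun k => augMat (partialMat A θ k) 0
      let G := mixtureScatter B (augMat R C) σ2
      let H := Matrix.fromCols (R * (A θ)ᴴ) (C * (A θ)ᵀ) * G⁻¹ *
        Matrix.fromRows (A θ * R) ((A θ).map conj * C.map conj)
      let F : Matrix (Fin L) (Fin L) ℝ := Matrix.of fun k l =>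
        2 * xi₂ M g / σ2 *
          (projPerp (A θ) * partialMat A θ l * H * (partialMat A θ k)ᴴ).trace.re
      FisherRegular p α ∧ IsUnit J.toBlocks₂₂ ∧
      (∀ k l, F k l = xi₂ M g / σ2 *
        (projPerp B * B' l * augMat R C * Bᴴ * G⁻¹ * B * augMat R C * (B' k)ᴴ).trace.re) ∧
      (∀ k l, 1 / (T : ℝ) * efficientInformation J k l = F k l) ∧
      (IsUnit J ↔ IsUnit F) ∧
      (IsUnit J → IsUnit (crbBlock J) ∧ ∀ k l, 1 / (T : ℝ) * (crbBlock J)⁻¹ k l = F k l)) := by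
  constructor
  · intro ρ hR p α J R S F
    obtain ⟨hreg, hu, heff⟩ :=
      circular_efficientInformation hKM hT b g hg hξ A θ hA hrank σ2 hσ ρ hR
    exact ⟨hreg, crb_of_efficientInformation hT hu heff⟩
  · intro ρ ρ' hR p α J R C B B' G H F
    obtain ⟨hreg, hu, heff⟩ :=
      noncircular_efficientInformation hKM hT b c g hg hξ A θ hA hrank σ2 hσ ρ ρ' hR
    have hF : ∀ k l, F k l = xi₂ M g / σ2 *
        (projPerp B * B' l * augMat R C * Bᴴ * G⁻¹ * B * augMat R C * (B' k)ᴴ).trace.re :=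
      fun k l => by
        have h := trace_augmented_information (A' := partialMat A θ l) (A'' := partialMat A θ k)
          (isUnit_conjTranspose_mul_self hrank) R C σ2
        simp only [F, B, B', G, Matrix.of_apply] at h ⊢
        rw [h]
        ring
    have hF' : efficientInformation J = (T : ℝ) • F := by
      refine heff.trans ?_
      congr 1
      ext k l
      exact (hF k l).symm
    obtain ⟨h1, h2, h3, h4⟩ := crb_of_efficientInformation hT hu hF'
    exact ⟨hreg, h1, hF, h2, h3, h4⟩
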